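/- Let $\Delta=\sum_{m\ge 0}q^{(2m+1)^2}\in\mathbf F_2[[q]]$ (the reduction mod $2$ of $\sum_n\tau(n)q^n$), and for $n\ge 1$ let $\mathcal F(n)\subset\mathbf F_2[[q]]$ be the span of $\Delta,\Delta^3,\dots,\Delta^{2n-1}$. For an odd prime $p$ let $T_p$ be the Hecke operator on $\mathbf F_2[[q]]$ for which the coefficient of $q^m$ in $T_pf$ is $a_{pm}(f)$, plus $a_{m/p}(f)$ if $p\mid m$; it preserves every $\mathcal F(n)$. Let $A(n)\subset\operatorname{End}(\mathcal F(n))$ be the $\mathbf F_2$-subalgebra generated by all $T_p$ ($p$ an odd prime), and let $A=\varprojlim A(n)$ (transition maps: restriction), with the projective limit topology of the discrete finite rings $A(n)$. Each $T_p$ is an element of $A$ and has a unique expansion, convergent in $A$, $$T_p=\sum_{i,j\ge 0}a_{ij}(p)\,T_3^{\,i}T_5^{\,j},\qquad a_{ij}(p)\in\mathbf F_2,\qquad a_{00}(p)=0 .$$ For every odd prime $p$: - $a_{10}(p)=1$ if and only if $p\equiv 3\pmod 8$; - $a_{01}(p)=1$ if and only if $p\equiv 5\pmod 8$; - $a_{11}(p)=1$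 if and only if $p\equiv 7\pmod{16}$; - $a_{20}(p)=1$ if and only if $p=a^2+8b^2$ for some $a,b\in\mathbf Z$ with $b$ odd; - $a_{02}(p)=1$ if and only if $p=a^2+16b^2$ for some $a,b\in\mathbf Z$ with $b$ odd. Moreover, for all primes $p\equiv 3\pmod 8$ and $p'\equiv 5\pmod 8$, the algebra $A$ is topologically generated by $T_p$ and $T_{p'}$, i.e. the $\mathbf F_2$-subalgebra generated by $T_p$ and $T_{p'}$ is dense in $A$. -/

import Mathlib

namespace HeckeModTwo

open PowerSeries

/-- `Δ = ∑_{m ≥ 0} q^{(2m+1)²}` in `𝔽₂[[q]]` (the reduction modulo `2` of `∑ τ(n) qⁿ`). -/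
noncomputable def Delta : PowerSeries (ZMod 2) :=
  open Classical in PowerSeries.mk fun n => if ∃ m : ℕ, n = (2 * m + 1) ^ 2 then 1 else 0

/-- The space with basis `Δ, Δ³, …, Δ^{2n-1}`. -/
noncomputable def cuspSpace (n : ℕ) : Submodule (ZMod 2) (PowerSeries (ZMod 2)) :=
  Submodule.span (ZMod 2) ((fun i : ℕ => Delta ^ (2 * i + 1)) '' {i | i < n})

theorem cuspSpace_le_succ (n : ℕ) : cuspSpace n ≤ cuspSpace (n + 1) :=
  Submodule.span_mono (Set.image_mono fun _ hi => Nat.lt_succ_of_lt hi)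

/-- The Hecke operator `T_p` modulo `2` (intended for `p` an odd prime): the coefficient of `qⁿ`
in `T_p f` is `a_{pn}(f)`, plus `a_{n/p}(f)` if `p ∣ n`. -/
noncomputable def heckeOp (p : ℕ) : Module.End (ZMod 2) (PowerSeries (ZMod 2)) where
  toFun f := PowerSeries.mk fun n =>
    coeff (p * n) f + if p ∣ n then coeff (n / p) f else 0
  map_add' f g := by
    ext n
    simp only [coeff_mk, map_add]
    split_ifs <;> ring
  map_smul' c f := by
    ext n
    simp only [coeff_mk, map_smul, RingHom.id_apply, smul_eq_mul]
    split_ifs <;> ring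

/-- The subalgebra `A(n)` of `End(F(n))` generated over `𝔽₂` by the (restrictions to `F(n)` of the)
operators `T_p`, `p` an odd prime. -/
noncomputable def heckeAlgebraAt (n : ℕ) :
    Subalgebra (ZMod 2) (Module.End (ZMod 2) (cuspSpace n)) :=
  Algebra.adjoin (ZMod 2)
    {u | ∃ p : ℕ, p.Prime ∧ p ≠ 2 ∧ ∀ f : cuspSpace n,
      (u f : PowerSeries (ZMod 2)) = heckeOp p f}

/-- The finite algebra `A(n)` carries the discrete topology. -/
instance heckeAlgebraAtTopology (n : ℕ) : TopologicalSpace (heckeAlgebraAt n) := ⊥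

/-- The projective limit `A` of the algebras `A(n)`, the transition maps being the restrictions
from `F(n+1)` to `F(n)`.  As a subtype of `∏ A(n)` it carries the projective limit topology. -/
noncomputable def heckeAlgebra : Subalgebra (ZMod 2) (∀ n : ℕ, heckeAlgebraAt n) where
  carrier := {u | ∀ (n : ℕ) (f : cuspSpace n),
    (u (n + 1)).1 (Submodule.inclusion (cuspSpace_le_succ n) f) =
      Submodule.inclusion (cuspSpace_le_succ n) ((u n).1 f)}
  mul_mem' {u v} hu hv n f := by
    have h1 := hv n f
    have h2 := hu n ((v n).1 f)
    simp only [Pi.mul_apply, MulMemClass.coe_mul, Module.End.mul_apply]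
    rw [h1, h2]
  add_mem' {u v} hu hv n f := by
    have h1 := hv n f
    have h2 := hu n f
    simp only [Pi.add_apply, AddMemClass.coe_add, LinearMap.add_apply, map_add]
    rw [h1, h2]
  algebraMap_mem' c n f := by
    simp [Module.algebraMap_end_apply]

/-- `t ∈ A` is the element that acts on every `F(n)` as the Hecke operator `T_p`. -/
def ActsAsHecke (p : ℕ) (t : heckeAlgebra) : Prop :=
  ∀ (n : ℕ) (f : cuspSpace n), (((t.1 n).1 f : cuspSpace n) : PowerSeries (ZMod 2)) = heckeOp p f

/-- `t = ∑_{i,j} c_{ij} xⁱ yʲ` as a convergent sum in the topological ring `A`. -/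
def IsExpansion (x y t : heckeAlgebra) (c : ℕ → ℕ → ZMod 2) : Prop :=
  HasSum (fun ij : ℕ × ℕ => c ij.1 ij.2 • (x ^ ij.1 * y ^ ij.2)) t

end HeckeModTwo

/-! The method is that of Nicolas and Serre. Since a_1(T_p f) = a_p(f), the pairing (T, f) ↦ a_1(T
f) turns the expansion of T_p into a question of duality. If m(i,j) is the basis of the span of the
odd powers of Δ dual to the monomials T_3^i T_5^j (`dualBasis`), then T_p = ∑ a_p(m(i,j)) T_3^i
T_5^j, a finite sum on every F(n) (`heckeOp_eq_sum`).

The dual basis exists by triangularity. Level-one forms with integral coefficients show that T_p Δ^k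
is a polynomial of degree at most k in Δ (`heckeOp_Delta_pow_mem_span`). With this bound, the
modular equations relating Δ(q) to Δ(q^3) and Δ(q^5) need only finitely many coefficients. They
yield linear recurrences, hence closed formulas for T_3 Δ^k and T_5 Δ^k with binomial coefficients
modulo 2. Write an exponent as 2L+1, let a and b be the numbers formed by the binary digits of L in
even and in odd positions, and order by (a+b, b) lexicographically. Then T_3 lowers a by one and T_5
lowers b by one, up to smaller terms (`heckeOp_three_Delta_pow_encode`,
`heckeOp_five_Delta_pow_encode`). Hence the pairing is unitriangular and large monomials vanish on
each F(n).

The dual vectors for (0,0), (1,0), (0,1), (1,1), (2,0), (0,2) are Δ, Δ^3, Δ^5, Δ^7, Δ^9, Δ^17, so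
only their p-th coefficients remain. By Frobenius, Δ^(1+2^i) = Δ(q) Δ(q^(2^i)), which counts p = x²
+ 2^i y² with x, y odd and positive; such a representation is unique. Jacobi's theorem on four odd
squares gives the parity of (p+1)/4 for Δ^3 when p ≡ 3 mod 4, and of (p+1)/8 for Δ^7 when p ≡ 7 mod
8.

For the generators: if p ≡ 3 and p' ≡ 5 mod 8, then T_p and T_p' agree with T_3 and T_5 up to
monomials of degree at least 2. Nilpotence on F(n) then makes them generate A(n), and density in the
limit follows. -/

namespace HeckeModTwo

/-! ### The Hecke operator on complex modular forms of level one. -/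

section ClassicalHecke

open UpperHalfPlane ModularForm MatrixGroups Matrix.SpecialLinearGroup

/-- The matrix `(1 j; 0 p)`. -/
noncomputable def heckeMatrix (p : ℕ) [NeZero p] (j : ℤ) : GL (Fin 2) ℝ :=
  Matrix.GeneralLinearGroup.mkOfDetNeZero !![1, (j : ℝ); 0, (p : ℝ)]
    (by simpa using NeZero.ne p)

/-- The matrix `(p 0; 0 1)`. -/
noncomputable def heckeMatrixInfty (p : ℕ) [NeZero p] : GL (Fin 2) ℝ :=
  Matrix.GeneralLinearGroup.mkOfDetNeZero !![(p : ℝ), 0; 0, 1] (by simpa using NeZero.ne p)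

@[simp] theorem coe_heckeMatrix (p : ℕ) [NeZero p] (j : ℤ) :
    (heckeMatrix p j : Matrix (Fin 2) (Fin 2) ℝ) = !![1, (j : ℝ); 0, (p : ℝ)] := rfl

@[simp] theorem coe_heckeMatrixInfty (p : ℕ) [NeZero p] :
    (heckeMatrixInfty p : Matrix (Fin 2) (Fin 2) ℝ) = !![(p : ℝ), 0; 0, 1] := rfl

variable {k : ℤ} (f : ModularForm 𝒮ℒ k) (p : ℕ)

theorem slash_mul_of_coe_eq (γ : SL(2, ℤ)) (A B : GL (Fin 2) ℝ)
    (h : A.1 = γ.1.map (Int.cast : ℤ → ℝ) * B.1) : ⇑f ∣[k] A = ⇑f ∣[k] B := by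
  have : A = mapGL ℝ γ * B := Units.ext (by rw [h]; rfl)
  rw [this, SlashAction.slash_mul, SlashInvariantForm.slash_action_eqn f _ (MonoidHom.mem_range.mpr ⟨γ, rfl⟩)]

/-- Shifting `j` by `p * m` is left multiplication by `T ^ m`, which fixes `f`. -/
theorem slash_heckeMatrix_congr [NeZero p] {i j : ℤ} (h : (i : ZMod p) = j) :
    ⇑f ∣[k] heckeMatrix p i = ⇑f ∣[k] heckeMatrix p j := by
  obtain ⟨m, hm⟩ := (ZMod.intCast_eq_intCast_iff_dvd_sub j i p).1 h.symm
  refine slash_mul_of_coe_eq f (ModularGroup.T ^ m) _ _ ?_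
  have : i = j + p * m := by linarith
  subst this
  ext a b
  fin_cases a <;> fin_cases b <;>
    simp [ModularGroup.coe_T_zpow, Matrix.mul_apply, Fin.sum_univ_two]
  ring

/-- The sum of the translates of `f` by representatives of the left cosets of `SL₂(ℤ)` in the
set of integral matrices of determinant `p`. -/
noncomputable def heckeSum [NeZero p] : UpperHalfPlane → ℂ :=
  ⇑f ∣[k] heckeMatrixInfty p + ∑ j : ZMod p, ⇑f ∣[k] heckeMatrix p (j.val : ℤ)

theorem heckeSum_slash_T [NeZero p] : heckeSum f p ∣[k] ModularGroup.T = heckeSum f p := by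
  rw [SL_slash, heckeSum, SlashAction.add_slash, SlashAction.sum_slash, ← SlashAction.slash_mul]
  congr 1
  · refine slash_mul_of_coe_eq f (ModularGroup.T ^ (p : ℤ)) _ _ ?_
    rw [ModularGroup.coe_T_zpow]
    change _ * ModularGroup.T.1.map (Int.cast : ℤ → ℝ) = _
    ext a b
    fin_cases a <;> fin_cases b <;> simp [Matrix.mul_apply, Fin.sum_univ_two, ModularGroup.T]
  · rw [← Equiv.sum_comp (Equiv.addRight (1 : ZMod p))
      (fun j => ⇑f ∣[k] heckeMatrix p (j.val : ℤ))]
    refine Finset.sum_congr rfl fun j _ => ?_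
    rw [← SlashAction.slash_mul]
    have h1 : heckeMatrix p (j.val : ℤ) * mapGL ℝ ModularGroup.T =
        heckeMatrix p ((j.val : ℤ) + 1) := by
      apply Units.ext
      change _ * ModularGroup.T.1.map (Int.cast : ℤ → ℝ) = _
      ext a b
      fin_cases a <;> fin_cases b <;>
        simp [Matrix.mul_apply, Fin.sum_univ_two, ModularGroup.T]
      ring
    refine (congrArg (⇑f ∣[k] ·) h1).trans ?_
    exact slash_heckeMatrix_congr f p (by simp)

/-- Right multiplication by `S` permutes the p+1 cosets as it acts on the projective line over 𝔽_p:
∞ and 0 are exchanged, and j ≠ 0 goes to -1/j. -/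
theorem heckeSum_slash_S [hp : Fact p.Prime] :
    heckeSum f p ∣[k] ModularGroup.S = heckeSum f p := by
  classical
  have hinf : ⇑f ∣[k] (heckeMatrixInfty p * ModularGroup.S) = ⇑f ∣[k] heckeMatrix p 0 := by
    refine slash_mul_of_coe_eq f ModularGroup.S _ _ ?_
    change _ * ModularGroup.S.1.map (Int.cast : ℤ → ℝ) = _
    ext a b
    fin_cases a <;> fin_cases b <;>
      simp [Matrix.mul_apply, Fin.sum_univ_two, ModularGroup.S]
  have hzero : ⇑f ∣[k] (heckeMatrix p 0 * ModularGroup.S) = ⇑f ∣[k] heckeMatrixInfty p := by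
    refine slash_mul_of_coe_eq f ModularGroup.S _ _ ?_
    change _ * ModularGroup.S.1.map (Int.cast : ℤ → ℝ) = _
    ext a b
    fin_cases a <;> fin_cases b <;>
      simp [Matrix.mul_apply, Fin.sum_univ_two, ModularGroup.S]
  have hne (i j : ℤ) (h : (i * j : ZMod p) = -1) :
      ⇑f ∣[k] (heckeMatrix p i * ModularGroup.S) = ⇑f ∣[k] heckeMatrix p j := by
    have : ((i * j + 1 : ℤ) : ZMod p) = 0 := by push_cast; rw [h]; ring
    obtain ⟨m, hm⟩ := (ZMod.intCast_zmod_eq_zero_iff_dvd _ p).1 this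
    -- The determinant is p m - i j, which equals 1 by the choice of `m`.
    refine slash_mul_of_coe_eq f ⟨!![i, -m; p, -j], ?_⟩ _ _ ?_
    · rw [Matrix.det_fin_two_of]; linarith
    change _ * ModularGroup.S.1.map (Int.cast : ℤ → ℝ) = _
    have hm' : (i : ℝ) * j + 1 = p * m := by exact_mod_cast hm
    ext a b
    fin_cases a <;> fin_cases b <;>
      simp [Matrix.mul_apply, Fin.sum_univ_two, ModularGroup.S]
    · linarith
    · ring
  rw [SL_slash, heckeSum, SlashAction.add_slash, SlashAction.sum_slash, ← SlashAction.slash_mul,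
    hinf]
  simp_rw [← SlashAction.slash_mul]
  rw [← Finset.add_sum_erase _ _ (Finset.mem_univ (0 : ZMod p)),
    ← Finset.add_sum_erase _ (fun j : ZMod p => ⇑f ∣[k] heckeMatrix p (j.val : ℤ))
      (Finset.mem_univ (0 : ZMod p))]
  simp only [ZMod.val_zero, Nat.cast_zero]
  rw [hzero, add_left_comm]
  congr 2
  refine Finset.sum_bij' (fun j _ => -j⁻¹) (fun j _ => -j⁻¹) (by simp) (by simp)
    (by simp [inv_neg]) (by simp [inv_neg]) fun j hj => ?_
  refine hne _ _ ?_
  have hj' : j ≠ 0 := by simpa using hj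
  simp [hj']

theorem hasSum_slash_heckeMatrixInfty [NeZero p] (τ : ℍ) :
    HasSum (fun m => ((if p ∣ m then (p : ℂ) ^ (k - 1) * (qExpansion 1 f).coeff (m / p) else 0) *
      Function.Periodic.qParam 1 τ ^ m)) ((⇑f ∣[k] heckeMatrixInfty p) τ) := by
  have hp0 : p ≠ 0 := NeZero.ne p
  have hdet : (heckeMatrixInfty p).det.val = p := by
    simp [Matrix.GeneralLinearGroup.val_det_apply, Matrix.det_fin_two_of]
  have hpos : 0 < (heckeMatrixInfty p).det.val := by rw [hdet]; positivity
  have hsmul : ((heckeMatrixInfty p • τ : ℍ) : ℂ) = p * τ := by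
    rw [coe_smul_of_det_pos hpos]
    simp [num, denom]
  have hval : (⇑f ∣[k] heckeMatrixInfty p) τ =
      (p : ℂ) ^ (k - 1) * f (heckeMatrixInfty p • τ) := by
    rw [slash_apply, hdet, σ, if_pos hpos]
    simp [denom]
    ring
  have hq : Function.Periodic.qParam 1 ((heckeMatrixInfty p • τ : ℍ) : ℂ) =
      Function.Periodic.qParam 1 τ ^ p := by
    rw [hsmul, Function.Periodic.qParam, Function.Periodic.qParam, ← Complex.exp_nat_mul]
    congr 1
    push_cast
    ring
  have h := (ModularForm.hasSum_qExpansion f one_pos one_mem_strictPeriods_SL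
    (heckeMatrixInfty p • τ)).mul_left ((p : ℂ) ^ (k - 1))
  rw [hval]
  rw [← (mul_right_injective₀ hp0).hasSum_iff (fun m hm => ?_)]
  · refine HasSum.congr_fun h fun m => ?_
    simp [hp0, hq, pow_mul]
    ring
  · have : ¬ p ∣ m := fun ⟨c, hc⟩ => hm ⟨c, hc.symm⟩
    simp [this]

theorem hasSum_sum_slash_heckeMatrix [NeZero p] (τ : ℍ) :
    HasSum (fun m => (qExpansion 1 f).coeff (p * m) * Function.Periodic.qParam 1 τ ^ m)
      ((∑ j : ZMod p, ⇑f ∣[k] heckeMatrix p (j.val : ℤ)) τ) := by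
  have hp0 : p ≠ 0 := NeZero.ne p
  have hp0' : (p : ℂ) ≠ 0 := by exact_mod_cast hp0
  set r : ℂ := Complex.exp (2 * Real.pi * Complex.I * τ / p) with hr
  have hrp : r ^ p = Function.Periodic.qParam 1 τ := by
    rw [hr, ← Complex.exp_nat_mul, Function.Periodic.qParam]
    congr 1
    push_cast
    field_simp
  have hdet (j : ℤ) : (heckeMatrix p j).det.val = p := by
    simp [Matrix.GeneralLinearGroup.val_det_apply, Matrix.det_fin_two_of]
  have hpos (j : ℤ) : 0 < (heckeMatrix p j).det.val := by rw [hdet]; positivity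
  have hsmul (j : ℤ) : ((heckeMatrix p j • τ : ℍ) : ℂ) = (τ + j) / p := by
    rw [coe_smul_of_det_pos (hpos j)]
    simp [num, denom]
  have hval (j : ℤ) : (⇑f ∣[k] heckeMatrix p j) τ = (p : ℂ)⁻¹ * f (heckeMatrix p j • τ) := by
    rw [slash_apply, hdet, σ, if_pos (hpos j)]
    simp [denom, zpow_sub₀ hp0']
    field_simp
  have hq (j : ZMod p) : Function.Periodic.qParam 1 ((heckeMatrix p j.val • τ : ℍ) : ℂ) =
      ZMod.stdAddChar j * r := by
    have hj : ZMod.stdAddChar j = Complex.exp (2 * Real.pi * Complex.I * j.val / p) := by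
      have := ZMod.stdAddChar_coe (N := p) (j.val : ℤ)
      simpa using this
    rw [hj, hsmul, hr, ← Complex.exp_add, Function.Periodic.qParam]
    congr 1
    push_cast
    field_simp
    ring
  have h : HasSum (fun m => ∑ j : ZMod p, (p : ℂ)⁻¹ * ((qExpansion 1 f).coeff m *
      (ZMod.stdAddChar j * r) ^ m)) ((∑ j : ZMod p, ⇑f ∣[k] heckeMatrix p (j.val : ℤ)) τ) := by
    rw [Finset.sum_apply]
    refine hasSum_sum fun j _ => ?_
    rw [hval, ← hq]
    exact (ModularForm.hasSum_qExpansion f one_pos one_mem_strictPeriods_SL _).mul_left _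
  -- Orthogonality of additive characters: averaging over j keeps only the exponents divisible by p.
  have hchar (m : ℕ) : ∑ j : ZMod p, (p : ℂ)⁻¹ * ((qExpansion 1 f).coeff m *
      (ZMod.stdAddChar j * r) ^ m) =
      if p ∣ m then (qExpansion 1 f).coeff m * r ^ m else 0 := by
    have h1 : ∑ j : ZMod p, (ZMod.stdAddChar j : ℂ) ^ m = if p ∣ m then (p : ℂ) else 0 := by
      have := AddChar.sum_mulShift (m : ZMod p) (ZMod.isPrimitive_stdAddChar p)
      simp only [ZMod.natCast_eq_zero_iff, ZMod.card] at this
      push_cast at this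
      rw [← this]
      refine Finset.sum_congr rfl fun j _ => ?_
      rw [← AddChar.map_nsmul_eq_pow, nsmul_eq_mul, mul_comm]
    calc _ = (p : ℂ)⁻¹ * ((qExpansion 1 f).coeff m * r ^ m) *
          ∑ j : ZMod p, (ZMod.stdAddChar j : ℂ) ^ m := by
          rw [Finset.mul_sum]
          refine Finset.sum_congr rfl fun j _ => ?_
          rw [mul_pow]
          ring
      _ = _ := by
          rw [h1]
          split_ifs
          · field_simp
          · simp
  simp_rw [hchar] at h
  rw [← (mul_right_injective₀ hp0).hasSum_iff (fun m hm => ?_)] at h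
  · convert h using 2 with m
    simp [← hrp, pow_mul]
  · have : ¬ p ∣ m := fun ⟨c, hc⟩ => hm ⟨c, hc.symm⟩
    simp [this]

theorem hasSum_heckeSum [NeZero p] (τ : ℍ) :
    HasSum (fun m => ((qExpansion 1 f).coeff (p * m) +
      (if p ∣ m then (p : ℂ) ^ (k - 1) * (qExpansion 1 f).coeff (m / p) else 0)) •
      Function.Periodic.qParam 1 τ ^ m) (heckeSum f p τ) := by
  convert (hasSum_slash_heckeMatrixInfty f p τ).add (hasSum_sum_slash_heckeMatrix f p τ) using 2
  · rw [smul_eq_mul]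
    ring
  · rfl

/-- The Hecke operator `T_p` on modular forms of level one. -/
noncomputable def classicalHecke [hp : Fact p.Prime] : ModularForm 𝒮ℒ k where
  toFun := heckeSum f p
  slash_action_eq' A hA := by
    obtain ⟨A, rfl⟩ := hA
    exact SlashInvariantForm.slash_action_generators_SL2Z (heckeSum_slash_S f p)
      (heckeSum_slash_T f p) A
  holo' := by
    refine MDifferentiable.add (ModularFormClass.holo f |>.slash _ _) ?_
    refine MDifferentiable.sum fun j _ => ?_
    exact (ModularFormClass.holo f).slash _ _
  bdd_at_cusps' hc := by
    rw [Subgroup.IsArithmetic.isCusp_iff_isCusp_SL2Z] at hc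
    rw [OnePoint.isBoundedAt_iff_forall_SL2Z hc]
    intro γ _
    rw [SlashInvariantForm.slash_action_generators_SL2Z (heckeSum_slash_S f p)
      (heckeSum_slash_T f p)]
    -- Invariance has moved every cusp to i∞, where the q-expansion gives boundedness.
    exact isBoundedAtImInfty_of_hasSum_qExpansion one_pos (hasSum_heckeSum f p)

theorem coeff_qExpansion_classicalHecke [hp : Fact p.Prime] (m : ℕ) :
    (qExpansion 1 (classicalHecke f p)).coeff m = (qExpansion 1 f).coeff (p * m) +
      (if p ∣ m then (p : ℂ) ^ (k - 1) * (qExpansion 1 f).coeff (m / p) else 0) :=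
  (ModularFormClass.qExpansion_coeff_unique one_pos one_mem_strictPeriods_SL
    (f := classicalHecke f p) (hasSum_heckeSum f p) m).symm

end ClassicalHecke

end HeckeModTwo

namespace HeckeModTwo

open PowerSeries

/-! ### Squaring power series over 𝔽₂. -/

section Frobenius

theorem sq_eq_expand (f : PowerSeries (ZMod 2)) : f ^ 2 = expand 2 two_ne_zero f := by
  have h := MvPowerSeries.map_frobenius_expand (R := ZMod 2) (σ := Unit) 2 two_ne_zero (f := f)
  rw [ZMod.frobenius_zmod, MvPowerSeries.map_id] at h
  exact h.symm

theorem coeff_sq (f : PowerSeries (ZMod 2)) (n : ℕ) :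
    coeff n (f ^ 2) = if 2 ∣ n then coeff (n / 2) f else 0 := by
  rw [sq_eq_expand, coeff_expand]

theorem coeff_Delta (n : ℕ) [Decidable (∃ m : ℕ, n = (2 * m + 1) ^ 2)] :
    coeff n Delta = if ∃ m : ℕ, n = (2 * m + 1) ^ 2 then 1 else 0 := by
  rw [Delta, coeff_mk]
  congr

end Frobenius

/-! ### The coefficients of Δ as divisor sums modulo 2. -/

section DivisorSums

/-- The involution d ↦ n/d pairs off the divisors, except for a square root of n. -/
theorem card_divisors_cast {n : ℕ} (hn : n ≠ 0) [Decidable (IsSquare n)] :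
    (n.divisors.card : ZMod 2) = if IsSquare n then 1 else 0 := by
  have key (s : Finset ℕ) (hs : s ⊆ n.divisors) (hinv : ∀ d ∈ s, n / d ∈ s)
      (hfix : ∀ d ∈ s, d * d ≠ n) : (s.card : ZMod 2) = 0 := by
    have : ∑ d ∈ s, (1 : ZMod 2) = 0 := by
      refine Finset.sum_involution (fun d _ => n / d) (fun d _ => by decide) ?_ hinv ?_
      · intro d hd _ h
        refine hfix d hd ?_
        nth_rw 1 [← h]
        exact Nat.div_mul_cancel (Nat.dvd_of_mem_divisors (hs hd))
      · intro d hd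
        exact Nat.div_div_self (Nat.dvd_of_mem_divisors (hs hd)) hn
    simpa using this
  split_ifs with h
  · obtain ⟨m, hm⟩ := h
    have hm0 : m ≠ 0 := by rintro rfl; simp at hm; exact hn hm
    have hmem : m ∈ n.divisors := by simp [hm, hm0]
    have h1 := key (n.divisors.erase m) (Finset.erase_subset _ _) ?_ ?_
    · rw [← Finset.card_erase_add_one hmem]
      push_cast
      rw [h1, zero_add]
    · intro d hd
      obtain ⟨hdm, hd⟩ := Finset.mem_erase.1 hd
      have hdn := Nat.dvd_of_mem_divisors hd
      refine Finset.mem_erase.2 ⟨fun h => hdm ?_, by simp [hn, Nat.div_dvd_of_dvd hdn]⟩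
      have := Nat.div_mul_cancel hdn
      rw [h, hm] at this
      exact Nat.eq_of_mul_eq_mul_left (Nat.pos_of_ne_zero hm0) this
    · intro d hd h
      refine (Finset.mem_erase.1 hd).1 (Nat.mul_self_inj.1 (h.trans hm))
  · refine key _ subset_rfl (fun d hd => ?_) fun d _ hd => h ⟨d, hd.symm⟩
    simp [hn, Nat.div_dvd_of_dvd (Nat.dvd_of_mem_divisors hd)]

/-- The parity of the sum of the divisors. -/
theorem sum_divisors_two_mul (n : ℕ) :
    ∑ d ∈ (2 * n).divisors, (d : ZMod 2) = ∑ d ∈ n.divisors, (d : ZMod 2) := by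
  rcases eq_or_ne n 0 with rfl | hn
  · simp
  symm
  refine Finset.sum_subset (Nat.divisors_subset_of_dvd (by omega) (Dvd.intro_left 2 rfl)) ?_
  intro d hd hd'
  rw [Nat.mem_divisors] at hd hd'
  rw [ZMod.natCast_eq_zero_iff_even]
  by_contra hodd
  rw [Nat.not_even_iff_odd] at hodd
  exact hd' ⟨(Nat.Coprime.dvd_mul_left hodd.coprime_two_right).1 hd.1, hn⟩

theorem sum_divisors_of_odd {n : ℕ} (h : ¬ 2 ∣ n) [Decidable (IsSquare n)] :
    ∑ d ∈ n.divisors, (d : ZMod 2) = if IsSquare n then 1 else 0 := by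
  rw [← card_divisors_cast (by rintro rfl; simp at h), Finset.card_eq_sum_ones, Nat.cast_sum]
  refine Finset.sum_congr rfl fun d hd => ?_
  rw [Nat.cast_one, ZMod.natCast_eq_one_iff_odd, ← Nat.not_even_iff_odd]
  exact fun he => h (he.two_dvd.trans (Nat.dvd_of_mem_divisors hd))

/-- For odd n all divisors are odd, so σ(n) has the parity of their number; for even n the two sums
are equal and cancel. This form is the one that the Eisenstein series produce. -/
theorem coeff_Delta_eq_sum_divisors (n : ℕ) :
    coeff n Delta = ∑ d ∈ n.divisors, (d : ZMod 2) +
      if 2 ∣ n then ∑ d ∈ (n / 2).divisors, (d : ZMod 2) else 0 := by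
  classical
  rw [coeff_Delta]
  split_ifs with h1 h2 h2
  · obtain ⟨m, rfl⟩ := h1
    exact absurd h2 (by simp [Nat.dvd_iff_mod_eq_zero, Nat.pow_mod, Nat.add_mod])
  · obtain ⟨m, rfl⟩ := h1
    rw [sum_divisors_of_odd h2, if_pos ⟨2 * m + 1, sq _⟩, add_zero]
  · obtain ⟨m, rfl⟩ := h2
    rw [sum_divisors_two_mul, Nat.mul_div_cancel_left _ two_pos, CharTwo.add_self_eq_zero]
  · rw [sum_divisors_of_odd h2, if_neg, add_zero]
    rintro ⟨r, rfl⟩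
    refine h1 ⟨r / 2, ?_⟩
    have : Odd r := by
      rw [← Nat.not_even_iff_odd]
      exact fun h => h2 (h.two_dvd.mul_left r)
    rw [Nat.two_mul_div_two_add_one_of_odd this, sq]

end DivisorSums

/-! ### Integral forms of level one and their reduction modulo 2. -/

section IntegralForms

open UpperHalfPlane ModularForm MatrixGroups ArithmeticFunction

/-- The `q`-expansion of the Eisenstein series of weight four. -/
noncomputable def eisensteinFour : PowerSeries ℤ :=
  1 + 240 * PowerSeries.mk fun n => (sigma 3 n : ℤ)

/-- The `q`-expansion of the Eisenstein series of weight six. -/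
noncomputable def eisensteinSix : PowerSeries ℤ :=
  1 - 504 * PowerSeries.mk fun n => (sigma 5 n : ℤ)

theorem twelve_dvd_five_mul_cube_add (d : ℤ) : 12 ∣ 5 * d ^ 3 + 7 * d ^ 5 := by
  refine (ZMod.intCast_zmod_eq_zero_iff_dvd _ 12).1 ?_
  push_cast
  generalize (d : ZMod 12) = x
  revert x
  decide

theorem five_mul_cube_add_div_twelve_cast (d : ℤ) :
    (((5 * d ^ 3 + 7 * d ^ 5) / 12 : ℤ) : ZMod 2) = d := by
  obtain ⟨c, hc⟩ := twelve_dvd_five_mul_cube_add d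
  rw [hc, Int.mul_ediv_cancel_left _ (by norm_num)]
  rw [← sub_eq_zero, ← Int.cast_sub, ZMod.intCast_zmod_eq_zero_iff_dvd]
  have : (24 : ℤ) ∣ 5 * d ^ 3 + 7 * d ^ 5 - 12 * d := by
    refine (ZMod.intCast_zmod_eq_zero_iff_dvd _ 24).1 ?_
    push_cast
    generalize (d : ZMod 24) = x
    revert x
    decide
  push_cast at *
  omega

/-- The `q`-expansion of the modular discriminant. -/
noncomputable def discriminantSeries : PowerSeries ℤ :=
  (PowerSeries.mk fun n => ∑ d ∈ n.divisors, (5 * (d : ℤ) ^ 3 + 7 * (d : ℤ) ^ 5) / 12) +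
    100 * (PowerSeries.mk fun n => (sigma 3 n : ℤ)) ^ 2 +
    8000 * (PowerSeries.mk fun n => (sigma 3 n : ℤ)) ^ 3 -
    147 * (PowerSeries.mk fun n => (sigma 5 n : ℤ)) ^ 2

/-- Expanding E₄³ - E₆² and dividing by 1728 gives the linear coefficients 5/12 and 7/12, integral
once combined divisor by divisor, and the coefficients 100, 8000 and 147 of the higher terms. -/
theorem mul_discriminantSeries :
    1728 * discriminantSeries = eisensteinFour ^ 3 - eisensteinSix ^ 2 := by
  have h : 12 * (PowerSeries.mk fun n => ∑ d ∈ n.divisors, (5 * (d : ℤ) ^ 3 + 7 * (d : ℤ) ^ 5) / 12)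
      = 5 * (PowerSeries.mk fun n => (sigma 3 n : ℤ)) +
        7 * (PowerSeries.mk fun n => (sigma 5 n : ℤ)) := by
    have h12 : (12 : PowerSeries ℤ) = C 12 := rfl
    have h5 : (5 : PowerSeries ℤ) = C 5 := rfl
    have h7 : (7 : PowerSeries ℤ) = C 7 := rfl
    ext n
    rw [h12, h5, h7]
    simp only [map_add, coeff_C_mul, coeff_mk, sigma_apply, Nat.cast_sum, Nat.cast_pow,
      Finset.mul_sum, ← Finset.sum_add_distrib]
    refine Finset.sum_congr rfl fun d _ => ?_
    rw [Int.mul_ediv_cancel' (twelve_dvd_five_mul_cube_add d)]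
  rw [discriminantSeries, eisensteinFour, eisensteinSix]
  linear_combination 144 * h

theorem map_eisensteinFour : map (Int.castRingHom (ZMod 2)) eisensteinFour = 1 := by
  have : (240 : PowerSeries (ZMod 2)) = 0 := by
    have : (240 : PowerSeries (ZMod 2)) = C (240 : ZMod 2) := rfl
    rw [this, show (240 : ZMod 2) = 0 from rfl, _root_.map_zero]
  rw [eisensteinFour, map_add, map_mul, map_one, map_ofNat, this, zero_mul, add_zero]

/-- Modulo 2 only the linear term and the square of ∑ σ₅(n) qⁿ survive. They reduce to σ(n) and, by
Frobenius, σ(n/2). -/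
theorem map_discriminantSeries : map (Int.castRingHom (ZMod 2)) discriminantSeries = Delta := by
  have h100 : (100 : PowerSeries (ZMod 2)) = 0 := by
    have : (100 : PowerSeries (ZMod 2)) = C (100 : ZMod 2) := rfl
    rw [this, show (100 : ZMod 2) = 0 from rfl, _root_.map_zero]
  have h8000 : (8000 : PowerSeries (ZMod 2)) = 0 := by
    have : (8000 : PowerSeries (ZMod 2)) = C (8000 : ZMod 2) := rfl
    rw [this, show (8000 : ZMod 2) = 0 from rfl, _root_.map_zero]
  have h147 : (147 : PowerSeries (ZMod 2)) = -1 := by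
    have : (147 : PowerSeries (ZMod 2)) = C (147 : ZMod 2) := rfl
    rw [this, show (147 : ZMod 2) = -1 from rfl, _root_.map_neg, map_one]
  rw [discriminantSeries]
  simp only [map_sub, map_add, map_mul, map_ofNat, map_pow, h100, h8000, h147, zero_mul, add_zero,
    neg_mul, one_mul, sub_neg_eq_add]
  ext n
  rw [map_add, coeff_sq, coeff_Delta_eq_sum_divisors]
  simp only [coeff_map, coeff_mk, sigma_apply, eq_intCast]
  push_cast
  congr 1
  · refine Finset.sum_congr rfl fun d _ => ?_
    rw [five_mul_cube_add_div_twelve_cast, Int.cast_natCast]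
  · split_ifs
    · refine Finset.sum_congr rfl fun d _ => ?_
      generalize (d : ZMod 2) = x
      revert x
      decide
    · rfl

theorem qExpansion_E₄ : qExpansion 1 E₄ = map (Int.castRingHom ℂ) eisensteinFour := by
  have h240 : (240 : PowerSeries ℤ) = C 240 := rfl
  ext n
  rw [E₄, EisensteinSeries.E_qExpansion_coeff _ ⟨2, rfl⟩, coeff_map, eisensteinFour, h240, map_add,
    coeff_C_mul, coeff_mk, coeff_one, show bernoulli 4 = -1 / 30 by decide +kernel]
  split_ifs with h
  · simp [h]
  · norm_num

theorem qExpansion_E₆ : qExpansion 1 E₆ = map (Int.castRingHom ℂ) eisensteinSix := by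
  have h504 : (504 : PowerSeries ℤ) = C 504 := rfl
  ext n
  rw [E₆, EisensteinSeries.E_qExpansion_coeff _ ⟨3, rfl⟩, coeff_map, eisensteinSix, h504, map_sub,
    coeff_C_mul, coeff_mk, coeff_one, show bernoulli 6 = 1 / 42 by decide +kernel]
  split_ifs with h
  · simp [h]
  · norm_num

theorem qExpansion_discriminant :
    qExpansion 1 discriminant = map (Int.castRingHom ℂ) discriminantSeries := by
  have h1 : (fun z => 1728 * discriminant z) = ⇑(E₄.pow 3) - ⇑(E₆.pow 2) := by
    ext z
    change 1728 * discriminant z = E₄.pow 3 z - E₆.pow 2 z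
    rw [discriminant_eq_E₄_cube_sub_E₆_sq, ModularForm.coe_pow, ModularForm.coe_pow, Pi.pow_apply, Pi.pow_apply]
    ring
  have h2 := ModularForm.qExpansion_sub one_pos one_mem_strictPeriods_SL (E₄.pow 3) (E₆.pow 2)
  rw [← h1, ModularForm.qExpansion_pow one_pos one_mem_strictPeriods_SL,
    ModularForm.qExpansion_pow one_pos one_mem_strictPeriods_SL, qExpansion_E₄, qExpansion_E₆,
    ← map_pow, ← map_pow, ← map_sub, ← mul_discriminantSeries] at h2
  have h3 := ModularForm.qExpansion_smul one_pos one_mem_strictPeriods_SL (1728 : ℂ)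
    CuspForm.discriminant
  have h4 : ((1728 : ℂ) • CuspForm.discriminant : UpperHalfPlane → ℂ) = fun z => 1728 * discriminant z := rfl
  rw [h4, h2, map_mul, map_ofNat, CuspForm.coe_discriminant] at h3
  have h5 : (1728 : PowerSeries ℂ) = C 1728 := rfl
  rw [h5, ← smul_eq_C_mul] at h3
  exact (smul_right_injective _ (by norm_num : (1728 : ℂ) ≠ 0) h3).symm

theorem map_castRingHom_injective :
    Function.Injective (map (Int.castRingHom ℂ) : PowerSeries ℤ → PowerSeries ℂ) :=
  map_injective _ Int.cast_injective

/-- Since the cofactor is a unit over ℤ, an integral series without constant term can be divided by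
the discriminant integrally. -/
theorem exists_discriminantSeries_eq_X_mul :
    ∃ u : PowerSeries ℤ, IsUnit u ∧ discriminantSeries = X * u := by
  have h0 : constantCoeff discriminantSeries = 0 := by
    rw [← coeff_zero_eq_constantCoeff_apply]
    have := congrArg (coeff 0) qExpansion_discriminant
    have h := PowerSeries.coeff_of_lt_order 0 (by rw [discriminant_qExpansion_order]; simp :
      ((0 : ℕ) : ℕ∞) < (qExpansion 1 discriminant).order)
    rw [h, coeff_map, eq_intCast] at this
    exact_mod_cast this.symm
  obtain ⟨u, hu⟩ := X_dvd_iff.2 h0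
  refine ⟨u, ?_, hu⟩
  have h1 := congrArg (coeff 1) qExpansion_discriminant
  rw [discriminant_qExpansion_coeff_one, coeff_map, hu, coeff_succ_X_mul 0, eq_intCast] at h1
  rw [isUnit_iff_constantCoeff, ← coeff_zero_eq_constantCoeff_apply]
  have h2 : coeff 0 u = 1 := by exact_mod_cast h1.symm
  rw [h2]
  exact isUnit_one

/-- A modular form of weight `12k` and level one with integral `q`-expansion is an integral
combination of the forms `Δ^j E₄^{3(k-j)}`. -/
theorem exists_eq_sum_of_qExpansion_eq_map (k : ℕ) (f : ModularForm 𝒮ℒ (12 * k))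
    (F : PowerSeries ℤ) (hF : qExpansion 1 f = map (Int.castRingHom ℂ) F) :
    ∃ c : ℕ → ℤ, F = ∑ j ∈ Finset.range (k + 1),
      C (c j) * (discriminantSeries ^ j * eisensteinFour ^ (3 * (k - j))) := by
  induction k generalizing F with
  | zero =>
    obtain ⟨c, hc⟩ := ModularFormClass.levelOne_weight_zero_const
      (ModularForm.mcast (by simp) f : ModularForm 𝒮ℒ 0)
    have h1 : (c • (1 : ModularForm 𝒮ℒ 0) : UpperHalfPlane → ℂ) = f := by
      ext z
      have := congrFun hc z
      simpa using this.symm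
    have h2 := ModularForm.qExpansion_smul one_pos one_mem_strictPeriods_SL c
      (1 : ModularForm 𝒮ℒ 0)
    rw [h1, hF, ModularForm.qExpansion_one] at h2
    refine ⟨fun _ => coeff 0 F, ?_⟩
    simp only [zero_add, Finset.range_one, Finset.sum_singleton, pow_zero, Nat.sub_zero, mul_zero,
      mul_one]
    ext n
    rw [coeff_C]
    split_ifs with hn
    · rw [hn]
    · have := congrArg (coeff n) h2
      rw [coeff_map, coeff_smul, coeff_one, if_neg hn, smul_zero, eq_intCast] at this
      exact_mod_cast this
  | succ k ih =>
    -- Subtracting `a` times a power of E₄ gives a cusp form; dividing it by the discriminant lowers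
    -- the weight by 12 and preserves integrality.
    set a : ℤ := coeff 0 F with ha
    set E : ModularForm 𝒮ℒ (12 * (k + 1 : ℕ)) :=
      ModularForm.mcast (by push_cast; ring) (E₄.pow (3 * (k + 1))) with hE
    have hqE : qExpansion 1 E = map (Int.castRingHom ℂ) (eisensteinFour ^ (3 * (k + 1))) := by
      rw [hE, ModularForm.qExpansion_mcast _ rfl,
        ModularForm.qExpansion_pow one_pos one_mem_strictPeriods_SL, qExpansion_E₄, map_pow]
    set g : ModularForm 𝒮ℒ (12 * (k + 1 : ℕ)) := f - (a : ℂ) • E with hg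
    set G : PowerSeries ℤ := F - C a * eisensteinFour ^ (3 * (k + 1)) with hG
    have hqg : qExpansion 1 g = map (Int.castRingHom ℂ) G := by
      have h1 := ModularForm.qExpansion_sub one_pos one_mem_strictPeriods_SL f ((a : ℂ) • E)
      have h2 := ModularForm.qExpansion_smul one_pos one_mem_strictPeriods_SL (a : ℂ) E
      change qExpansion 1 (⇑f - (a : ℂ) • ⇑E) = _
      change qExpansion 1 (⇑f - (a : ℂ) • ⇑E) = qExpansion 1 f - qExpansion 1 ((a : ℂ) • ⇑E) at h1
      rw [h1, h2, hF, hqE, hG, map_sub, map_mul, map_C, smul_eq_C_mul]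
      rfl
    have hE0 : coeff 0 (eisensteinFour ^ (3 * (k + 1))) = 1 := by
      simp [eisensteinFour]
    have hG0 : coeff 0 G = 0 := by
      rw [hG, map_sub, coeff_C_mul, hE0, mul_one, ← ha, sub_self]
    have hcusp : (qExpansion 1 g).coeff 0 = 0 := by
      rw [hqg, coeff_map, hG0, _root_.map_zero]
    have hfac := qExpansion_eq_qExpansion_discriminant_mul g hcusp
    obtain ⟨u, hu, hDu⟩ := exists_discriminantSeries_eq_X_mul
    obtain ⟨v, rfl⟩ := hu
    obtain ⟨w, hw⟩ := X_dvd_iff.2 (by rwa [coeff_zero_eq_constantCoeff_apply] at hG0)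
    have hGH : G = discriminantSeries * ((↑v⁻¹ : PowerSeries ℤ) * w) := by
      rw [hDu, mul_assoc, ← mul_assoc (v : PowerSeries ℤ), Units.mul_inv, one_mul, hw]
    set H := (↑v⁻¹ : PowerSeries ℤ) * w
    rw [hqg, hGH, map_mul, qExpansion_discriminant] at hfac
    have hD0 : map (Int.castRingHom ℂ) discriminantSeries ≠ 0 := by
      rw [Ne, ← _root_.map_zero (map (Int.castRingHom ℂ)), map_castRingHom_injective.eq_iff, hDu]
      exact mul_ne_zero X_ne_zero v.ne_zero
    have hqH := mul_left_cancel₀ hD0 hfac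
    obtain ⟨c, hc⟩ := ih (ModularForm.mcast (by push_cast; ring)
      (CuspForm.discriminantEquiv (toCuspForm g hcusp))) H hqH.symm
    refine ⟨fun j => if j = 0 then a else c (j - 1), ?_⟩
    rw [Finset.sum_range_succ']
    simp only [Nat.add_eq_zero_iff, one_ne_zero, and_false, if_false, Nat.add_sub_cancel, if_true,
      pow_zero, one_mul, Nat.sub_zero, Nat.add_sub_add_right]
    have hF' : F = G + C a * eisensteinFour ^ (3 * (k + 1)) := by rw [hG]; ring
    rw [hF', hGH, hc, Finset.mul_sum]
    congr 1
    refine Finset.sum_congr rfl fun j _ => ?_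
    ring

theorem map_eq_sum_Delta_pow (k : ℕ) (f : ModularForm 𝒮ℒ (12 * k))
    (F : PowerSeries ℤ) (hF : qExpansion 1 f = map (Int.castRingHom ℂ) F) :
    map (Int.castRingHom (ZMod 2)) F ∈
      Submodule.span (ZMod 2) ((fun j => Delta ^ j) '' {j | j ≤ k}) := by
  obtain ⟨c, rfl⟩ := exists_eq_sum_of_qExpansion_eq_map k f F hF
  rw [map_sum]
  refine Submodule.sum_mem _ fun j hj => ?_
  rw [map_mul, map_mul, map_pow, map_pow, map_discriminantSeries, map_eisensteinFour, one_pow,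
    mul_one, map_C, ← smul_eq_C_mul]
  exact Submodule.smul_mem _ _ (Submodule.subset_span ⟨j, by simpa [Nat.lt_succ_iff] using hj, rfl⟩)

/-- The Hecke operator maps `Δ^k` to a polynomial of degree at most `k` in `Δ`. -/
theorem heckeOp_Delta_pow_mem_span (p : ℕ) (hp : p.Prime) (hp2 : p ≠ 2) (k : ℕ) (hk : k ≠ 0) :
    heckeOp p (Delta ^ k) ∈ Submodule.span (ZMod 2) ((fun j => Delta ^ j) '' {j | j ≤ k}) := by
  have : Fact p.Prime := ⟨hp⟩
  set f : ModularForm 𝒮ℒ (12 * k) :=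
    ModularForm.mcast (by ring) ((CuspForm.toModularFormₗ CuspForm.discriminant).pow k) with hfdef
  have hf : qExpansion 1 f = map (Int.castRingHom ℂ) (discriminantSeries ^ k) := by
    rw [hfdef, ModularForm.qExpansion_mcast _ rfl,
      ModularForm.qExpansion_pow one_pos one_mem_strictPeriods_SL, map_pow,
      ← qExpansion_discriminant]
    rfl
  set F : PowerSeries ℤ := PowerSeries.mk fun m => coeff (p * m) (discriminantSeries ^ k) +
    if p ∣ m then (p : ℤ) ^ (12 * k - 1) * coeff (m / p) (discriminantSeries ^ k) else 0 with hFdef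
  have hF : qExpansion 1 (classicalHecke f p) = map (Int.castRingHom ℂ) F := by
    ext m
    rw [coeff_qExpansion_classicalHecke, hf, coeff_map, coeff_map, coeff_map, hFdef, coeff_mk]
    have : ((p : ℂ) ^ ((12 * k : ℤ) - 1)) = (p : ℂ) ^ (12 * k - 1) := by
      rw [← zpow_natCast, Nat.cast_sub (by omega)]
      push_cast
      rfl
    rw [this]
    split_ifs <;> simp
  convert map_eq_sum_Delta_pow k _ F hF using 1
  ext m
  -- For odd p the factor p^(12k-1) is 1 modulo 2, so the classical operator reduces to `heckeOp p`.
  have hpo : (p : ZMod 2) = 1 := by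
    rcases hp.eq_two_or_odd' with h | h
    · exact absurd h hp2
    · exact (ZMod.natCast_eq_one_iff_odd).2 h
  rw [← map_discriminantSeries, ← map_pow, heckeOp]
  simp only [LinearMap.coe_mk, AddHom.coe_mk, coeff_mk, coeff_map, hFdef]
  split_ifs <;> simp [hpo]

end IntegralForms

end HeckeModTwo

namespace HeckeModTwo

open PowerSeries

instance : CharP (PowerSeries (ZMod 2)) 2 := charP_of_injective_ringHom (C_injective (R := ZMod 2)) 2

/-! ### Exponents and order of the powers of Δ. -/

section Support

/-- Odd squares are 1 modulo 8. -/
theorem coeff_Delta_of_mod_ne {n : ℕ} (h : n % 8 ≠ 1) : coeff n Delta = 0 := by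
  classical
  rw [coeff_Delta, if_neg]
  rintro ⟨m, rfl⟩
  obtain ⟨c, hc⟩ := Nat.even_mul_succ_self m
  have : (2 * m + 1) ^ 2 = 4 * (m * (m + 1)) + 1 := by ring
  omega

theorem coeff_Delta_pow_of_mod_ne (k : ℕ) {n : ℕ} (h : n % 8 ≠ k % 8) :
    coeff n (Delta ^ k) = 0 := by
  induction k generalizing n with
  | zero => rw [pow_zero, coeff_one, if_neg]; rintro rfl; exact h rfl
  | succ k ih =>
    rw [pow_succ, coeff_mul]
    refine Finset.sum_eq_zero fun ij hij => ?_
    rw [Finset.HasAntidiagonal.mem_antidiagonal] at hij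
    by_cases h1 : ij.1 % 8 = k % 8
    · rw [coeff_Delta_of_mod_ne (by omega), mul_zero]
    · rw [ih h1, zero_mul]

theorem exists_Delta_eq_X_mul : ∃ u : PowerSeries (ZMod 2), constantCoeff u = 1 ∧ Delta = X * u := by
  classical
  have h0 : constantCoeff Delta = 0 := by
    rw [← coeff_zero_eq_constantCoeff_apply, coeff_Delta_of_mod_ne (by norm_num)]
  obtain ⟨u, hu⟩ := X_dvd_iff.2 h0
  refine ⟨u, ?_, hu⟩
  rw [← coeff_zero_eq_constantCoeff_apply, ← coeff_succ_X_mul, ← hu, coeff_Delta,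
    if_pos ⟨0, by norm_num⟩]

theorem coeff_mul_Delta_pow_of_lt (f : PowerSeries (ZMod 2)) (k : ℕ) {B n : ℕ}
    (hf : ∀ i < B, coeff i f = 0) (hn : n < B + k) : coeff n (f * Delta ^ k) = 0 := by
  obtain ⟨u, -, hu⟩ := exists_Delta_eq_X_mul
  obtain ⟨g, rfl⟩ := X_pow_dvd_iff.2 hf
  have : X ^ B * g * Delta ^ k = X ^ (B + k) * (g * u ^ k) := by rw [hu]; ring
  rw [this, coeff_X_pow_mul', if_neg (by omega)]

theorem coeff_mul_Delta_pow_self (f : PowerSeries (ZMod 2)) (k : ℕ) {B : ℕ}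
    (hf : ∀ i < B, coeff i f = 0) : coeff (B + k) (f * Delta ^ k) = coeff B f := by
  obtain ⟨u, hu1, hu⟩ := exists_Delta_eq_X_mul
  obtain ⟨g, rfl⟩ := X_pow_dvd_iff.2 hf
  have : X ^ B * g * Delta ^ k = X ^ (B + k) * (g * u ^ k) := by rw [hu]; ring
  rw [this, coeff_X_pow_mul', if_pos le_rfl, Nat.sub_self, coeff_X_pow_mul', if_pos le_rfl,
    Nat.sub_self, coeff_zero_eq_constantCoeff_apply, coeff_zero_eq_constantCoeff_apply, map_mul,
    map_pow, hu1, one_pow, mul_one]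

theorem coeff_Delta_pow_of_lt {k n : ℕ} (h : n < k) : coeff n (Delta ^ k) = 0 := by
  have := coeff_mul_Delta_pow_of_lt 1 k (B := 0) (by simp) (by omega : n < 0 + k)
  rwa [one_mul] at this

theorem coeff_Delta_pow_self (k : ℕ) : coeff k (Delta ^ k) = 1 := by
  have := coeff_mul_Delta_pow_self 1 k (B := 0) (by simp)
  rwa [one_mul, zero_add, coeff_one, if_pos rfl] at this

/-- A polynomial of degree at most `N` in `Δ` is determined by its coefficients up to `q^N`. -/
theorem eq_zero_of_mem_span_Delta_pow {N : ℕ} {f : PowerSeries (ZMod 2)}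
    (hf : f ∈ Submodule.span (ZMod 2) ((fun j => Delta ^ j) '' {j | j ≤ N}))
    (h : ∀ i ≤ N, coeff i f = 0) : f = 0 := by
  obtain ⟨c, rfl⟩ : ∃ c : ℕ → ZMod 2, f = ∑ j ∈ Finset.range (N + 1), c j • Delta ^ j := by
    have : {j | j ≤ N} = (Finset.range (N + 1) : Set ℕ) := by ext; simp
    rw [this, Submodule.mem_span_image_finset_iff_exists_fun] at hf
    obtain ⟨c, hc⟩ := hf
    refine ⟨fun j => if h : j ∈ Finset.range (N + 1) then c ⟨j, h⟩ else 0, ?_⟩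
    rw [← hc, ← Finset.sum_attach (Finset.range (N + 1)), Finset.univ_eq_attach]
    refine Finset.sum_congr rfl fun j _ => ?_
    beta_reduce
    rw [dif_pos j.2]
  have hc : ∀ j ≤ N, c j = 0 := by
    intro j
    induction j using Nat.strong_induction_on with
    | _ j ih =>
      intro hj
      have := h j hj
      rw [map_sum, Finset.sum_eq_single j] at this
      · simpa [coeff_Delta_pow_self] using this
      · intro i hi hij
        rcases lt_or_gt_of_ne hij with hlt | hgt
        · rw [ih i hlt (by omega), zero_smul, map_zero]
        · rw [coeff_smul, coeff_Delta_pow_of_lt hgt, smul_zero]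
      · intro hj'
        exact absurd (Finset.mem_range.2 (by omega)) hj'
  refine Finset.sum_eq_zero fun j hj => ?_
  rw [hc j (by simpa [Nat.lt_succ_iff] using hj), zero_smul]

end Support

/-! ### Modular equations of degree 3 and 5, and the recurrences they imply. -/

section ModularEquation

/-- The operator `U_p`, keeping the coefficients of index divisible by `p`. -/
noncomputable def decimate (p : ℕ) : PowerSeries (ZMod 2) →ₗ[ZMod 2] PowerSeries (ZMod 2) where
  toFun f := PowerSeries.mk fun n => coeff (p * n) f
  map_add' f g := by ext n; simp
  map_smul' c f := by ext n; simp

@[simp] theorem coeff_decimate (p n : ℕ) (f : PowerSeries (ZMod 2)) :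
    coeff n (decimate p f) = coeff (p * n) f := by simp [decimate]

theorem heckeOp_apply (p : ℕ) (hp : p ≠ 0) (f : PowerSeries (ZMod 2)) :
    heckeOp p f = decimate p f + expand p hp f := by
  ext n
  simp [heckeOp, coeff_expand]

/-- The projection formula U_p(f · V_p g) = U_p(f) · g. -/
theorem decimate_mul_expand (p : ℕ) (hp : p ≠ 0) (f g : PowerSeries (ZMod 2)) :
    decimate p (f * expand p hp g) = decimate p f * g := by
  ext n
  rw [coeff_decimate, coeff_mul, coeff_mul]
  symm
  refine Finset.sum_of_injOn (fun ij => (p * ij.1, p * ij.2)) ?_ ?_ ?_ ?_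
  · rintro ⟨a, b⟩ - ⟨c, d⟩ - h
    simpa [hp] using h
  · rintro ⟨a, b⟩ h
    simp only [Finset.mem_coe, Finset.HasAntidiagonal.mem_antidiagonal] at h ⊢
    rw [← mul_add, h]
  · rintro ⟨a, b⟩ h hab
    rw [Finset.HasAntidiagonal.mem_antidiagonal] at h
    rw [coeff_expand_of_not_dvd, mul_zero]
    rintro ⟨d, rfl⟩
    obtain ⟨c, rfl⟩ : p ∣ a := by
      rw [Nat.dvd_add_iff_left (Dvd.intro d rfl), h]
      exact Dvd.intro n rfl
    refine hab ⟨(c, d), ?_, rfl⟩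
    have : p * (c + d) = p * n := by rw [mul_add]; exact h
    simpa using Nat.eq_of_mul_eq_mul_left (Nat.pos_of_ne_zero hp) this
  · rintro ⟨a, b⟩ -
    rw [coeff_decimate, coeff_expand_mul]

theorem heckeOp_sq (p : ℕ) (hp : p ≠ 0) (f : PowerSeries (ZMod 2)) (hodd : Odd p) :
    heckeOp p (f ^ 2) = heckeOp p f ^ 2 := by
  have hc : Nat.Coprime 2 p := hodd.coprime_two_left
  ext n
  rw [coeff_sq, heckeOp]
  simp only [LinearMap.coe_mk, AddHom.coe_mk, coeff_mk, coeff_sq]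
  by_cases h2 : 2 ∣ n
  · obtain ⟨m, rfl⟩ := h2
    have h1 : 2 ∣ p * (2 * m) := ⟨p * m, by ring⟩
    have h3 : p ∣ 2 * m ↔ p ∣ m := hc.symm.dvd_mul_left
    have h4 : p * (2 * m) / 2 = p * m := by
      rw [show p * (2 * m) = 2 * (p * m) by ring, Nat.mul_div_cancel_left _ two_pos]
    rw [if_pos h1, if_pos (Dvd.intro m rfl), h4, Nat.mul_div_cancel_left _ two_pos]
    simp only [h3]
    congr 1
    split_ifs with h5 h6
    · obtain ⟨c, rfl⟩ := h5
      congr 2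
      rw [show 2 * (p * c) = p * (2 * c) by ring,
        Nat.mul_div_cancel_left _ (Nat.pos_of_ne_zero hp),
        Nat.mul_div_cancel_left _ (Nat.pos_of_ne_zero hp), Nat.mul_div_cancel_left _ two_pos]
    · obtain ⟨c, rfl⟩ := h5
      refine absurd ?_ h6
      rw [show 2 * (p * c) = p * (2 * c) by ring,
        Nat.mul_div_cancel_left _ (Nat.pos_of_ne_zero hp)]
      exact Dvd.intro c rfl
    · rfl
  · have h1 : ¬ 2 ∣ p * n := fun h => h2 (hc.dvd_of_dvd_mul_left h)
    rw [if_neg h1, if_neg h2, zero_add]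
    split_ifs with h3 h4
    · exact absurd (h4.trans (Nat.div_dvd_of_dvd h3)) h2
    · rfl
    · rfl

/-- A power series `Φ` vanishes if the combinations `U_p(Φ Δ^k) + Φ V_p(Δ)^k` are polynomials in `Δ`
of degree small compared to the order of `Φ`. -/
theorem eq_zero_of_decimate_add_mem_span (p : ℕ) (hp : 2 ≤ p) (N : ℕ) (hN : 1 ≤ N) (Φ : PowerSeries (ZMod 2))
    (h : ∀ k < p, decimate p (Φ * Delta ^ k) + Φ * expand p (by omega) Delta ^ k ∈
      Submodule.span (ZMod 2) ((fun j => Delta ^ j) '' {j | j ≤ N}))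
    (hΦ : X ^ (p * N + 1) ∣ Φ) : Φ = 0 := by
  classical
  by_contra hne
  have hex : ∃ n, coeff n Φ ≠ 0 := by
    by_contra! h0
    exact hne (ext fun n => by simpa using h0 n)
  set B := Nat.find hex with hB
  have hB0 : coeff B Φ ≠ 0 := Nat.find_spec hex
  have hlt : ∀ i < B, coeff i Φ = 0 := fun i hi => not_not.1 (Nat.find_min hex hi)
  have hBN : p * N + 1 ≤ B := by
    by_contra hcon
    exact hB0 (X_pow_dvd_iff.1 hΦ B (by omega))
  -- With this `k` the series Φ Δ^k has order p n, so U_p of it has order exactly n. As n < B, the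
  -- other summand contributes nothing up to degree n. As n > N, the degree bound would force the
  -- sum to vanish.
  obtain ⟨k, hk, n, hn⟩ : ∃ k < p, p ∣ B + k := by
    refine ⟨(p - B % p) % p, Nat.mod_lt _ (by omega), ?_⟩
    rw [Nat.dvd_iff_mod_eq_zero, Nat.add_mod, Nat.mod_mod]
    have := Nat.mod_lt B (by omega : p > 0)
    rw [← Nat.add_mod, ← Nat.mod_add_mod, ← Nat.add_sub_assoc this.le, Nat.add_sub_cancel_left,
      Nat.mod_self]
  have hnB : n < B := by
    by_contra! hcon
    have h1 := Nat.mul_le_mul_left p hcon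
    have h2 := Nat.mul_le_mul_right B hp
    have h3 := Nat.mul_le_mul_left p hN
    omega
  have hNn : N < n := Nat.lt_of_mul_lt_mul_left (a := p) (by omega)
  have hlow (i : ℕ) (hi : i ≤ n) : coeff i (Φ * expand p (by omega : p ≠ 0) Delta ^ k) = 0 := by
    have hdvd : X ^ B ∣ Φ * expand p (by omega : p ≠ 0) Delta ^ k :=
      (X_pow_dvd_iff.2 hlt).mul_right _
    exact X_pow_dvd_iff.1 hdvd i (by omega)
  have hzero := eq_zero_of_mem_span_Delta_pow (h k hk) (fun i hi => by
    rw [map_add, hlow i (by omega), coeff_decimate, add_zero]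
    refine coeff_mul_Delta_pow_of_lt Φ k hlt ?_
    rw [hn]
    exact Nat.mul_lt_mul_of_pos_left (by omega) (by omega))
  have := congrArg (coeff n) hzero
  rw [map_add, hlow n le_rfl, coeff_decimate, ← hn, coeff_mul_Delta_pow_self Φ k hlt] at this
  exact hB0 (by simpa using this)

theorem mul_span_Delta_pow {N d : ℕ} {f : PowerSeries (ZMod 2)}
    (hf : f ∈ Submodule.span (ZMod 2) ((fun j => Delta ^ j) '' {j | j ≤ N})) :
    Delta ^ d * f ∈ Submodule.span (ZMod 2) ((fun j => Delta ^ j) '' {j | j ≤ N + d}) := by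
  induction hf using Submodule.span_induction with
  | mem x hx =>
    obtain ⟨j, hj, rfl⟩ := hx
    exact Submodule.subset_span ⟨j + d, by simpa using hj, by simp [pow_add, mul_comm]⟩
  | zero => simp
  | add x y _ _ hx hy => rw [mul_add]; exact Submodule.add_mem _ hx hy
  | smul a x _ hx => rw [mul_smul_comm]; exact Submodule.smul_mem _ _ hx

theorem heckeOp_one (p : ℕ) (hp : p ≠ 0) : heckeOp p 1 = 0 := by
  have : decimate p 1 = 1 := by
    ext n
    simp [coeff_one, hp]
  rw [heckeOp_apply p hp, this, map_one, CharTwo.add_self_eq_zero]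

theorem heckeOp_Delta_pow_mem_span' {p : ℕ} (hp : p.Prime) (hp2 : p ≠ 2) {k N : ℕ} (hk : k ≤ N) :
    heckeOp p (Delta ^ k) ∈ Submodule.span (ZMod 2) ((fun j => Delta ^ j) '' {j | j ≤ N}) := by
  rcases eq_or_ne k 0 with rfl | hk0
  · rw [pow_zero, heckeOp_one p hp.ne_zero]
    exact zero_mem _
  · exact Submodule.span_mono (Set.image_mono fun j hj => le_trans hj hk)
      (heckeOp_Delta_pow_mem_span p hp hp2 k hk0)

theorem exists_Delta_eq_add_X_pow_mul :
    ∃ g, Delta = X + X ^ 9 + X ^ 25 + X ^ 49 + X ^ 81 * g := by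
  classical
  have : X ^ 81 ∣ Delta - (X + X ^ 9 + X ^ 25 + X ^ 49) := by
    rw [X_pow_dvd_iff]
    intro n hn
    simp only [map_sub, map_add, coeff_Delta, coeff_X, coeff_X_pow]
    by_cases h : ∃ m : ℕ, n = (2 * m + 1) ^ 2
    · rw [if_pos h]
      obtain ⟨m, rfl⟩ := h
      have : m < 4 := by nlinarith
      interval_cases m <;> simp
    · have h1 (m : ℕ) : n ≠ (2 * m + 1) ^ 2 := fun hm => h ⟨m, hm⟩
      have h2 := h1 0
      have h3 := h1 1
      have h4 := h1 2
      have h5 := h1 3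
      norm_num at h2 h3 h4 h5
      simp [h, h2, h3, h4, h5]
  obtain ⟨g, hg⟩ := this
  exact ⟨g, by rw [← hg]; ring⟩

/-- The left side is symmetric in Δ and V_3 Δ, so U_3(Φ Δ^k) + Φ (V_3 Δ)^k regroups into products of
powers of Δ with T_3 of powers of Δ. For k ≤ 2 these have degree at most 6 in Δ. -/
theorem modular_equation_three :
    Delta ^ 4 + expand 3 three_ne_zero Delta ^ 4 + Delta * expand 3 three_ne_zero Delta = 0 := by
  refine eq_zero_of_decimate_add_mem_span 3 (by norm_num) 6 (by norm_num) _ (fun k hk => ?_) ?_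
  · have hT (k : ℕ) := heckeOp_apply 3 three_ne_zero (Delta ^ k)
    have h1 := decimate_mul_expand 3 three_ne_zero (Delta ^ k) (Delta ^ 4)
    have h2 := decimate_mul_expand 3 three_ne_zero (Delta ^ (k + 1)) Delta
    have h3 : (Delta ^ 4 + expand 3 three_ne_zero Delta ^ 4 +
        Delta * expand 3 three_ne_zero Delta) * Delta ^ k = Delta ^ (k + 4) +
        Delta ^ k * expand 3 three_ne_zero (Delta ^ 4) +
        Delta ^ (k + 1) * expand 3 three_ne_zero Delta := by
      rw [map_pow]
      ring
    have h4 : decimate 3 ((Delta ^ 4 + expand 3 three_ne_zero Delta ^ 4 +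
        Delta * expand 3 three_ne_zero Delta) * Delta ^ k) +
        (Delta ^ 4 + expand 3 three_ne_zero Delta ^ 4 +
        Delta * expand 3 three_ne_zero Delta) * expand 3 (by norm_num) Delta ^ k =
        heckeOp 3 (Delta ^ (k + 4)) + Delta ^ 4 * heckeOp 3 (Delta ^ k) +
        Delta ^ 1 * heckeOp 3 (Delta ^ (k + 1)) := by
      rw [h3, map_add, map_add, h1, h2, hT, hT, hT]
      simp only [map_pow (expand 3 three_ne_zero)]
      ring
    rw [h4]
    refine add_mem (add_mem ?_ ?_) ?_
    · exact heckeOp_Delta_pow_mem_span' Nat.prime_three (by norm_num) (by omega)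
    · exact mul_span_Delta_pow (N := 2) (d := 4)
        (heckeOp_Delta_pow_mem_span' Nat.prime_three (by norm_num) (by omega))
    · exact mul_span_Delta_pow (N := 5) (d := 1)
        (heckeOp_Delta_pow_mem_span' Nat.prime_three (by norm_num) (by omega))
  -- It remains to see that Φ vanishes to order 3·6 + 1 = 19.
  · obtain ⟨g, hg⟩ := exists_Delta_eq_add_X_pow_mul
    have h2 : (2 : PowerSeries (ZMod 2)) = 0 := CharTwo.two_eq_zero
    have hV : expand 3 three_ne_zero Delta = X ^ 3 + X ^ 27 *
        (1 + X ^ 48 + X ^ 120 + X ^ 216 * expand 3 three_ne_zero g) := by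
      rw [hg]
      simp only [map_add, map_mul, map_pow, expand_X]
      ring
    have hD : Delta = X + X ^ 9 + X ^ 25 * (1 + X ^ 24 + X ^ 56 * g) := by
      rw [hg]
      ring
    rw [hV, hD]
    generalize 1 + X ^ 48 + X ^ 120 + X ^ 216 * expand 3 three_ne_zero g = b
    generalize 1 + X ^ 24 + X ^ 56 * g = a
    have h4 (u v : PowerSeries (ZMod 2)) : (u + v) ^ 4 = u ^ 4 + v ^ 4 := by
      rw [show 4 = 2 * 2 from rfl, pow_mul, pow_mul, pow_mul, CharTwo.add_sq, CharTwo.add_sq]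
    rw [h4, h4, h4]
    refine ⟨X ^ 17 + X ^ 81 * a ^ 4 + X ^ 89 * b ^ 4 + (X ^ 9 + X ^ 17 + X ^ 33 * a) * b +
      X ^ 9 * a, ?_⟩
    linear_combination (X ^ 4 + X ^ 12) * h2

/-- Same argument: for k ≤ 4 the degrees are at most 10, so vanishing to order 5·10 + 1 = 51
suffices. -/
theorem modular_equation_five :
    (Delta ^ 2 + expand 5 (by norm_num) Delta ^ 2) * (Delta ^ 4 + expand 5 (by norm_num) Delta ^ 4)
      + Delta * expand 5 (by norm_num) Delta = 0 := by
  have h50 : 5 ≠ 0 := by norm_num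
  refine eq_zero_of_decimate_add_mem_span 5 (by norm_num) 10 (by norm_num) _ (fun k hk => ?_) ?_
  · have hT (k : ℕ) := heckeOp_apply 5 h50 (Delta ^ k)
    have h1 := decimate_mul_expand 5 h50 (Delta ^ k) (Delta ^ 6)
    have h2 := decimate_mul_expand 5 h50 (Delta ^ (k + 2)) (Delta ^ 4)
    have h3 := decimate_mul_expand 5 h50 (Delta ^ (k + 4)) (Delta ^ 2)
    have h4 := decimate_mul_expand 5 h50 (Delta ^ (k + 1)) Delta
    have h5 : ((Delta ^ 2 + expand 5 h50 Delta ^ 2) * (Delta ^ 4 + expand 5 h50 Delta ^ 4) +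
        Delta * expand 5 h50 Delta) * Delta ^ k = Delta ^ (k + 6) +
        Delta ^ k * expand 5 h50 (Delta ^ 6) + Delta ^ (k + 2) * expand 5 h50 (Delta ^ 4) +
        Delta ^ (k + 4) * expand 5 h50 (Delta ^ 2) + Delta ^ (k + 1) * expand 5 h50 Delta := by
      rw [map_pow, map_pow, map_pow]
      ring
    have h6 : decimate 5 (((Delta ^ 2 + expand 5 h50 Delta ^ 2) *
        (Delta ^ 4 + expand 5 h50 Delta ^ 4) + Delta * expand 5 h50 Delta) * Delta ^ k) +
        ((Delta ^ 2 + expand 5 h50 Delta ^ 2) * (Delta ^ 4 + expand 5 h50 Delta ^ 4) +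
        Delta * expand 5 h50 Delta) * expand 5 h50 Delta ^ k =
        heckeOp 5 (Delta ^ (k + 6)) + Delta ^ 6 * heckeOp 5 (Delta ^ k) +
        Delta ^ 4 * heckeOp 5 (Delta ^ (k + 2)) + Delta ^ 2 * heckeOp 5 (Delta ^ (k + 4)) +
        Delta ^ 1 * heckeOp 5 (Delta ^ (k + 1)) := by
      rw [h5, map_add, map_add, map_add, map_add, h1, h2, h3, h4, hT, hT, hT, hT, hT]
      simp only [map_pow (expand 5 h50)]
      ring
    rw [h6]
    refine add_mem (add_mem (add_mem (add_mem ?_ ?_) ?_) ?_) ?_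
    · exact heckeOp_Delta_pow_mem_span' Nat.prime_five (by norm_num) (by omega)
    · exact mul_span_Delta_pow (N := 4) (d := 6)
        (heckeOp_Delta_pow_mem_span' Nat.prime_five (by norm_num) (by omega))
    · exact mul_span_Delta_pow (N := 6) (d := 4)
        (heckeOp_Delta_pow_mem_span' Nat.prime_five (by norm_num) (by omega))
    · exact mul_span_Delta_pow (N := 8) (d := 2)
        (heckeOp_Delta_pow_mem_span' Nat.prime_five (by norm_num) (by omega))
    · exact mul_span_Delta_pow (N := 9) (d := 1)
        (heckeOp_Delta_pow_mem_span' Nat.prime_five (by norm_num) (by omega))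
  · obtain ⟨g, hg⟩ := exists_Delta_eq_add_X_pow_mul
    have h2 : (2 : PowerSeries (ZMod 2)) = 0 := CharTwo.two_eq_zero
    have hV : expand 5 h50 Delta = X ^ 5 + X ^ 45 + X ^ 125 *
        (1 + X ^ 120 + X ^ 280 * expand 5 h50 g) := by
      rw [hg]
      simp only [map_add, map_mul, map_pow, expand_X]
      ring
    have hD : Delta = X + X ^ 9 + X ^ 25 + X ^ 49 * (1 + X ^ 32 * g) := by
      rw [hg]
      ring
    rw [hV, hD]
    generalize 1 + X ^ 120 + X ^ 280 * expand 5 h50 g = b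
    generalize 1 + X ^ 32 * g = a
    have h4 (u v : PowerSeries (ZMod 2)) : (u + v) ^ 4 = u ^ 4 + v ^ 4 := by
      rw [show 4 = 2 * 2 from rfl, pow_mul, pow_mul, pow_mul, CharTwo.add_sq, CharTwo.add_sq]
    simp only [h4, CharTwo.add_sq]
    have hA : (X ^ 2 + (X ^ 9) ^ 2 + (X ^ 25) ^ 2 + (X ^ 49 * a) ^ 2 +
        ((X ^ 5) ^ 2 + (X ^ 45) ^ 2 + (X ^ 125 * b) ^ 2) : PowerSeries (ZMod 2)) =
        X ^ 2 + X ^ 10 + X ^ 18 + X ^ 50 * (1 + X ^ 48 * a ^ 2 + X ^ 40 + X ^ 200 * b ^ 2) := by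
      ring
    have hB : (X ^ 4 + (X ^ 9) ^ 4 + (X ^ 25) ^ 4 + (X ^ 49 * a) ^ 4 +
        ((X ^ 5) ^ 4 + (X ^ 45) ^ 4 + (X ^ 125 * b) ^ 4) : PowerSeries (ZMod 2)) =
        X ^ 4 + X ^ 20 + X ^ 36 +
          X ^ 100 * (1 + X ^ 96 * a ^ 4 + X ^ 80 + X ^ 400 * b ^ 4) := by
      ring
    rw [hA, hB]
    generalize 1 + X ^ 48 * a ^ 2 + X ^ 40 + X ^ 200 * b ^ 2 = A
    generalize 1 + X ^ 96 * a ^ 4 + X ^ 80 + X ^ 400 * b ^ 4 = B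
    refine ⟨X ^ 3 + X ^ 3 * A + X ^ 19 * A + X ^ 35 * A +
      (X ^ 51 + X ^ 59 + X ^ 67 + X ^ 99 * A) * B + X ^ 3 + X ^ 19 +
      X ^ 3 * a + X ^ 43 * a + (X ^ 75 + X ^ 83 + X ^ 99 + X ^ 123 * a) * b, ?_⟩
    linear_combination (X ^ 6 + X ^ 14 + X ^ 22 + X ^ 30 + X ^ 38 + X ^ 46) * h2

/-- Multiplying the symmetric modular equation by Δ^k and applying U_3 gives the U-part; multiplying
it by (V_3 Δ)^k gives the V-part. -/
theorem heckeOp_three_recurrence (k : ℕ) : heckeOp 3 (Delta ^ (k + 4)) =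
    Delta * heckeOp 3 (Delta ^ (k + 1)) + Delta ^ 4 * heckeOp 3 (Delta ^ k) := by
  have hT (k : ℕ) := heckeOp_apply 3 three_ne_zero (Delta ^ k)
  have h1 := decimate_mul_expand 3 three_ne_zero (Delta ^ k) (Delta ^ 4)
  have h2 := decimate_mul_expand 3 three_ne_zero (Delta ^ (k + 1)) Delta
  have h := modular_equation_three
  have h3 : Delta ^ (k + 4) = Delta ^ k * expand 3 three_ne_zero (Delta ^ 4) +
      Delta ^ (k + 1) * expand 3 three_ne_zero Delta := by
    rw [map_pow, ← CharTwo.add_eq_zero]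
    linear_combination Delta ^ k * h
  have h4 : expand 3 three_ne_zero Delta ^ (k + 4) = expand 3 three_ne_zero Delta ^ k * Delta ^ 4 +
      expand 3 three_ne_zero Delta ^ (k + 1) * Delta := by
    rw [← CharTwo.add_eq_zero]
    linear_combination expand 3 three_ne_zero Delta ^ k * h
  rw [hT, hT, hT, map_pow (expand 3 three_ne_zero), map_pow (expand 3 three_ne_zero),
    map_pow (expand 3 three_ne_zero), h4]
  nth_rw 1 [h3]
  rw [map_add, h1, h2]
  ring

theorem heckeOp_five_recurrence (k : ℕ) : heckeOp 5 (Delta ^ (k + 6)) =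
    Delta ^ 2 * heckeOp 5 (Delta ^ (k + 4)) + Delta ^ 4 * heckeOp 5 (Delta ^ (k + 2)) +
      Delta * heckeOp 5 (Delta ^ (k + 1)) + Delta ^ 6 * heckeOp 5 (Delta ^ k) := by
  have h50 : 5 ≠ 0 := by norm_num
  have hT (k : ℕ) := heckeOp_apply 5 h50 (Delta ^ k)
  have h1 := decimate_mul_expand 5 h50 (Delta ^ k) (Delta ^ 6)
  have h2 := decimate_mul_expand 5 h50 (Delta ^ (k + 2)) (Delta ^ 4)
  have h3 := decimate_mul_expand 5 h50 (Delta ^ (k + 4)) (Delta ^ 2)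
  have h4 := decimate_mul_expand 5 h50 (Delta ^ (k + 1)) Delta
  have h := modular_equation_five
  have h5 : Delta ^ (k + 6) = Delta ^ k * expand 5 h50 (Delta ^ 6) +
      Delta ^ (k + 2) * expand 5 h50 (Delta ^ 4) + Delta ^ (k + 4) * expand 5 h50 (Delta ^ 2) +
      Delta ^ (k + 1) * expand 5 h50 Delta := by
    rw [map_pow, map_pow, map_pow, ← CharTwo.add_eq_zero]
    linear_combination Delta ^ k * h
  have h6 : expand 5 h50 Delta ^ (k + 6) = expand 5 h50 Delta ^ k * Delta ^ 6 +
      expand 5 h50 Delta ^ (k + 2) * Delta ^ 4 + expand 5 h50 Delta ^ (k + 4) * Delta ^ 2 +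
      expand 5 h50 Delta ^ (k + 1) * Delta := by
    rw [← CharTwo.add_eq_zero]
    linear_combination expand 5 h50 Delta ^ k * h
  rw [hT, hT, hT, hT, hT]
  rw [map_pow (expand 5 h50), map_pow (expand 5 h50), map_pow (expand 5 h50),
    map_pow (expand 5 h50), map_pow (expand 5 h50), h6]
  nth_rw 1 [h5]
  rw [map_add, map_add, map_add, h1, h2, h3, h4]
  ring

end ModularEquation

end HeckeModTwo

namespace HeckeModTwo

open PowerSeries

/-! ### Closed formulas for T_3 and T_5 on powers of Δ. -/

section ClosedFormula

/-- In characteristic 2 the equation reads G = Q + QG with Q = x X^r / (1 - (xX)^e)^s. Hence G =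
∑_{m ≥ 1} Q^m, and each Q^m expands by the negative binomial series. -/
theorem coeff_of_mul_eq {R : Type*} [CommRing R] [CharP (PowerSeries R) 2] (x : R) (e s r : ℕ)
    (he : e ≠ 0) (hr : 0 < r) (hs : 0 < s) (G : PowerSeries R)
    (h : G * ((1 - (C x * X) ^ e) ^ s + C x * X ^ r) = C x * X ^ r) (k : ℕ) :
    coeff k G = ∑ m ∈ Finset.Icc 1 k, if r * m ≤ k ∧ e ∣ k - r * m then
      ((s * m - 1 + (k - r * m) / e).choose (s * m - 1) : R) * x ^ (m + (k - r * m)) else 0 := by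
  set I : ℕ → PowerSeries R := fun d =>
    expand e he (rescale (x ^ e) (invOneSubPow R d : PowerSeries R)) with hI
  have hImul (a b : ℕ) : I (a + b) = I a * I b := by
    simp only [hI, invOneSubPow_add, Units.val_mul, map_mul]
  have hIpow (m : ℕ) : I s ^ m = I (s * m) := by
    induction m with
    | zero => simp [hI, invOneSubPow_zero]
    | succ m ih => rw [pow_succ, ih, Nat.mul_succ, hImul]
  have hIinv : (1 - (C x * X) ^ e) ^ s * I s = 1 := by
    have h1 : (1 - (C x * X) ^ e) ^ s = expand e he (rescale (x ^ e) ((1 - X) ^ s)) := by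
      simp only [map_pow, map_sub, map_one, rescale_X, map_mul, expand_C, expand_X, mul_pow]
    rw [h1, hI, ← map_mul, ← map_mul, ← invOneSubPow_inv_eq_one_sub_pow, Units.inv_val,
      map_one, map_one]
  have hIcoeff (d n : ℕ) (hd : 0 < d) : coeff n (I d) = if e ∣ n then
      ((d - 1 + n / e).choose (d - 1) : R) * x ^ n else 0 := by
    simp only [hI, coeff_expand, coeff_rescale, invOneSubPow_val_eq_mk_sub_one_add_choose_of_pos _ _ hd,
      coeff_mk]
    split_ifs with hn
    · obtain ⟨c, rfl⟩ := hn
      rw [Nat.mul_div_cancel_left _ (Nat.pos_of_ne_zero he), pow_mul, mul_comm]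
    · rfl
  set Q : PowerSeries R := C x * X ^ r * I s with hQ
  have hG : G = Q + Q * G := by
    rw [← sub_eq_zero, sub_eq_add_neg, CharTwo.neg_eq]
    have h2 : (2 : PowerSeries R) = 0 := CharTwo.two_eq_zero
    rw [hQ]
    linear_combination I s * h - G * hIinv + (C x * X ^ r * I s) * h2
  have hiter (M : ℕ) : G = ∑ m ∈ Finset.Icc 1 M, Q ^ m + Q ^ M * G := by
    induction M with
    | zero => simp
    | succ M ih =>
      rw [Finset.sum_Icc_succ_top (by omega), pow_succ, add_assoc, mul_assoc, ← mul_add, ← hG]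
      exact ih
  have hQpow (m : ℕ) : Q ^ m = X ^ (r * m) * (C (x ^ m) * I (s * m)) := by
    rw [hQ, mul_pow, mul_pow, hIpow, ← pow_mul, map_pow]
    ring
  -- The remainder Q^(k+1) G has order above k because r ≥ 1.
  have hsum : coeff k G = ∑ m ∈ Finset.Icc 1 (k + 1), coeff k (Q ^ m) := by
    conv_lhs => rw [hiter (k + 1)]
    rw [map_add, map_sum, hQpow (k + 1), mul_assoc, coeff_X_pow_mul', if_neg (by nlinarith),
      add_zero]
  rw [hsum, Finset.sum_Icc_succ_top (by omega), hQpow (k + 1), coeff_X_pow_mul',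
    if_neg (by nlinarith), add_zero]
  refine Finset.sum_congr rfl fun m hm => ?_
  rw [Finset.mem_Icc] at hm
  rw [hQpow, coeff_X_pow_mul', coeff_C_mul, hIcoeff _ _ (Nat.mul_pos hs hm.1)]
  by_cases h1 : r * m ≤ k
  · by_cases h2 : e ∣ k - r * m
    · simp only [h1, h2, and_self, if_true]
      ring
    · simp [h1, h2]
  · simp [h1]

instance : CharP (PowerSeries (PowerSeries (ZMod 2))) 2 :=
  charP_of_injective_ringHom (C_injective (R := PowerSeries (ZMod 2))) 2

theorem heckeOp_three_Delta : heckeOp 3 (Delta ^ 1) = 0 := by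
  refine eq_zero_of_mem_span_Delta_pow
    (heckeOp_Delta_pow_mem_span' Nat.prime_three (by norm_num) le_rfl) fun i hi => ?_
  rw [heckeOp_apply 3 three_ne_zero, map_add, coeff_decimate, coeff_expand,
    coeff_Delta_pow_of_mod_ne 1 (by omega)]
  split_ifs with h
  · rw [coeff_Delta_pow_of_mod_ne 1 (by omega), add_zero]
  · rw [add_zero]

theorem heckeOp_three_Delta_cube : heckeOp 3 (Delta ^ 3) = Delta := by
  rw [← CharTwo.add_eq_zero]
  refine eq_zero_of_mem_span_Delta_pow (N := 3) (add_mem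
    (heckeOp_Delta_pow_mem_span' Nat.prime_three (by norm_num) le_rfl)
    (Submodule.subset_span ⟨1, by simp, pow_one _⟩)) fun i hi => ?_
  rw [heckeOp_apply 3 three_ne_zero, map_add, map_add, coeff_decimate, coeff_expand]
  by_cases hi1 : i = 1
  · subst hi1
    have h1 := coeff_Delta_pow_self 1
    rw [pow_one] at h1
    rw [coeff_Delta_pow_self, if_neg (by norm_num), h1, add_zero]
    rfl
  · rw [coeff_Delta_pow_of_mod_ne 3 (by omega), coeff_Delta_of_mod_ne (by omega), add_zero, zero_add]
    split_ifs with h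
    · rw [coeff_Delta_pow_of_mod_ne 3 (by omega)]
    · rfl

theorem heckeOp_five_Delta : heckeOp 5 (Delta ^ 1) = 0 := by
  refine eq_zero_of_mem_span_Delta_pow
    (heckeOp_Delta_pow_mem_span' Nat.prime_five (by norm_num) le_rfl) fun i hi => ?_
  rw [heckeOp_apply 5 (by norm_num), map_add, coeff_decimate, coeff_expand,
    coeff_Delta_pow_of_mod_ne 1 (by omega)]
  split_ifs with h
  · rw [coeff_Delta_pow_of_mod_ne 1 (by omega), add_zero]
  · rw [add_zero]

theorem heckeOp_five_Delta_cube : heckeOp 5 (Delta ^ 3) = 0 := by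
  refine eq_zero_of_mem_span_Delta_pow
    (heckeOp_Delta_pow_mem_span' Nat.prime_five (by norm_num) le_rfl) fun i hi => ?_
  rw [heckeOp_apply 5 (by norm_num), map_add, coeff_decimate, coeff_expand,
    coeff_Delta_pow_of_mod_ne 3 (by omega)]
  split_ifs with h
  · rw [coeff_Delta_pow_of_mod_ne 3 (by omega), add_zero]
  · rw [add_zero]

theorem heckeOp_five_Delta_pow_five : heckeOp 5 (Delta ^ 5) = Delta := by
  rw [← CharTwo.add_eq_zero]
  refine eq_zero_of_mem_span_Delta_pow (N := 5) (add_mem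
    (heckeOp_Delta_pow_mem_span' Nat.prime_five (by norm_num) le_rfl)
    (Submodule.subset_span ⟨1, by simp, pow_one _⟩)) fun i hi => ?_
  rw [heckeOp_apply 5 (by norm_num), map_add, map_add, coeff_decimate, coeff_expand]
  by_cases hi1 : i = 1
  · subst hi1
    have h1 := coeff_Delta_pow_self 1
    rw [pow_one] at h1
    rw [coeff_Delta_pow_self, if_neg (by norm_num), h1, add_zero]
    rfl
  · rw [coeff_Delta_pow_of_mod_ne 5 (by omega), coeff_Delta_of_mod_ne (by omega), add_zero, zero_add]
    split_ifs with h
    · rw [coeff_Delta_pow_of_mod_ne 5 (by omega)]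
    · rfl

/-- The recurrence and the values for k ≤ 3 say that the generating series G of T_3 Δ^k satisfies (1
- Δ⁴X⁴ + ΔX³) G = ΔX³. -/
theorem heckeOp_three_Delta_pow (k : ℕ) :
    heckeOp 3 (Delta ^ k) = ∑ m ∈ Finset.Icc 1 k, if 3 * m ≤ k ∧ 4 ∣ k - 3 * m then
      ((m - 1 + (k - 3 * m) / 4).choose (m - 1) : PowerSeries (ZMod 2)) *
        Delta ^ (m + (k - 3 * m)) else 0 := by
  set G : PowerSeries (PowerSeries (ZMod 2)) := PowerSeries.mk fun k => heckeOp 3 (Delta ^ k) with hG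
  have h := coeff_of_mul_eq Delta 4 1 3 (by norm_num) (by norm_num) (by norm_num) G ?_ k
  · simpa [hG] using h
  have h1 : G * ((1 - (C Delta * X) ^ 4) ^ 1 + C Delta * X ^ 3) =
      G - C (Delta ^ 4) * (X ^ 4 * G) + C Delta * (X ^ 3 * G) := by
    rw [map_pow]
    ring
  have h0 : heckeOp 3 1 = 0 := heckeOp_one 3 (by norm_num)
  have h2 : heckeOp 3 (Delta ^ 2) = 0 := by
    have := heckeOp_sq 3 (by norm_num) (Delta ^ 1) (by decide)
    rw [heckeOp_three_Delta] at this
    simpa using this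
  rw [h1]
  ext1 n
  rw [map_add, map_sub, coeff_C_mul, coeff_C_mul, coeff_C_mul, coeff_X_pow_mul', coeff_X_pow_mul',
    coeff_X_pow]
  simp only [hG, coeff_mk]
  match n with
  | 0 => simp [h0]
  | 1 => simpa using heckeOp_three_Delta
  | 2 => simp [h2]
  | 3 => simpa [heckeOp_three_Delta_cube] using Or.inr h0
  | n + 4 =>
    rw [heckeOp_three_recurrence, if_pos (by omega), if_pos (by omega), if_neg (by omega),
      show n + 4 - 4 = n from rfl, show n + 4 - 3 = n + 1 from rfl]
    linear_combination (Delta * heckeOp 3 (Delta ^ (n + 1))) * (CharTwo.two_eq_zero : (2 : PowerSeries (ZMod 2)) = 0)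

/-- Here the denominator is a cube, since 1 + Y² + Y⁴ + Y⁶ = (1 - Y²)³ modulo 2 for Y = ΔX. -/
theorem heckeOp_five_Delta_pow (k : ℕ) :
    heckeOp 5 (Delta ^ k) = ∑ m ∈ Finset.Icc 1 k, if 5 * m ≤ k ∧ 2 ∣ k - 5 * m then
      ((3 * m - 1 + (k - 5 * m) / 2).choose (3 * m - 1) : PowerSeries (ZMod 2)) *
        Delta ^ (m + (k - 5 * m)) else 0 := by
  set G : PowerSeries (PowerSeries (ZMod 2)) := PowerSeries.mk fun k => heckeOp 5 (Delta ^ k) with hG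
  have h := coeff_of_mul_eq Delta 2 3 5 (by norm_num) (by norm_num) (by norm_num) G ?_ k
  · simpa [hG] using h
  have h1 : G * ((1 - (C Delta * X) ^ 2) ^ 3 + C Delta * X ^ 5) =
      G + C (Delta ^ 2) * (X ^ 2 * G) + C (Delta ^ 4) * (X ^ 4 * G) + C (Delta ^ 6) * (X ^ 6 * G) +
        C Delta * (X ^ 5 * G) := by
    have h2 : (2 : PowerSeries (PowerSeries (ZMod 2))) = 0 := CharTwo.two_eq_zero
    simp only [map_pow]
    linear_combination (-2 * (C Delta * X) ^ 2 + (C Delta * X) ^ 4 - (C Delta * X) ^ 6) * G * h2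
  have h0 : heckeOp 5 1 = 0 := heckeOp_one 5 (by norm_num)
  have h2 : heckeOp 5 (Delta ^ 2) = 0 := by
    have := heckeOp_sq 5 (by norm_num) (Delta ^ 1) (by decide)
    rw [heckeOp_five_Delta] at this
    simpa using this
  have h4 : heckeOp 5 (Delta ^ 4) = 0 := by
    have := heckeOp_sq 5 (by norm_num) (Delta ^ 2) (by decide)
    rw [h2, ← pow_mul] at this
    simpa using this
  have h10 := heckeOp_five_Delta
  rw [pow_one] at h10
  rw [h1]
  ext1 n
  rw [map_add, map_add, map_add, map_add, coeff_C_mul, coeff_C_mul, coeff_C_mul, coeff_C_mul,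
    coeff_C_mul, coeff_X_pow_mul', coeff_X_pow_mul', coeff_X_pow_mul', coeff_X_pow_mul', coeff_X_pow]
  simp only [hG, coeff_mk]
  match n with
  | 0 => simp [h0]
  | 1 => simp [h10]
  | 2 => simp [h2, h0]
  | 3 => simp [heckeOp_five_Delta_cube, h10]
  | 4 => simp [h4, h2, h0]
  | 5 => simp [heckeOp_five_Delta_pow_five, heckeOp_five_Delta_cube, h10, h0]
  | n + 6 =>
    rw [heckeOp_five_recurrence, if_pos (by omega), if_pos (by omega), if_pos (by omega),
      if_pos (by omega), if_neg (by omega), show n + 6 - 6 = n from rfl,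
      show n + 6 - 5 = n + 1 from rfl, show n + 6 - 2 = n + 4 from rfl,
      show n + 6 - 4 = n + 2 from rfl]
    linear_combination (Delta ^ 2 * heckeOp 5 (Delta ^ (n + 4)) +
      Delta ^ 4 * heckeOp 5 (Delta ^ (n + 2)) + Delta * heckeOp 5 (Delta ^ (n + 1)) +
      Delta ^ 6 * heckeOp 5 (Delta ^ n)) * (CharTwo.two_eq_zero : (2 : PowerSeries (ZMod 2)) = 0)

end ClosedFormula

end HeckeModTwo

namespace HeckeModTwo

/-! ### The code of an exponent, and how it changes in the closed formulas. -/

section Codes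

/-- The number whose binary digits are the digits of `n` at even positions. -/
def codeThree (n : ℕ) : ℕ := if n = 0 then 0 else 2 * codeThree (n / 4) + n % 2
termination_by n
decreasing_by omega

/-- The number whose binary digits are the digits of `n` at odd positions. -/
def codeFive (n : ℕ) : ℕ := if n = 0 then 0 else 2 * codeFive (n / 4) + n / 2 % 2
termination_by n
decreasing_by omega

theorem codeThree_eq (n : ℕ) : codeThree n = 2 * codeThree (n / 4) + n % 2 := by
  rcases eq_or_ne n 0 with rfl | h
  · simp [codeThree]
  · conv_lhs => rw [codeThree, if_neg h]

theorem codeFive_eq (n : ℕ) : codeFive n = 2 * codeFive (n / 4) + n / 2 % 2 := by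
  rcases eq_or_ne n 0 with rfl | h
  · simp [codeFive]
  · conv_lhs => rw [codeFive, if_neg h]

/-- The pair formed by the height `codeThree n + codeFive n` and by `codeFive n`. -/
def code (n : ℕ) : ℤ × ℤ := (codeThree n + codeFive n, codeFive n)

/-- The contribution of the last two binary digits of `n` to `code n`. -/
def digitCode (n : ℕ) : ℤ × ℤ := ((n % 2 + n / 2 % 2 : ℕ), (n / 2 % 2 : ℕ))

theorem digitCode_mod (n : ℕ) : digitCode (n % 4) = digitCode n := by
  simp only [digitCode]
  rw [show n % 4 % 2 = n % 2 by omega, show n % 4 / 2 % 2 = n / 2 % 2 by omega]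

/-- Removing one digit in base 4 halves both code numbers; this lets codes be compared by a finite
carry automaton. -/
theorem code_eq (n : ℕ) : code n =
    (2 * (code (n / 4)).1 + (digitCode n).1, 2 * (code (n / 4)).2 + (digitCode n).2) := by
  simp only [code, digitCode]
  rw [codeThree_eq n, codeFive_eq n]
  push_cast
  refine Prod.ext ?_ ?_
  · dsimp only
    ring
  · rfl

theorem code_zero : code 0 = (0, 0) := by simp [code, codeThree, codeFive]

theorem code_of_lt {n : ℕ} (h : n < 16) : code n =
    (2 * (digitCode (n / 4)).1 + (digitCode n).1, 2 * (digitCode (n / 4)).2 + (digitCode n).2) := by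
  rw [code_eq, code_eq (n / 4), show n / 4 / 4 = 0 by omega, code_zero]
  simp

/-- The lexicographic order. -/
def LexLE (x y : ℤ × ℤ) : Prop := x.1 < y.1 ∨ x.1 = y.1 ∧ x.2 ≤ y.2

instance (x y : ℤ × ℤ) : Decidable (LexLE x y) := inferInstanceAs (Decidable (_ ∨ _))

/-- The number whose binary digits are those of `a` at even positions and `b` at odd positions. -/
def encode (a b : ℕ) : ℕ :=
  if a = 0 ∧ b = 0 then 0 else 4 * encode (a / 2) (b / 2) + a % 2 + 2 * (b % 2)
termination_by a + b
decreasing_by omega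

theorem encode_zero : encode 0 0 = 0 := by simp [encode]

theorem encode_eq (a b : ℕ) : encode a b = 4 * encode (a / 2) (b / 2) + a % 2 + 2 * (b % 2) := by
  by_cases h : a = 0 ∧ b = 0
  · obtain ⟨rfl, rfl⟩ := h
    simp [encode]
  · conv_lhs => rw [encode, if_neg h]

theorem codeThree_encode (a b : ℕ) : codeThree (encode a b) = a := by
  by_cases h : a = 0 ∧ b = 0
  · obtain ⟨rfl, rfl⟩ := h
    simp [encode, codeThree]
  · have := codeThree_encode (a / 2) (b / 2)
    rw [codeThree_eq, encode_eq, show (4 * encode (a / 2) (b / 2) + a % 2 + 2 * (b % 2)) / 4 =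
      encode (a / 2) (b / 2) by omega, this]
    omega
termination_by a + b
decreasing_by omega

theorem codeFive_encode (a b : ℕ) : codeFive (encode a b) = b := by
  by_cases h : a = 0 ∧ b = 0
  · obtain ⟨rfl, rfl⟩ := h
    simp [encode, codeFive]
  · have := codeFive_encode (a / 2) (b / 2)
    rw [codeFive_eq, encode_eq, show (4 * encode (a / 2) (b / 2) + a % 2 + 2 * (b % 2)) / 4 =
      encode (a / 2) (b / 2) by omega, this]
    omega
termination_by a + b
decreasing_by omega

theorem code_encode (a b : ℕ) : code (encode a b) = ((a : ℤ) + b, (b : ℤ)) := by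
  simp [code, codeThree_encode, codeFive_encode]

theorem encode_code (n : ℕ) : encode (codeThree n) (codeFive n) = n := by
  induction n using Nat.strong_induction_on with
  | _ n ih =>
    rcases eq_or_ne n 0 with rfl | hn
    · simp [codeThree, codeFive, encode]
    · have h1 := codeThree_eq n
      have h2 := codeFive_eq n
      rw [encode_eq, show codeThree n / 2 = codeThree (n / 4) by omega,
        show codeFive n / 2 = codeFive (n / 4) by omega, ih _ (by omega)]
      omega

theorem land_four_mul_add {a b r s : ℕ} (hr : r < 4) (hs : s < 4)
    (h : (4 * a + r) &&& (4 * b + s) = 0) : a &&& b = 0 ∧ r &&& s = 0 := by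
  have h1 := Nat.and_div_two_pow (a := 4 * a + r) (b := 4 * b + s) (n := 2)
  have h2 := Nat.and_mod_two_pow (a := 4 * a + r) (b := 4 * b + s) (n := 2)
  rw [h] at h1 h2
  norm_num at h1 h2
  rw [show (4 * a + r) / 4 = a by omega, show (4 * b + s) / 4 = b by omega] at h1
  rw [Nat.mod_eq_of_lt hr, Nat.mod_eq_of_lt hs] at h2
  exact ⟨h1.symm, h2.symm⟩

theorem land_four_mul_add_eq_zero {a b r s : ℕ} (hr : r < 4) (hs : s < 4)
    (h1 : a &&& b = 0) (h2 : r &&& s = 0) : (4 * a + r) &&& (4 * b + s) = 0 := by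
  have h3 := Nat.and_div_two_pow (a := 4 * a + r) (b := 4 * b + s) (n := 2)
  have h4 := Nat.and_mod_two_pow (a := 4 * a + r) (b := 4 * b + s) (n := 2)
  norm_num at h3 h4
  rw [show (4 * a + r) / 4 = a by omega, show (4 * b + s) / 4 = b by omega, h1] at h3
  rw [Nat.mod_eq_of_lt hr, Nat.mod_eq_of_lt hs, h2] at h4
  omega

/-- Kummer's criterion, by Lucas's theorem one binary digit at a time: no carry may occur in x + y.
-/
theorem odd_choose_add_iff (x y : ℕ) : Odd ((x + y).choose x) ↔ x &&& y = 0 := by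
  induction x using Nat.strong_induction_on generalizing y with
  | _ x ih =>
    rcases eq_or_ne x 0 with rfl | hx
    · simp
    have h1 := Nat.and_div_two_pow (a := x) (b := y) (n := 1)
    have h2 := Nat.and_mod_two_pow (a := x) (b := y) (n := 1)
    rw [pow_one] at h1 h2
    have hl := Choose.choose_modEq_choose_mod_mul_choose_div_nat (p := 2) (n := x + y) (k := x)
    have hodd : Odd ((x + y).choose x) ↔
        Odd (((x + y) % 2).choose (x % 2) * ((x + y) / 2).choose (x / 2)) := by
      rw [Nat.odd_iff, Nat.odd_iff, hl]
    have hi := ih (x / 2) (by omega) (y / 2)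
    rw [hodd]
    rcases Nat.mod_two_eq_zero_or_one x with hx2 | hx2 <;>
      rcases Nat.mod_two_eq_zero_or_one y with hy2 | hy2
    · rw [show (x + y) / 2 = x / 2 + y / 2 by omega, show (x + y) % 2 = 0 by omega, hx2,
        Nat.choose_self, one_mul, hi]
      rw [hx2, hy2] at h2
      simp only [Nat.and_zero] at h2
      omega
    · rw [show (x + y) / 2 = x / 2 + y / 2 by omega, show (x + y) % 2 = 1 by omega, hx2,
        Nat.choose_zero_right, one_mul, hi]
      rw [hx2, hy2] at h2
      simp only [Nat.zero_and] at h2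
      omega
    · rw [show (x + y) / 2 = x / 2 + y / 2 by omega, show (x + y) % 2 = 1 by omega, hx2,
        Nat.choose_self, one_mul, hi]
      rw [hx2, hy2] at h2
      simp only [Nat.and_zero] at h2
      omega
    · rw [show (x + y) % 2 = 0 by omega, hx2]
      rw [hx2, hy2] at h2
      simp only [Nat.and_self] at h2
      simp
      omega

/-- The pairs of carries `(c, d)` that occur when `3M + 4J` and `M + 4J` are computed digitwise,
with lower bounds for `code (3M + 4J + c) - code (M + 4J + d)`. -/
def carriesThree : List (ℕ × ℕ × ℤ × ℤ) :=
  [(0, 0, 0, 0), (1, 0, 1, 0), (1, 1, 0, 0), (2, 0, 1, 1), (2, 1, 0, 1), (2, 2, 0, 0),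
    (3, 1, 1, 1), (3, 2, 1, 0), (3, 3, 0, 0)]

theorem carriesThree_initial : ∀ s ∈ carriesThree, LexLE s.2.2
    (2 * (digitCode (s.1 / 4)).1 + (digitCode s.1).1
      - (2 * (digitCode (s.2.1 / 4)).1 + (digitCode s.2.1).1),
    2 * (digitCode (s.1 / 4)).2 + (digitCode s.1).2
      - (2 * (digitCode (s.2.1 / 4)).2 + (digitCode s.2.1).2)) := by
  decide

theorem carriesThree_lt : ∀ s ∈ carriesThree, s.1 < 16 ∧ s.2.1 < 16 := by
  decide

/-- Transitions of the automaton on the last base-4 digits μ of M and ν of J. The digit ν enters the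
next carry whole because J is multiplied by 4. -/
theorem carriesThree_step : ∀ s ∈ carriesThree, ∀ μ < 4, ∀ ν < 4, ν &&& μ = 0 →
    ∃ t ∈ carriesThree, t.1 = ν + (3 * μ + s.1) / 4 ∧ t.2.1 = ν + (μ + s.2.1) / 4 ∧
      LexLE s.2.2 (2 * t.2.2.1 + (digitCode (3 * μ + s.1)).1 - (digitCode (μ + s.2.1)).1,
        2 * t.2.2.2 + (digitCode (3 * μ + s.1)).2 - (digitCode (μ + s.2.1)).2) := by
  decide

/-- Doubling and translation preserve the lexicographic order, so a bound for the leading digits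
passes to the whole numbers. -/
theorem lexLE_code_sub_code_of_step {x y : ℕ} {s t : ℤ × ℤ} {u v : ℕ}
    (ht : LexLE t (code (x / 4) - code (y / 4))) (hu : x % 4 = u % 4) (hv : y % 4 = v % 4)
    (hs : LexLE s (2 * t.1 + (digitCode u).1 - (digitCode v).1,
      2 * t.2 + (digitCode u).2 - (digitCode v).2)) :
    LexLE s (code x - code y) := by
  rw [code_eq x, code_eq y, ← digitCode_mod x, ← digitCode_mod y, hu, hv, digitCode_mod,
    digitCode_mod]
  simp only [LexLE, Prod.fst_sub, Prod.snd_sub] at *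
  omega

theorem lexLE_code_three_mul_add (M J : ℕ) (h : J &&& M = 0) :
    ∀ s ∈ carriesThree, LexLE s.2.2
      (code (3 * M + 4 * J + s.1) - code (M + 4 * J + s.2.1)) := by
  obtain ⟨n, hn⟩ : ∃ n, M + J = n := ⟨_, rfl⟩
  induction n using Nat.strong_induction_on generalizing M J with
  | _ n ih =>
    intro s hs
    by_cases h0 : M = 0 ∧ J = 0
    · obtain ⟨rfl, rfl⟩ := h0
      have h1 := carriesThree_lt s hs
      have h2 := carriesThree_initial s hs
      simp only [mul_zero, zero_add]
      rw [code_of_lt h1.1, code_of_lt h1.2]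
      exact h2
    have hdec : 4 * (J / 4) + J % 4 &&& 4 * (M / 4) + M % 4 = 0 := by
      rwa [Nat.div_add_mod, Nat.div_add_mod]
    have hμ := Nat.mod_lt M (by norm_num : 4 > 0)
    have hν := Nat.mod_lt J (by norm_num : 4 > 0)
    obtain ⟨hd, hr⟩ := land_four_mul_add hν hμ hdec
    obtain ⟨t, ht, ht1, ht2, hle⟩ := carriesThree_step _ hs _ hμ _ hν hr
    have := ih (M / 4 + J / 4) (by omega) (M / 4) (J / 4) hd rfl _ ht
    rw [ht1, ht2] at this
    refine lexLE_code_sub_code_of_step ?_ ?_ ?_ hle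
    · convert this using 3 <;> omega
    · omega
    · omega

/-- The triples of carries `(c, d, e)` that occur when `5M + j`, `M + j` and `6M` are computed
digitwise, with lower bounds for `code (5M + j + c) - code (M + j + d)`. -/
def carriesFive : List (ℕ × ℕ × ℕ × ℤ × ℤ) :=
  [(0, 0, 0, 0, 0), (0, 0, 1, 0, 0), (1, 0, 1, 1, 0), (1, 0, 2, 0, 1), (1, 1, 1, 0, 0),
    (2, 0, 2, 1, 1), (2, 0, 3, 1, 1), (2, 1, 2, 0, 1), (3, 0, 3, 1, 2), (3, 0, 4, 1, 0),
    (3, 1, 3, 1, 1), (3, 1, 4, 1, -1), (4, 0, 4, 2, 0), (4, 0, 5, 2, 0), (4, 1, 4, 1, 0),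
    (4, 1, 5, 1, 0), (5, 1, 5, 2, 0)]

theorem carriesFive_initial : ∀ s ∈ carriesFive, LexLE s.2.2.2
    (2 * (digitCode (s.1 / 4)).1 + (digitCode s.1).1
      - (2 * (digitCode (s.2.1 / 4)).1 + (digitCode s.2.1).1),
    2 * (digitCode (s.1 / 4)).2 + (digitCode s.1).2
      - (2 * (digitCode (s.2.1 / 4)).2 + (digitCode s.2.1).2)) := by
  decide

theorem carriesFive_lt : ∀ s ∈ carriesFive, s.1 < 16 ∧ s.2.1 < 16 := by
  decide

/-- The third carry follows 6M, whose digits enter the disjointness condition. -/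
theorem carriesFive_step : ∀ s ∈ carriesFive, ∀ μ < 4, ∀ ν < 4, ν &&& (6 * μ + s.2.2.1) % 4 = 0 →
    ∃ t ∈ carriesFive, t.1 = (5 * μ + ν + s.1) / 4 ∧ t.2.1 = (μ + ν + s.2.1) / 4 ∧
      t.2.2.1 = (6 * μ + s.2.2.1) / 4 ∧
      LexLE s.2.2.2
        (2 * t.2.2.2.1 + (digitCode (5 * μ + ν + s.1)).1 - (digitCode (μ + ν + s.2.1)).1,
        2 * t.2.2.2.2 + (digitCode (5 * μ + ν + s.1)).2 - (digitCode (μ + ν + s.2.1)).2) := by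
  decide

theorem lexLE_code_five_mul_add (M J : ℕ) :
    ∀ s ∈ carriesFive, J &&& (6 * M + s.2.2.1) = 0 → LexLE s.2.2.2
      (code (5 * M + J + s.1) - code (M + J + s.2.1)) := by
  obtain ⟨n, hn⟩ : ∃ n, M + J = n := ⟨_, rfl⟩
  induction n using Nat.strong_induction_on generalizing M J with
  | _ n ih =>
    intro s hs h
    by_cases h0 : M = 0 ∧ J = 0
    · obtain ⟨rfl, rfl⟩ := h0
      have h1 := carriesFive_lt s hs
      have h2 := carriesFive_initial s hs
      simp only [mul_zero, zero_add]
      rw [code_of_lt h1.1, code_of_lt h1.2]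
      exact h2
    have hdec : 4 * (J / 4) + J % 4 &&&
        4 * ((6 * M + s.2.2.1) / 4) + (6 * M + s.2.2.1) % 4 = 0 := by
      rwa [Nat.div_add_mod, Nat.div_add_mod]
    have hμ := Nat.mod_lt M (by norm_num : 4 > 0)
    have hν := Nat.mod_lt J (by norm_num : 4 > 0)
    obtain ⟨hd, hr⟩ := land_four_mul_add hν (Nat.mod_lt _ (by norm_num)) hdec
    rw [show (6 * M + s.2.2.1) % 4 = (6 * (M % 4) + s.2.2.1) % 4 by omega] at hr
    obtain ⟨t, ht, ht1, ht2, ht3, hle⟩ := carriesFive_step _ hs _ hμ _ hν hr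
    have := ih (M / 4 + J / 4) (by omega) (M / 4) (J / 4) rfl _ ht
      (by rw [ht3, show 6 * (M / 4) + (6 * (M % 4) + s.2.2.1) / 4 = (6 * M + s.2.2.1) / 4 by omega]
          exact hd)
    rw [ht1, ht2] at this
    refine lexLE_code_sub_code_of_step ?_ ?_ ?_ hle
    · convert this using 3 <;> omega
    · omega
    · omega

theorem lexLE_code_three (M j : ℕ) (h : j &&& 2 * M = 0) :
    LexLE (1, 0) (code (3 * M + 2 * j + 1) - code (M + 2 * j)) := by
  have h1 := Nat.and_div_two_pow (a := j) (b := 2 * M) (n := 1)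
  rw [h, pow_one, Nat.mul_div_cancel_left _ two_pos] at h1
  have key := lexLE_code_three_mul_add M (j / 2) h1.symm
  -- Writing 2j = 4(j/2) + 2(j mod 2), the parity of j decides the initial carries.
  rcases Nat.mod_two_eq_zero_or_one j with hj | hj
  · have := key (1, 0, 1, 0) (by decide)
    convert this using 3 <;> dsimp only <;> omega
  · have := key (3, 2, 1, 0) (by decide)
    convert this using 3 <;> dsimp only <;> omega

theorem lexLE_code_five (M j : ℕ) (h : j &&& (6 * M + 2) = 0) :
    LexLE (1, 1) (code (5 * M + j + 2) - code (M + j)) :=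
  lexLE_code_five_mul_add M j (2, 0, 2, 1, 1) (by decide) h

/-- Exhibits the term of T_3 that lowers a+1 to a. For even a only the last bit changes and M = 0
works; for odd a the carry passes to the next base-4 digit, hence the recursion. -/
theorem exists_leading_three (a b : ℕ) : ∃ M j, j &&& 2 * M = 0 ∧
    encode (a + 1) b = 3 * M + 2 * j + 1 ∧ encode a b = M + 2 * j := by
  induction a using Nat.strong_induction_on generalizing b with
  | _ a ih =>
    have h1 := encode_eq a b
    have h2 := encode_eq (a + 1) b
    rcases Nat.mod_two_eq_zero_or_one a with ha | ha
    · rw [show (a + 1) / 2 = a / 2 by omega] at h2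
      exact ⟨0, encode a b / 2, by simp, by omega, by omega⟩
    · rw [show (a + 1) / 2 = a / 2 + 1 by omega] at h2
      obtain ⟨M, j, h, h3, h4⟩ := ih (a / 2) (by omega) (b / 2)
      refine ⟨4 * M + 1, 4 * j + b % 2, ?_, by omega, by omega⟩
      rw [show 2 * (4 * M + 1) = 4 * (2 * M) + 2 by ring]
      refine land_four_mul_add_eq_zero (by omega) (by omega) h ?_
      rcases Nat.mod_two_eq_zero_or_one b with hb | hb <;> rw [hb] <;> rfl

theorem exists_leading_five (a b : ℕ) : ∃ M j, j &&& (6 * M + 2) = 0 ∧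
    encode a (b + 1) = 5 * M + j + 2 ∧ encode a b = M + j := by
  induction b using Nat.strong_induction_on generalizing a with
  | _ b ih =>
    have h1 := encode_eq a b
    have h2 := encode_eq a (b + 1)
    rcases Nat.mod_two_eq_zero_or_one b with hb | hb
    · rw [show (b + 1) / 2 = b / 2 by omega] at h2
      refine ⟨0, encode a b, ?_, by omega, by omega⟩
      rw [show encode a b = 4 * encode (a / 2) (b / 2) + a % 2 by omega]
      refine land_four_mul_add_eq_zero (b := 0) (s := 2) (by omega) (by omega) (by simp) ?_
      rcases Nat.mod_two_eq_zero_or_one a with ha | ha <;> rw [ha] <;> rfl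
    · rw [show (b + 1) / 2 = b / 2 + 1 by omega] at h2
      obtain ⟨M, j, h, h3, h4⟩ := ih (b / 2) (by omega) (a / 2)
      refine ⟨4 * M + 1, 4 * j + (a % 2 + 1), ?_, by omega, by omega⟩
      rw [show 6 * (4 * M + 1) + 2 = 4 * (6 * M + 2) + 0 by ring]
      exact land_four_mul_add_eq_zero (by omega) (by omega) h (by simp)

end Codes

end HeckeModTwo

namespace HeckeModTwo

open PowerSeries

/-! ### Commutation of the Hecke operators and stability of F(n). -/

section Parity

theorem natCast_eq_ite_odd (n : ℕ) [Decidable (Odd n)] :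
    (n : PowerSeries (ZMod 2)) = if Odd n then 1 else 0 := by
  split_ifs with h
  · obtain ⟨m, rfl⟩ := h
    rw [Nat.cast_add, Nat.cast_mul, show ((2 : ℕ) : PowerSeries (ZMod 2)) = 0 from CharP.cast_eq_zero _ 2]
    simp
  · obtain ⟨m, rfl⟩ := Nat.not_odd_iff_even.1 h
    rw [Nat.cast_add, CharTwo.add_self_eq_zero]

theorem coeff_heckeOp (p n : ℕ) (f : PowerSeries (ZMod 2)) :
    coeff n (heckeOp p f) = coeff (p * n) f + if p ∣ n then coeff (n / p) f else 0 := by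
  simp [heckeOp]

theorem coeff_one_heckeOp {p : ℕ} (hp : p.Prime) (f : PowerSeries (ZMod 2)) :
    coeff 1 (heckeOp p f) = coeff p f := by
  rw [coeff_heckeOp, mul_one, if_neg (by simpa using hp.one_lt.ne'), add_zero]

theorem heckeOp_commute {p q : ℕ} (hp : p.Prime) (hq : q.Prime) :
    Commute (heckeOp p) (heckeOp q) := by
  rcases eq_or_ne p q with rfl | hpq
  · exact Commute.refl _
  have hc : Nat.Coprime p q := (Nat.coprime_primes hp hq).2 hpq
  refine LinearMap.ext fun f => PowerSeries.ext fun n => ?_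
  simp only [Module.End.mul_apply, coeff_heckeOp]
  have h1 : q ∣ p * n ↔ q ∣ n := hc.symm.dvd_mul_left
  have h2 : p ∣ q * n ↔ p ∣ n := hc.dvd_mul_left
  simp only [h1, h2]
  rw [show q * (p * n) = p * (q * n) by ring]
  by_cases hpn : p ∣ n <;> by_cases hqn : q ∣ n
  · obtain ⟨m, rfl⟩ := hc.mul_dvd_of_dvd_of_dvd hpn hqn
    have e1 : p * (p * q * m) / q = p * (p * m) := by
      rw [show p * (p * q * m) = q * (p * (p * m)) by ring, Nat.mul_div_cancel_left _ hq.pos]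
    have e2 : p * q * m / p = q * m := by rw [mul_assoc, Nat.mul_div_cancel_left _ hp.pos]
    have e3 : p * q * m / q = p * m := by
      rw [show p * q * m = q * (p * m) by ring, Nat.mul_div_cancel_left _ hq.pos]
    have e4 : q * (p * q * m) / p = q * (q * m) := by
      rw [show q * (p * q * m) = p * (q * (q * m)) by ring, Nat.mul_div_cancel_left _ hp.pos]
    simp only [hpn, hqn, if_true, e1, e2, e3, e4, dvd_mul_right, Nat.mul_div_cancel_left _ hp.pos,
      Nat.mul_div_cancel_left _ hq.pos]
    ring
  · have h3 : ¬ q ∣ n / p := fun h => hqn (h.trans (Nat.div_dvd_of_dvd hpn))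
    simp only [hpn, hqn, h3, if_true, if_false, add_zero]
    rw [Nat.mul_div_assoc _ hpn]
  · have h3 : ¬ p ∣ n / q := fun h => hpn (h.trans (Nat.div_dvd_of_dvd hqn))
    simp only [hpn, hqn, h3, if_true, if_false, add_zero]
    rw [Nat.mul_div_assoc _ hqn]
  · simp [hpn, hqn]

theorem coeff_heckeOp_of_even {p : ℕ} (hp : p.Prime) (hp2 : p ≠ 2) {f : PowerSeries (ZMod 2)}
    (hf : ∀ n, Even n → coeff n f = 0) (n : ℕ) (hn : Even n) : coeff n (heckeOp p f) = 0 := by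
  rw [coeff_heckeOp, hf _ (hn.mul_left p), zero_add]
  split_ifs with h
  · obtain ⟨m, rfl⟩ := h
    rw [Nat.mul_div_cancel_left _ hp.pos]
    refine hf _ ((Nat.even_mul.1 hn).resolve_left ?_)
    exact Nat.not_even_iff_odd.2 (hp.odd_of_ne_two hp2)
  · rfl

/-- The terms of odd degree of a power series. -/
noncomputable def oddPart : Module.End (ZMod 2) (PowerSeries (ZMod 2)) where
  toFun f := PowerSeries.mk fun n => if Even n then 0 else coeff n f
  map_add' f g := by
    ext n
    simp only [coeff_mk, map_add]
    split_ifs <;> simp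
  map_smul' c f := by
    ext n
    simp only [coeff_mk, map_smul, RingHom.id_apply, smul_eq_mul]
    split_ifs <;> simp

theorem coeff_oddPart (n : ℕ) (f : PowerSeries (ZMod 2)) :
    coeff n (oddPart f) = if Even n then 0 else coeff n f := by
  simp [oddPart]

theorem coeff_Delta_pow_of_even {k n : ℕ} (hk : Odd k) (hn : Even n) :
    coeff n (Delta ^ k) = 0 := by
  refine coeff_Delta_pow_of_mod_ne k fun h => ?_
  rw [Nat.odd_iff] at hk
  rw [Nat.even_iff] at hn
  omega

theorem mem_cuspSpace_of_even_coeff {f : PowerSeries (ZMod 2)} {n : ℕ}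
    (hf : f ∈ Submodule.span (ZMod 2) ((fun j : ℕ => Delta ^ j) '' {j | j < 2 * n}))
    (h : ∀ m, Even m → coeff m f = 0) : f ∈ cuspSpace n := by
  have h1 : oddPart f = f := by
    ext m
    rw [coeff_oddPart]
    split_ifs with hm
    · rw [h m hm]
    · rfl
  rw [← h1]
  clear h1 h
  have h2 := Submodule.mem_map_of_mem (f := oddPart) hf
  rw [Submodule.map_span] at h2
  refine Submodule.span_le.2 ?_ h2
  rintro _ ⟨_, ⟨j, hj, rfl⟩, rfl⟩
  rcases Nat.even_or_odd' j with ⟨i, rfl | rfl⟩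
  · suffices h0 : oddPart (Delta ^ (2 * i)) = 0 by
      rw [SetLike.mem_coe, h0]
      exact zero_mem _
    ext m
    rw [coeff_oddPart]
    split_ifs with hm
    · simp
    · rw [coeff_Delta_pow_of_mod_ne, map_zero]
      rw [Nat.even_iff] at hm
      omega
  · have hi : i < n := by simp only [Set.mem_ofPred_eq] at hj; omega
    suffices h0 : oddPart (Delta ^ (2 * i + 1)) = Delta ^ (2 * i + 1) by
      rw [SetLike.mem_coe, h0]
      exact Submodule.subset_span (Set.mem_image_of_mem _ hi)
    ext m
    rw [coeff_oddPart]
    split_ifs with hm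
    · rw [coeff_Delta_pow_of_even ⟨i, rfl⟩ hm]
    · rfl

theorem heckeOp_mem_cuspSpace {p : ℕ} (hp : p.Prime) (hp2 : p ≠ 2) {n : ℕ}
    {f : PowerSeries (ZMod 2)} (hf : f ∈ cuspSpace n) : heckeOp p f ∈ cuspSpace n := by
  have h2 := Submodule.mem_map_of_mem (f := heckeOp p) hf
  rw [cuspSpace, Submodule.map_span] at h2
  refine Submodule.span_le.2 ?_ h2
  rintro _ ⟨_, ⟨i, hi, rfl⟩, rfl⟩
  simp only [Set.mem_ofPred_eq] at hi
  refine mem_cuspSpace_of_even_coeff ?_ ?_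
  · refine Submodule.span_mono ?_ (heckeOp_Delta_pow_mem_span' hp hp2 (le_refl (2 * i + 1)))
    refine Set.image_mono fun j hj => ?_
    simp only [Set.mem_ofPred_eq] at hj ⊢
    omega
  · exact coeff_heckeOp_of_even hp hp2 fun m hm => coeff_Delta_pow_of_even ⟨i, rfl⟩ hm

end Parity

/-! ### Leading terms of T_3 and T_5 for the code order. -/

section Filtration

/-- The span of the `Δ ^ (2L + 1)` for which `code L` is at most `x`. -/
noncomputable def filtration (x : ℤ × ℤ) : Submodule (ZMod 2) (PowerSeries (ZMod 2)) :=
  Submodule.span (ZMod 2) ((fun L : ℕ => Delta ^ (2 * L + 1)) '' {L | LexLE (code L) x})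

theorem LexLE.trans {x y z : ℤ × ℤ} (h : LexLE x y) (h' : LexLE y z) : LexLE x z := by
  simp only [LexLE] at *
  omega

theorem Delta_pow_mem_filtration {L : ℕ} {x : ℤ × ℤ} (h : LexLE (code L) x) :
    Delta ^ (2 * L + 1) ∈ filtration x :=
  Submodule.subset_span ⟨L, h, rfl⟩

theorem filtration_eq_bot {x : ℤ × ℤ} (h : ¬ LexLE 0 x) : filtration x = ⊥ := by
  rw [filtration, Submodule.span_eq_bot]
  rintro _ ⟨L, hL, rfl⟩
  refine absurd (LexLE.trans ?_ hL) h
  simp only [LexLE, code, Prod.fst_zero, Prod.snd_zero]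
  omega

theorem code_injective : Function.Injective code := by
  intro m n h
  simp only [code, Prod.mk.injEq, Nat.cast_inj] at h
  rw [← encode_code m, ← encode_code n, h.2]
  congr 1
  have := h.1
  omega

/-- Parity forces m = 2M+1 in the closed formula, and 4j = 2K+1 - 3m; the binomial coefficient is
odd exactly when j and 2M share no binary digit. -/
theorem heckeOp_three_Delta_pow_odd (K : ℕ) : ∃ s : Finset ℕ,
    heckeOp 3 (Delta ^ (2 * K + 1)) = ∑ L ∈ s, Delta ^ (2 * L + 1) ∧
    ∀ L, L ∈ s ↔ ∃ M j, j &&& 2 * M = 0 ∧ K = 3 * M + 2 * j + 1 ∧ L = M + 2 * j := by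
  classical
  let P : ℕ → Prop := fun m => ∃ M j, j &&& 2 * M = 0 ∧ K = 3 * M + 2 * j + 1 ∧ m = 2 * M + 1
  refine ⟨((Finset.Icc 1 (2 * K + 1)).filter P).image (K - ·), ?_, fun L => ?_⟩
  · rw [heckeOp_three_Delta_pow, Finset.sum_image, Finset.sum_filter]
    · refine Finset.sum_congr rfl fun m hm => ?_
      rw [Finset.mem_Icc] at hm
      rw [natCast_eq_ite_odd]
      rcases Nat.even_or_odd' m with ⟨M, rfl | rfl⟩
      · rw [if_neg (by omega), if_neg]
        rintro ⟨M, j, -, -, h⟩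
        omega
      · by_cases h : 3 * (2 * M + 1) ≤ 2 * K + 1 ∧ 4 ∣ 2 * K + 1 - 3 * (2 * M + 1)
        · obtain ⟨h1, j, h2⟩ := h
          have ho := odd_choose_add_iff (2 * M) j
          rw [Nat.land_comm] at ho
          rw [if_pos ⟨h1, j, h2⟩, h2, Nat.mul_div_cancel_left _ (by norm_num), Nat.add_sub_cancel]
          by_cases h3 : j &&& 2 * M = 0
          · rw [if_pos (ho.2 h3), if_pos ⟨M, j, h3, by omega, rfl⟩, one_mul]
            congr 1
            omega
          · rw [if_neg (mt ho.1 h3), if_neg, zero_mul]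
            rintro ⟨M', j', h4, h5, h6⟩
            obtain rfl : M = M' := by omega
            obtain rfl : j = j' := by omega
            exact h3 h4
        · rw [if_neg h, if_neg]
          rintro ⟨M', j', h4, h5, h6⟩
          omega
    · intro x hx y hy hxy
      simp only [Finset.coe_filter, Set.mem_ofPred_eq] at hx hy
      obtain ⟨-, M, j, -, h1, h2⟩ := hx
      obtain ⟨-, M', j', -, h3, h4⟩ := hy
      dsimp only at hxy
      omega
  · simp only [Finset.mem_image, Finset.mem_filter, Finset.mem_Icc]
    constructor
    · rintro ⟨m, ⟨hm, M, j, h1, h2, h3⟩, rfl⟩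
      exact ⟨M, j, h1, h2, by omega⟩
    · rintro ⟨M, j, h1, h2, h3⟩
      exact ⟨2 * M + 1, ⟨by omega, M, j, h1, h2, rfl⟩, by omega⟩

/-- Here m = 2M+1 and 2j = 2K+1 - 5m; the lower index 3m - 1 of the binomial coefficient is 6M + 2.
-/
theorem heckeOp_five_Delta_pow_odd (K : ℕ) : ∃ s : Finset ℕ,
    heckeOp 5 (Delta ^ (2 * K + 1)) = ∑ L ∈ s, Delta ^ (2 * L + 1) ∧
    ∀ L, L ∈ s ↔ ∃ M j, j &&& (6 * M + 2) = 0 ∧ K = 5 * M + j + 2 ∧ L = M + j := by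
  classical
  let P : ℕ → Prop := fun m => ∃ M j, j &&& (6 * M + 2) = 0 ∧ K = 5 * M + j + 2 ∧ m = 2 * M + 1
  refine ⟨((Finset.Icc 1 (2 * K + 1)).filter P).image (fun m => K - 2 * m), ?_, fun L => ?_⟩
  · rw [heckeOp_five_Delta_pow, Finset.sum_image, Finset.sum_filter]
    · refine Finset.sum_congr rfl fun m hm => ?_
      rw [Finset.mem_Icc] at hm
      rw [natCast_eq_ite_odd]
      rcases Nat.even_or_odd' m with ⟨M, rfl | rfl⟩
      · rw [if_neg (by omega), if_neg]
        rintro ⟨M, j, -, -, h⟩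
        omega
      · by_cases h : 5 * (2 * M + 1) ≤ 2 * K + 1 ∧ 2 ∣ 2 * K + 1 - 5 * (2 * M + 1)
        · obtain ⟨h1, j, h2⟩ := h
          have ho := odd_choose_add_iff (6 * M + 2) j
          rw [Nat.land_comm] at ho
          rw [if_pos ⟨h1, j, h2⟩, h2, Nat.mul_div_cancel_left _ (by norm_num),
            show 3 * (2 * M + 1) - 1 = 6 * M + 2 by omega]
          by_cases h3 : j &&& (6 * M + 2) = 0
          · rw [if_pos (ho.2 h3), if_pos ⟨M, j, h3, by omega, rfl⟩, one_mul]
            congr 1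
            omega
          · rw [if_neg (mt ho.1 h3), if_neg, zero_mul]
            rintro ⟨M', j', h4, h5, h6⟩
            obtain rfl : M = M' := by omega
            obtain rfl : j = j' := by omega
            exact h3 h4
        · rw [if_neg h, if_neg]
          rintro ⟨M', j', h4, h5, h6⟩
          omega
    · intro x hx y hy hxy
      simp only [Finset.coe_filter, Set.mem_ofPred_eq] at hx hy
      obtain ⟨-, M, j, -, h1, h2⟩ := hx
      obtain ⟨-, M', j', -, h3, h4⟩ := hy
      dsimp only at hxy
      omega
  · simp only [Finset.mem_image, Finset.mem_filter, Finset.mem_Icc]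
    constructor
    · rintro ⟨m, ⟨hm, M, j, h1, h2, h3⟩, rfl⟩
      exact ⟨M, j, h1, h2, by omega⟩
    · rintro ⟨M, j, h1, h2, h3⟩
      exact ⟨2 * M + 1, ⟨by omega, M, j, h1, h2, rfl⟩, by omega⟩

theorem heckeOp_three_mem_filtration {x : ℤ × ℤ} {f : PowerSeries (ZMod 2)}
    (hf : f ∈ filtration x) : heckeOp 3 f ∈ filtration (x - (1, 0)) := by
  have h2 := Submodule.mem_map_of_mem (f := heckeOp 3) hf
  rw [filtration, Submodule.map_span] at h2
  refine Submodule.span_le.2 ?_ h2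
  rintro _ ⟨_, ⟨K, hK, rfl⟩, rfl⟩
  obtain ⟨s, hs, hL⟩ := heckeOp_three_Delta_pow_odd K
  dsimp only
  rw [hs]
  refine Submodule.sum_mem _ fun L h => Delta_pow_mem_filtration ?_
  obtain ⟨M, j, h1, rfl, rfl⟩ := (hL L).1 h
  have := lexLE_code_three M j h1
  simp only [LexLE, Prod.fst_sub, Prod.snd_sub, Set.mem_ofPred_eq] at *
  omega

theorem heckeOp_five_mem_filtration {x : ℤ × ℤ} {f : PowerSeries (ZMod 2)}
    (hf : f ∈ filtration x) : heckeOp 5 f ∈ filtration (x - (1, 1)) := by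
  have h2 := Submodule.mem_map_of_mem (f := heckeOp 5) hf
  rw [filtration, Submodule.map_span] at h2
  refine Submodule.span_le.2 ?_ h2
  rintro _ ⟨_, ⟨K, hK, rfl⟩, rfl⟩
  obtain ⟨s, hs, hL⟩ := heckeOp_five_Delta_pow_odd K
  dsimp only
  rw [hs]
  refine Submodule.sum_mem _ fun L h => Delta_pow_mem_filtration ?_
  obtain ⟨M, j, h1, rfl, rfl⟩ := (hL L).1 h
  have := lexLE_code_five M j h1
  simp only [LexLE, Prod.fst_sub, Prod.snd_sub, Set.mem_ofPred_eq] at *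
  omega

/-- Every term has code at most (a+b, b), and `code` is injective, so all terms but the leading one
lie strictly below it. -/
theorem heckeOp_three_Delta_pow_encode (a b : ℕ) :
    heckeOp 3 (Delta ^ (2 * encode (a + 1) b + 1)) - Delta ^ (2 * encode a b + 1) ∈
      filtration (a + b, b - 1) := by
  obtain ⟨s, hs, hL⟩ := heckeOp_three_Delta_pow_odd (encode (a + 1) b)
  have hmem : encode a b ∈ s := by
    obtain ⟨M, j, h⟩ := exists_leading_three a b
    exact (hL _).2 ⟨M, j, h⟩
  rw [hs, ← Finset.sum_erase_add _ _ hmem, add_sub_cancel_right]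
  refine Submodule.sum_mem _ fun L h => Delta_pow_mem_filtration ?_
  rw [Finset.mem_erase] at h
  obtain ⟨M, j, h1, h2, h3⟩ := (hL L).1 h.2
  have h4 := lexLE_code_three M j h1
  rw [← h2, ← h3, code_encode] at h4
  have h5 : code L ≠ code (encode a b) := fun h' => h.1 (code_injective h')
  rw [code_encode, Ne, Prod.ext_iff] at h5
  simp only [LexLE, Prod.fst_sub, Prod.snd_sub] at *
  push_cast at h4
  omega

theorem heckeOp_five_Delta_pow_encode (a b : ℕ) :
    heckeOp 5 (Delta ^ (2 * encode a (b + 1) + 1)) - Delta ^ (2 * encode a b + 1) ∈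
      filtration (a + b, b - 1) := by
  obtain ⟨s, hs, hL⟩ := heckeOp_five_Delta_pow_odd (encode a (b + 1))
  have hmem : encode a b ∈ s := by
    obtain ⟨M, j, h⟩ := exists_leading_five a b
    exact (hL _).2 ⟨M, j, h⟩
  rw [hs, ← Finset.sum_erase_add _ _ hmem, add_sub_cancel_right]
  refine Submodule.sum_mem _ fun L h => Delta_pow_mem_filtration ?_
  rw [Finset.mem_erase] at h
  obtain ⟨M, j, h1, h2, h3⟩ := (hL L).1 h.2
  have h4 := lexLE_code_five M j h1
  rw [← h2, ← h3, code_encode] at h4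
  have h5 : code L ≠ code (encode a b) := fun h' => h.1 (code_injective h')
  rw [code_encode, Ne, Prod.ext_iff] at h5
  simp only [LexLE, Prod.fst_sub, Prod.snd_sub] at *
  push_cast at h4
  omega

end Filtration

/-! ### The dual basis and the expansion of T_p. -/

section Duality

/-- The linear form sending `f` to the coefficient of `q` in `T₃ⁱ T₅ʲ f`. -/
noncomputable def dualForm (i j : ℕ) : PowerSeries (ZMod 2) →ₗ[ZMod 2] ZMod 2 :=
  (coeff 1).comp (heckeOp 3 ^ i * heckeOp 5 ^ j)

theorem dualForm_apply (i j : ℕ) (f : PowerSeries (ZMod 2)) :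
    dualForm i j f = coeff 1 ((heckeOp 3 ^ i * heckeOp 5 ^ j) f) := rfl

theorem heckeOp_pow_mul_pow_mem_filtration (i j : ℕ) {x : ℤ × ℤ} {f : PowerSeries (ZMod 2)}
    (hf : f ∈ filtration x) :
    (heckeOp 3 ^ i * heckeOp 5 ^ j) f ∈ filtration (x - ((i : ℤ) + j, (j : ℤ))) := by
  have h5 : (heckeOp 5 ^ j) f ∈ filtration (x - ((j : ℤ), (j : ℤ))) := by
    induction j with
    | zero => simpa [← Prod.zero_eq_mk] using hf
    | succ j ih =>
      rw [pow_succ', Module.End.mul_apply]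
      convert heckeOp_five_mem_filtration ih using 2
      ext <;> simp <;> ring
  rw [Module.End.mul_apply]
  induction i with
  | zero => simpa using h5
  | succ i ih =>
    rw [pow_succ', Module.End.mul_apply]
    convert heckeOp_three_mem_filtration ih using 2
    ext <;> simp <;> ring

theorem heckeOp_pow_mul_pow_eq_zero {i j : ℕ} {x : ℤ × ℤ} {f : PowerSeries (ZMod 2)}
    (hf : f ∈ filtration x) (h : ¬ LexLE ((i : ℤ) + j, (j : ℤ)) x) :
    (heckeOp 3 ^ i * heckeOp 5 ^ j) f = 0 := by
  have h1 := heckeOp_pow_mul_pow_mem_filtration i j hf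
  rw [filtration_eq_bot, Submodule.mem_bot] at h1
  · exact h1
  · simp only [LexLE, Prod.fst_sub, Prod.snd_sub, Prod.fst_zero, Prod.snd_zero] at *
    omega

theorem dualForm_eq_zero {i j : ℕ} {x : ℤ × ℤ} {f : PowerSeries (ZMod 2)}
    (hf : f ∈ filtration x) (h : ¬ LexLE ((i : ℤ) + j, (j : ℤ)) x) : dualForm i j f = 0 := by
  rw [dualForm_apply, heckeOp_pow_mul_pow_eq_zero hf h, map_zero]

theorem dualForm_succ_right (i j : ℕ) (f : PowerSeries (ZMod 2)) :
    dualForm i (j + 1) f = dualForm i j (heckeOp 5 f) := by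
  rw [dualForm_apply, dualForm_apply, pow_succ, ← mul_assoc, Module.End.mul_apply]

theorem dualForm_succ_left (i j : ℕ) (f : PowerSeries (ZMod 2)) :
    dualForm (i + 1) j f = dualForm i j (heckeOp 3 f) := by
  have h : Commute (heckeOp 3) (heckeOp 5) := heckeOp_commute Nat.prime_three Nat.prime_five
  rw [dualForm_apply, dualForm_apply, pow_succ, mul_assoc, (h.pow_right j).eq, ← mul_assoc,
    Module.End.mul_apply]

theorem dualForm_Delta_pow_encode (i j : ℕ) : dualForm i j (Delta ^ (2 * encode i j + 1)) = 1 := by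
  induction i with
  | zero =>
    induction j with
    | zero => simpa [dualForm_apply, encode_zero] using coeff_Delta_pow_self 1
    | succ j ih =>
      rw [dualForm_succ_right, ← ih, ← sub_eq_zero, ← map_sub]
      refine dualForm_eq_zero (heckeOp_five_Delta_pow_encode 0 j) ?_
      simp only [LexLE]
      omega
  | succ i ih =>
    rw [dualForm_succ_left, ← ih, ← sub_eq_zero, ← map_sub]
    refine dualForm_eq_zero (heckeOp_three_Delta_pow_encode i j) ?_
    simp only [LexLE]
    omega

/-- The span of the odd powers of `Δ`. -/
noncomputable def oddSpace : Submodule (ZMod 2) (PowerSeries (ZMod 2)) :=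
  Submodule.span (ZMod 2) (Set.range fun L : ℕ => Delta ^ (2 * L + 1))

theorem cuspSpace_le_oddSpace (n : ℕ) : cuspSpace n ≤ oddSpace :=
  Submodule.span_mono (Set.image_subset_range _ _)

theorem cuspSpace_mono : Monotone cuspSpace := fun _ _ h =>
  Submodule.span_mono (Set.image_mono fun _ hi => lt_of_lt_of_le hi h)

theorem Delta_pow_mem_cuspSpace {L n : ℕ} (h : L < n) : Delta ^ (2 * L + 1) ∈ cuspSpace n :=
  Submodule.subset_span ⟨L, h, rfl⟩

theorem exists_mem_cuspSpace {f : PowerSeries (ZMod 2)} (hf : f ∈ oddSpace) :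
    ∃ n, f ∈ cuspSpace n := by
  have hdir : Directed (· ≤ ·) cuspSpace := cuspSpace_mono.directed_le
  refine (Submodule.mem_iSup_of_directed _ hdir).1 (Submodule.span_le.2 ?_ hf)
  rintro _ ⟨L, rfl⟩
  exact Submodule.mem_iSup_of_mem (L + 1) (Delta_pow_mem_cuspSpace L.lt_succ_self)

theorem eq_zero_or_eq_one (x : ZMod 2) : x = 0 ∨ x = 1 := by
  revert x
  decide

/-- The form indexed by the largest code in f takes the value 1 on the leading power and kills all
the others. -/
theorem eq_zero_of_dualForm {f : PowerSeries (ZMod 2)} (hf : f ∈ oddSpace)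
    (h : ∀ i j, dualForm i j f = 0) : f = 0 := by
  obtain ⟨c, rfl⟩ := Finsupp.mem_span_range_iff_exists_finsupp.1 hf
  by_contra hne
  have hc : c.support.Nonempty := by
    rw [Finsupp.support_nonempty_iff]
    rintro rfl
    simp at hne
  obtain ⟨K, hK, hmax⟩ := Finset.exists_max_image c.support (fun L => toLex (code L)) hc
  have hcK : c K = 1 := (eq_zero_or_eq_one (c K)).resolve_left (Finsupp.mem_support_iff.1 hK)
  have h1 := h (codeThree K) (codeFive K)
  rw [Finsupp.sum, ← Finset.add_sum_erase _ _ hK, map_add, hcK, one_smul] at h1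
  have h2 := dualForm_Delta_pow_encode (codeThree K) (codeFive K)
  rw [encode_code] at h2
  rw [h2, map_sum, Finset.sum_eq_zero, add_zero] at h1
  · exact one_ne_zero h1
  intro L hL
  rw [Finset.mem_erase] at hL
  rw [map_smul, dualForm_eq_zero (Delta_pow_mem_filtration (x := code L) (Or.inr ⟨rfl, le_rfl⟩)),
    smul_zero]
  have h3 := hmax L hL.2
  have h4 : code L ≠ code K := fun h => hL.1 (code_injective h)
  rw [Ne, Prod.ext_iff] at h4
  rw [Prod.Lex.le_iff] at h3
  simp only [ofLex_toLex] at h3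
  change ¬ LexLE (code K) (code L)
  simp only [LexLE]
  omega

/-- Inversion of a unitriangular matrix: from the power of Δ with code (i+j, j), subtract the dual
vectors of smaller index. -/
theorem exists_dualBasis (i j : ℕ) : ∃ m ∈ oddSpace,
    ∀ k l, dualForm k l m = if k = i ∧ l = j then 1 else 0 := by
  classical
  have ih : ∀ kl : ℕ × ℕ, ∃ m : PowerSeries (ZMod 2), m ∈ oddSpace ∧
      (kl.1 + kl.2 < i + j ∨ kl.1 + kl.2 = i + j ∧ kl.2 < j →
        ∀ k l, dualForm k l m = if k = kl.1 ∧ l = kl.2 then 1 else 0) := fun kl => by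
    by_cases h : kl.1 + kl.2 < i + j ∨ kl.1 + kl.2 = i + j ∧ kl.2 < j
    · obtain ⟨m, hm, hm'⟩ := exists_dualBasis kl.1 kl.2
      exact ⟨m, hm, fun _ => hm'⟩
    · exact ⟨0, zero_mem _, fun h' => absurd h' h⟩
  choose m hm hm' using ih
  set e := Delta ^ (2 * encode i j + 1) with he
  have he' : e ∈ filtration ((i : ℤ) + j, (j : ℤ)) := by
    rw [← code_encode]
    exact Delta_pow_mem_filtration (Or.inr ⟨rfl, le_rfl⟩)
  let S := (Finset.range (i + j + 1) ×ˢ Finset.range (i + j + 1)).filter fun kl =>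
    kl.1 + kl.2 < i + j ∨ kl.1 + kl.2 = i + j ∧ kl.2 < j
  refine ⟨e - ∑ kl ∈ S, dualForm kl.1 kl.2 e • m kl, ?_, fun k l => ?_⟩
  · exact sub_mem (Submodule.subset_span ⟨_, rfl⟩)
      (Submodule.sum_mem _ fun kl _ => Submodule.smul_mem _ _ (hm kl))
  have h1 : ∀ kl ∈ S, dualForm k l (dualForm kl.1 kl.2 e • m kl) =
      if (k, l) = kl then dualForm k l e else 0 := fun kl hkl => by
    rw [map_smul, hm' kl (Finset.mem_filter.1 hkl).2, smul_eq_mul]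
    obtain ⟨k', l'⟩ := kl
    simp only [Prod.mk.injEq]
    split_ifs with h
    · rw [h.1, h.2, mul_one]
    · rw [mul_zero]
  rw [map_sub, map_sum, Finset.sum_congr rfl h1, Finset.sum_ite_eq]
  by_cases hS : (k, l) ∈ S
  · rw [if_pos hS, sub_self, if_neg]
    rintro ⟨rfl, rfl⟩
    have := (Finset.mem_filter.1 hS).2
    simp only at this
    omega
  · rw [if_neg hS, sub_zero]
    split_ifs with h
    · rw [h.1, h.2, dualForm_Delta_pow_encode]
    · refine dualForm_eq_zero he' fun h' => hS ?_
      simp only [LexLE] at h'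
      simp only [S, Finset.mem_filter, Finset.mem_product, Finset.mem_range]
      omega
termination_by (i + j, j)
decreasing_by
  rw [Prod.lex_def]
  exact h

/-- The basis of `oddSpace` dual to the forms `dualForm i j`. -/
noncomputable def dualBasis (i j : ℕ) : PowerSeries (ZMod 2) := (exists_dualBasis i j).choose

theorem dualBasis_mem (i j : ℕ) : dualBasis i j ∈ oddSpace := (exists_dualBasis i j).choose_spec.1

theorem dualForm_dualBasis (i j k l : ℕ) :
    dualForm k l (dualBasis i j) = if k = i ∧ l = j then 1 else 0 :=
  (exists_dualBasis i j).choose_spec.2 k l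

theorem eq_of_dualForm {f g : PowerSeries (ZMod 2)} (hf : f ∈ oddSpace) (hg : g ∈ oddSpace)
    (h : ∀ i j, dualForm i j f = dualForm i j g) : f = g :=
  sub_eq_zero.1 (eq_zero_of_dualForm (sub_mem hf hg) fun i j => by rw [map_sub, h, sub_self])

/-- On `F(n)` the monomials of degree at least `nilpotencyBound n` in `T₃`, `T₅` vanish. -/
noncomputable def nilpotencyBound (n : ℕ) : ℕ :=
  ((Finset.range n).sup fun L => codeThree L + codeFive L) + 2

theorem heckeOp_pow_mul_pow_cuspSpace {n i j : ℕ} (h : nilpotencyBound n ≤ i + j)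
    {f : PowerSeries (ZMod 2)} (hf : f ∈ cuspSpace n) : (heckeOp 3 ^ i * heckeOp 5 ^ j) f = 0 := by
  have h2 : f ∈ LinearMap.ker (heckeOp 3 ^ i * heckeOp 5 ^ j) := by
    refine Submodule.span_le.2 ?_ hf
    rintro _ ⟨L, hL, rfl⟩
    refine heckeOp_pow_mul_pow_eq_zero
      (Delta_pow_mem_filtration (x := code L) (Or.inr ⟨rfl, le_rfl⟩)) ?_
    have : codeThree L + codeFive L ≤ _ :=
      Finset.le_sup (f := fun L => codeThree L + codeFive L) (Finset.mem_range.2 hL)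
    simp only [nilpotencyBound] at h
    simp only [LexLE, code]
    omega
  exact h2

theorem eq_sum_dualBasis {n : ℕ} {f : PowerSeries (ZMod 2)} (hf : f ∈ cuspSpace n) :
    f = ∑ ij ∈ Finset.range (nilpotencyBound n) ×ˢ Finset.range (nilpotencyBound n),
      dualForm ij.1 ij.2 f • dualBasis ij.1 ij.2 := by
  classical
  refine eq_of_dualForm (cuspSpace_le_oddSpace n hf)
    (Submodule.sum_mem _ fun ij _ => Submodule.smul_mem _ _ (dualBasis_mem _ _)) fun k l => ?_
  have h1 : ∀ ij ∈ Finset.range (nilpotencyBound n) ×ˢ Finset.range (nilpotencyBound n),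
      dualForm k l (dualForm ij.1 ij.2 f • dualBasis ij.1 ij.2) =
      if (k, l) = ij then dualForm k l f else 0 := fun ij _ => by
    rw [map_smul, dualForm_dualBasis, smul_eq_mul]
    obtain ⟨k', l'⟩ := ij
    simp only [Prod.mk.injEq]
    split_ifs with h
    · rw [h.1, h.2, mul_one]
    · rw [mul_zero]
  rw [map_sum, Finset.sum_congr rfl h1, Finset.sum_ite_eq]
  split_ifs with h
  · rfl
  · rw [dualForm_apply, heckeOp_pow_mul_pow_cuspSpace _ hf, map_zero]
    rw [Finset.mem_product, Finset.mem_range, Finset.mem_range] at h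
    omega

theorem heckeOp_pow_mul_pow_mem_cuspSpace (i j : ℕ) {n : ℕ} {f : PowerSeries (ZMod 2)}
    (hf : f ∈ cuspSpace n) : (heckeOp 3 ^ i * heckeOp 5 ^ j) f ∈ cuspSpace n := by
  have h5 : (heckeOp 5 ^ j) f ∈ cuspSpace n := by
    induction j with
    | zero => exact hf
    | succ j ih =>
      rw [pow_succ', Module.End.mul_apply]
      exact heckeOp_mem_cuspSpace Nat.prime_five (by norm_num) ih
  rw [Module.End.mul_apply]
  induction i with
  | zero => exact h5
  | succ i ih =>
    rw [pow_succ', Module.End.mul_apply]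
    exact heckeOp_mem_cuspSpace Nat.prime_three (by norm_num) ih

/-- Combines a_p(g) = a_1(T_p g) with the commutation of the Hecke operators. -/
theorem coeff_heckeOp_pow_mul_pow {p : ℕ} (hp : p.Prime) (i j : ℕ) (f : PowerSeries (ZMod 2)) :
    coeff p ((heckeOp 3 ^ i * heckeOp 5 ^ j) f) = dualForm i j (heckeOp p f) := by
  have h : Commute (heckeOp 3 ^ i * heckeOp 5 ^ j) (heckeOp p) :=
    ((heckeOp_commute Nat.prime_three hp).pow_left i).mul_left
      ((heckeOp_commute Nat.prime_five hp).pow_left j)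
  rw [dualForm_apply, show (heckeOp 3 ^ i * heckeOp 5 ^ j) (heckeOp p f) =
    heckeOp p ((heckeOp 3 ^ i * heckeOp 5 ^ j) f) from LinearMap.congr_fun h.eq f,
    coeff_one_heckeOp hp]

theorem dualForm_heckeOp_pow_mul_pow (i j k l : ℕ) (f : PowerSeries (ZMod 2)) :
    dualForm k l ((heckeOp 3 ^ i * heckeOp 5 ^ j) f) =
      dualForm i j ((heckeOp 3 ^ k * heckeOp 5 ^ l) f) := by
  have h : Commute (heckeOp 3) (heckeOp 5) := heckeOp_commute Nat.prime_three Nat.prime_five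
  have h1 : Commute (heckeOp 3 ^ i * heckeOp 5 ^ j) (heckeOp 3 ^ k * heckeOp 5 ^ l) :=
    (((Commute.refl _).pow_pow i k).mul_right (h.pow_pow i l)).mul_left
      ((h.symm.pow_pow j k).mul_right ((Commute.refl _).pow_pow j l))
  rw [dualForm_apply, dualForm_apply, ← Module.End.mul_apply, ← Module.End.mul_apply, h1.eq]

theorem coeff_eq_sum {p n : ℕ} {f : PowerSeries (ZMod 2)} (hf : f ∈ cuspSpace n) :
    coeff p f = ∑ ij ∈ Finset.range (nilpotencyBound n) ×ˢ Finset.range (nilpotencyBound n),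
      coeff p (dualBasis ij.1 ij.2) * dualForm ij.1 ij.2 f := by
  conv_lhs => rw [eq_sum_dualBasis hf]
  rw [map_sum]
  exact Finset.sum_congr rfl fun ij _ => by rw [map_smul, smul_eq_mul, mul_comm]

/-- The expansion of `T_p` in terms of `T₃` and `T₅` on `F(n)`. -/
theorem heckeOp_eq_sum {p : ℕ} (hp : p.Prime) (hp2 : p ≠ 2) {n : ℕ} {f : PowerSeries (ZMod 2)}
    (hf : f ∈ cuspSpace n) : heckeOp p f =
    ∑ ij ∈ Finset.range (nilpotencyBound n) ×ˢ Finset.range (nilpotencyBound n),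
      coeff p (dualBasis ij.1 ij.2) • (heckeOp 3 ^ ij.1 * heckeOp 5 ^ ij.2) f := by
  refine eq_of_dualForm (cuspSpace_le_oddSpace n (heckeOp_mem_cuspSpace hp hp2 hf))
    (Submodule.sum_mem _ fun ij _ => Submodule.smul_mem _ _ (cuspSpace_le_oddSpace n
      (heckeOp_pow_mul_pow_mem_cuspSpace _ _ hf))) fun k l => ?_
  -- The form of index (k, l) at T_p f is a_p(T_3^k T_5^l f), which is expanded in the dual basis;
  -- the two monomials may then be exchanged.
  rw [← coeff_heckeOp_pow_mul_pow hp, coeff_eq_sum (heckeOp_pow_mul_pow_mem_cuspSpace _ _ hf),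
    map_sum]
  exact Finset.sum_congr rfl fun ij _ => by
    rw [map_smul, smul_eq_mul, dualForm_heckeOp_pow_mul_pow]

end Duality

end HeckeModTwo

namespace HeckeModTwo

open PowerSeries

/-! ### The first dual vectors are powers of Δ. -/

section SmallDualBasis

theorem dualForm_zero_zero (f : PowerSeries (ZMod 2)) : dualForm 0 0 f = coeff 1 f := by
  simp [dualForm_apply]

/-- Dual vectors are characterised recursively: T_3 lowers the first index, T_5 the second, and a_1
settles the origin. -/
theorem dualForm_eq_ite_of_heckeOp {f : PowerSeries (ZMod 2)} (i j : ℕ)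
    (h0 : coeff 1 f = if 0 = i ∧ 0 = j then 1 else 0)
    (h3 : ∀ k l, dualForm k l (heckeOp 3 f) = if k + 1 = i ∧ l = j then 1 else 0)
    (h5 : ∀ k l, dualForm k l (heckeOp 5 f) = if k = i ∧ l + 1 = j then 1 else 0) (k l : ℕ) :
    dualForm k l f = if k = i ∧ l = j then 1 else 0 := by
  cases k with
  | succ k => rw [dualForm_succ_left, h3]
  | zero =>
    cases l with
    | succ l => rw [dualForm_succ_right, h5]
    | zero => rw [dualForm_zero_zero, h0]

theorem dualBasis_eq {f : PowerSeries (ZMod 2)} {i j : ℕ} (hf : f ∈ oddSpace)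
    (h : ∀ k l, dualForm k l f = if k = i ∧ l = j then 1 else 0) : dualBasis i j = f :=
  eq_of_dualForm (dualBasis_mem i j) hf fun k l => by rw [dualForm_dualBasis, h]

theorem Delta_pow_mem_oddSpace (L : ℕ) : Delta ^ (2 * L + 1) ∈ oddSpace :=
  Submodule.subset_span ⟨L, rfl⟩

theorem dualForm_Delta_one (k l : ℕ) :
    dualForm k l (Delta ^ 1) = if k = 0 ∧ l = 0 then 1 else 0 :=
  dualForm_eq_ite_of_heckeOp 0 0 (by rw [coeff_Delta_pow_self]; rfl)
    (fun k l => by rw [heckeOp_three_Delta, map_zero]; simp) (fun k l => by rw [heckeOp_five_Delta, map_zero]; simp) k l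

theorem dualForm_Delta_three (k l : ℕ) :
    dualForm k l (Delta ^ 3) = if k = 1 ∧ l = 0 then 1 else 0 :=
  dualForm_eq_ite_of_heckeOp 1 0 (by rw [coeff_Delta_pow_of_lt (by norm_num)]; rfl)
    (fun k l => by rw [heckeOp_three_Delta_cube, ← pow_one Delta, dualForm_Delta_one]; simp)
    (fun k l => by simp [heckeOp_five_Delta_cube]) k l

theorem heckeOp_three_Delta_five : heckeOp 3 (Delta ^ 5) = 0 := by
  rw [heckeOp_three_Delta_pow]
  simp [Finset.sum_Icc_succ_top]

theorem dualForm_Delta_five (k l : ℕ) :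
    dualForm k l (Delta ^ 5) = if k = 0 ∧ l = 1 then 1 else 0 :=
  dualForm_eq_ite_of_heckeOp 0 1 (by rw [coeff_Delta_pow_of_lt (by norm_num)]; rfl)
    (fun k l => by simp [heckeOp_three_Delta_five])
    (fun k l => by rw [heckeOp_five_Delta_pow_five, ← pow_one Delta, dualForm_Delta_one]; simp) k l

theorem heckeOp_three_Delta_seven : heckeOp 3 (Delta ^ 7) = Delta ^ 5 := by
  rw [heckeOp_three_Delta_pow]
  simp [Finset.sum_Icc_succ_top]

theorem heckeOp_five_Delta_seven : heckeOp 5 (Delta ^ 7) = Delta ^ 3 := by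
  rw [heckeOp_five_Delta_pow]
  have h : (3 : PowerSeries (ZMod 2)) = 1 := by
    exact_mod_cast (natCast_eq_ite_odd 3).trans (if_pos (by decide))
  simp [Finset.sum_Icc_succ_top, h]

theorem heckeOp_three_Delta_nine : heckeOp 3 (Delta ^ 9) = Delta ^ 3 := by
  rw [heckeOp_three_Delta_pow]
  simp [Finset.sum_Icc_succ_top]

theorem heckeOp_five_Delta_nine : heckeOp 5 (Delta ^ 9) = 0 := by
  rw [heckeOp_five_Delta_pow]
  have h : ((4 : ℕ).choose 2 : PowerSeries (ZMod 2)) = 0 := by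
    rw [natCast_eq_ite_odd, if_neg (by decide)]
  simp [Finset.sum_Icc_succ_top, h]

theorem heckeOp_three_Delta_seventeen : heckeOp 3 (Delta ^ 17) = 0 := by
  rw [heckeOp_three_Delta_pow]
  have h : ((4 : ℕ).choose 2 : PowerSeries (ZMod 2)) = 0 := by
    rw [natCast_eq_ite_odd, if_neg (by decide)]
  simp [Finset.sum_Icc_succ_top, h]

theorem heckeOp_five_Delta_seventeen : heckeOp 5 (Delta ^ 17) = Delta ^ 5 := by
  rw [heckeOp_five_Delta_pow]
  have h : ((8 : ℕ).choose 2 : PowerSeries (ZMod 2)) = 0 := by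
    rw [natCast_eq_ite_odd, if_neg (by decide)]
  have h' : (9 : PowerSeries (ZMod 2)) = 1 := by
    exact_mod_cast (natCast_eq_ite_odd 9).trans (if_pos (by decide))
  simp [Finset.sum_Icc_succ_top, h, h']

theorem dualBasis_zero_zero : dualBasis 0 0 = Delta := by
  rw [← pow_one Delta]
  exact dualBasis_eq (Delta_pow_mem_oddSpace 0) dualForm_Delta_one

theorem dualBasis_one_zero : dualBasis 1 0 = Delta ^ 3 :=
  dualBasis_eq (Delta_pow_mem_oddSpace 1) dualForm_Delta_three

theorem dualBasis_zero_one : dualBasis 0 1 = Delta ^ 5 :=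
  dualBasis_eq (Delta_pow_mem_oddSpace 2) dualForm_Delta_five

theorem dualBasis_one_one : dualBasis 1 1 = Delta ^ 7 :=
  dualBasis_eq (Delta_pow_mem_oddSpace 3) <| dualForm_eq_ite_of_heckeOp 1 1
    (by rw [coeff_Delta_pow_of_lt (by norm_num)]; rfl)
    (fun k l => by rw [heckeOp_three_Delta_seven, dualForm_Delta_five]; simp)
    (fun k l => by rw [heckeOp_five_Delta_seven, dualForm_Delta_three]; simp)

theorem dualBasis_two_zero : dualBasis 2 0 = Delta ^ 9 :=
  dualBasis_eq (Delta_pow_mem_oddSpace 4) <| dualForm_eq_ite_of_heckeOp 2 0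
    (by rw [coeff_Delta_pow_of_lt (by norm_num)]; rfl)
    (fun k l => by rw [heckeOp_three_Delta_nine, dualForm_Delta_three]; simp)
    (fun k l => by simp [heckeOp_five_Delta_nine])

theorem dualBasis_zero_two : dualBasis 0 2 = Delta ^ 17 :=
  dualBasis_eq (Delta_pow_mem_oddSpace 8) <| dualForm_eq_ite_of_heckeOp 0 2
    (by rw [coeff_Delta_pow_of_lt (by norm_num)]; rfl)
    (fun k l => by simp [heckeOp_three_Delta_seventeen])
    (fun k l => by rw [heckeOp_five_Delta_seventeen, dualForm_Delta_five]; simp)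

end SmallDualBasis

end HeckeModTwo

namespace HeckeModTwo

/-! ### Sums of two squares, by the arithmetic of Gaussian integers. -/

section TwoSquares

/-- The representations of `n` as a sum of two squares of integers. -/
noncomputable def twoSquares (n : ℕ) : Finset (ℤ × ℤ) :=
  (Finset.Icc (-(n : ℤ)) n ×ˢ Finset.Icc (-(n : ℤ)) n).filter fun z => z.1 ^ 2 + z.2 ^ 2 = n

theorem mem_twoSquares {n : ℕ} {z : ℤ × ℤ} : z ∈ twoSquares n ↔ z.1 ^ 2 + z.2 ^ 2 = n := by
  simp only [twoSquares, Finset.mem_filter, Finset.mem_product, Finset.mem_Icc,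
    and_iff_right_iff_imp]
  intro h
  refine ⟨⟨?_, ?_⟩, ?_, ?_⟩ <;> nlinarith [sq_nonneg (z.1 - 1), sq_nonneg (z.1 + 1),
    sq_nonneg (z.2 - 1), sq_nonneg (z.2 + 1), sq_nonneg z.1, sq_nonneg z.2,
    Int.le_self_sq z.1, Int.le_self_sq z.2, Int.le_self_sq (-z.1), Int.le_self_sq (-z.2)]

/-- Multiplication by 1 + i. -/
theorem card_twoSquares_two_mul (n : ℕ) : (twoSquares (2 * n)).card = (twoSquares n).card := by
  symm
  refine Finset.card_nbij' (fun z => (z.1 - z.2, z.1 + z.2))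
    (fun z => ((z.1 + z.2) / 2, (z.2 - z.1) / 2)) ?_ ?_ ?_ ?_
  · intro z hz
    simp only [Finset.mem_coe, mem_twoSquares] at hz ⊢
    push_cast
    linear_combination 2 * hz
  · intro z hz
    simp only [Finset.mem_coe, mem_twoSquares] at hz ⊢
    have h : (z.1 + z.2) % 2 = 0 := by
      have h1 : Even (z.1 ^ 2 + z.2 ^ 2) := ⟨n, by rw [hz]; push_cast; ring⟩
      rw [Int.even_add, Int.even_pow' two_ne_zero, Int.even_pow' two_ne_zero, ← Int.even_add] at h1
      exact Int.even_iff.1 h1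
    obtain ⟨c, hc⟩ : ∃ c, z.1 + z.2 = 2 * c := ⟨(z.1 + z.2) / 2, by omega⟩
    rw [show (z.1 + z.2) / 2 = c by omega, show (z.2 - z.1) / 2 = z.2 - c by omega]
    rw [show z.1 = 2 * c - z.2 by omega] at hz
    push_cast at hz
    linarith
  · intro z hz
    ext <;> dsimp only <;> omega
  · intro z hz
    simp only [Finset.mem_coe, mem_twoSquares] at hz
    have h : (z.1 + z.2) % 2 = 0 := by
      have h1 : Even (z.1 ^ 2 + z.2 ^ 2) := ⟨n, by rw [hz]; push_cast; ring⟩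
      rw [Int.even_add, Int.even_pow' two_ne_zero, Int.even_pow' two_ne_zero, ← Int.even_add] at h1
      exact Int.even_iff.1 h1
    ext <;> dsimp only <;> omega

theorem card_twoSquares_filter_dvd {p : ℕ} (hp : p.Prime) {n : ℕ} :
    ((twoSquares (p * n)).filter fun z => (p : ℤ) ∣ z.1 ∧ (p : ℤ) ∣ z.2).card =
      if p ∣ n then (twoSquares (n / p)).card else 0 := by
  have hp0 : (p : ℤ) ≠ 0 := by exact_mod_cast hp.ne_zero
  split_ifs with h
  · obtain ⟨m, rfl⟩ := h
    rw [Nat.mul_div_cancel_left _ hp.pos]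
    symm
    refine Finset.card_nbij (fun z => (p * z.1, p * z.2)) ?_ ?_ ?_
    · intro z hz
      simp only [Finset.mem_coe, mem_twoSquares, Finset.mem_filter] at hz ⊢
      refine ⟨?_, dvd_mul_right _ _, dvd_mul_right _ _⟩
      push_cast
      linear_combination (p : ℤ) ^ 2 * hz
    · intro z _ w _ h
      simp only [Prod.mk.injEq, mul_eq_mul_left_iff, hp0, or_false] at h
      exact Prod.ext h.1 h.2
    · rintro ⟨x, y⟩ hz
      simp only [Finset.coe_filter, mem_twoSquares, Set.mem_ofPred_eq] at hz
      obtain ⟨h, ⟨a, rfl⟩, b, rfl⟩ := hz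
      refine ⟨(a, b), ?_, rfl⟩
      rw [Finset.mem_coe, mem_twoSquares]
      have : (p : ℤ) ^ 2 * (a ^ 2 + b ^ 2) = (p : ℤ) ^ 2 * m := by
        push_cast at h
        linear_combination h
      exact mul_left_cancel₀ (pow_ne_zero 2 hp0) this
  · rw [Finset.card_eq_zero, Finset.filter_eq_empty_iff]
    rintro ⟨x, y⟩ hz ⟨⟨a, ha⟩, b, hb⟩
    dsimp only at ha hb
    subst ha hb
    rw [mem_twoSquares] at hz
    refine h ?_
    rw [← Int.natCast_dvd_natCast]
    refine ⟨a ^ 2 + b ^ 2, mul_left_cancel₀ hp0 ?_⟩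
    push_cast at hz
    linear_combination -hz

/-- Such p is inert: -1 is not a square modulo p, so p divides both coordinates. -/
theorem card_twoSquares_of_three {p : ℕ} (hp : p.Prime) (h3 : p % 4 = 3) (n : ℕ) :
    (twoSquares (p * n)).card = if p ∣ n then (twoSquares (n / p)).card else 0 := by
  rw [← card_twoSquares_filter_dvd hp, Finset.filter_true_of_mem]
  intro z hz
  rw [mem_twoSquares] at hz
  have : Fact p.Prime := ⟨hp⟩
  have h1 : (z.1 : ZMod p) ^ 2 + (z.2 : ZMod p) ^ 2 = 0 := by
    have := congrArg (Int.cast : ℤ → ZMod p) hz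
    push_cast at this
    simpa using this
  have hy : (z.2 : ZMod p) = 0 := by
    by_contra hy
    exact ZMod.mod_four_ne_three_of_sq_eq_neg_sq' hy (eq_neg_of_add_eq_zero_left h1) h3
  rw [hy, zero_pow two_ne_zero, add_zero] at h1
  rw [← ZMod.intCast_zmod_eq_zero_iff_dvd, ← ZMod.intCast_zmod_eq_zero_iff_dvd]
  exact ⟨pow_eq_zero_iff two_ne_zero |>.1 h1, hy⟩

/-- The divisibility condition selects the multiples of a + bi, and multiplication by a + bi is the
bijection. -/
theorem card_twoSquares_filter_dvd_add {p : ℕ} (hp : p.Prime) {a b : ℤ} (hab : a ^ 2 + b ^ 2 = p)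
    (n : ℕ) : ((twoSquares (p * n)).filter fun z => (p : ℤ) ∣ z.1 * a + z.2 * b).card =
      (twoSquares n).card := by
  have hp0 : (p : ℤ) ≠ 0 := by exact_mod_cast hp.ne_zero
  symm
  refine Finset.card_nbij (fun z => (a * z.1 - b * z.2, a * z.2 + b * z.1)) ?_ ?_ ?_
  · intro z hz
    simp only [Finset.mem_coe, mem_twoSquares, Finset.mem_filter] at hz ⊢
    refine ⟨?_, z.1, by linear_combination z.1 * hab⟩
    push_cast
    rw [← hab]
    linear_combination (a ^ 2 + b ^ 2) * hz
  · intro z _ w _ h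
    simp only [Prod.mk.injEq] at h
    ext
    · exact mul_left_cancel₀ hp0
        (by rw [← hab]; linear_combination a * h.1 + b * h.2)
    · exact mul_left_cancel₀ hp0
        (by rw [← hab]; linear_combination a * h.2 - b * h.1)
  · rintro ⟨x, y⟩ hz
    simp only [Finset.coe_filter, mem_twoSquares, Set.mem_ofPred_eq] at hz
    obtain ⟨h, c, hc⟩ := hz
    push_cast at h
    have h2 : (p : ℤ) ∣ y * a - x * b := by
      refine (Nat.prime_iff_prime_int.1 hp).dvd_of_dvd_pow (n := 2) ⟨p * n - p * c ^ 2, ?_⟩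
      linear_combination (a ^ 2 + b ^ 2) * h + p * n * hab - (x * a + y * b + p * c) * hc
    obtain ⟨d, hd⟩ := h2
    refine ⟨(c, d), ?_, ?_⟩
    · rw [Finset.mem_coe, mem_twoSquares]
      refine mul_left_cancel₀ (pow_ne_zero 2 hp0) ?_
      linear_combination -(x * a + y * b + p * c) * hc - (y * a - x * b + p * d) * hd +
        (x ^ 2 + y ^ 2) * hab + p * h
    · ext
      · exact mul_left_cancel₀ hp0 (by dsimp only; linear_combination -a * hc + b * hd + x * hab)
      · exact mul_left_cancel₀ hp0 (by dsimp only; linear_combination -a * hd - b * hc + y * hab)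

/-- Here p splits: an element of norm p n is divisible by a + bi or by a - bi, and by both exactly
when p divides it. The identity is inclusion-exclusion. -/
theorem card_twoSquares_of_one {p : ℕ} (hp : p.Prime) (h1 : p % 4 = 1) (n : ℕ) :
    (twoSquares (p * n)).card + (if p ∣ n then (twoSquares (n / p)).card else 0) =
      2 * (twoSquares n).card := by
  have : Fact p.Prime := ⟨hp⟩
  obtain ⟨a, b, hab⟩ := Nat.Prime.sq_add_sq (p := p) (by omega)
  have hab' : (a : ℤ) ^ 2 + (b : ℤ) ^ 2 = p := by exact_mod_cast hab
  have hab'' : (a : ℤ) ^ 2 + (-b : ℤ) ^ 2 = p := by rw [neg_sq]; exact hab'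
  have hpp := Nat.prime_iff_prime_int.1 hp
  have ha : ¬ (p : ℤ) ∣ 2 * a := by
    intro h
    rcases hpp.dvd_or_dvd h with h | h
    · have := Nat.le_of_dvd two_pos (by exact_mod_cast h)
      have := hp.two_le
      omega
    · rw [Int.natCast_dvd_natCast] at h
      obtain ⟨c, rfl⟩ := h
      rcases Nat.eq_zero_or_pos c with rfl | hc
      · have := (hp.prime.irreducible.not_isSquare) ⟨b, by nlinarith⟩
        exact this
      · have := hp.two_le
        nlinarith [Nat.mul_le_mul hc hc, Nat.mul_le_mul this this]
  have hb : ¬ (p : ℤ) ∣ 2 * b := by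
    intro h
    rcases hpp.dvd_or_dvd h with h | h
    · have := Nat.le_of_dvd two_pos (by exact_mod_cast h)
      have := hp.two_le
      omega
    · rw [Int.natCast_dvd_natCast] at h
      obtain ⟨c, rfl⟩ := h
      rcases Nat.eq_zero_or_pos c with rfl | hc
      · have := (hp.prime.irreducible.not_isSquare) ⟨a, by nlinarith⟩
        exact this
      · have := hp.two_le
        nlinarith [Nat.mul_le_mul hc hc, Nat.mul_le_mul this this]
  rw [two_mul]
  nth_rewrite 2 [← card_twoSquares_filter_dvd_add hp hab' n]
  rw [← card_twoSquares_filter_dvd_add hp hab'' n, ← card_twoSquares_filter_dvd hp]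
  refine Eq.trans ?_ (Finset.card_union_add_card_inter _ _)
  rw [← Finset.filter_or, ← Finset.filter_and]
  congr 2
  · rw [Finset.filter_true_of_mem]
    intro z hz
    rw [mem_twoSquares] at hz
    refine hpp.dvd_or_dvd ⟨n * a ^ 2 - z.2 ^ 2, ?_⟩
    push_cast at hz
    linear_combination a ^ 2 * hz - z.2 ^ 2 * hab'
  · refine Finset.filter_congr fun z hz => ⟨fun h => ⟨?_, ?_⟩, fun h => ⟨?_, ?_⟩⟩
    · exact dvd_add (h.1.mul_right _) (h.2.mul_right _)
    · exact dvd_add (h.1.mul_right _) (h.2.mul_right _)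
    · refine (hpp.dvd_or_dvd (a := 2 * (a : ℤ)) ?_).resolve_left ha
      convert dvd_add h.1 h.2 using 1
      ring
    · refine (hpp.dvd_or_dvd (a := 2 * (b : ℤ)) ?_).resolve_left hb
      convert dvd_sub h.2 h.1 using 1
      ring

/-- The sum of the values of the nontrivial character modulo `4` at the divisors of `n`. -/
def sumChi (n : ℕ) : ℤ := ∑ d ∈ n.divisors, ZMod.χ₄ d

theorem sumChi_mul {p : ℕ} (hp : p.Prime) {n : ℕ} (hn : n ≠ 0) :
    sumChi (p * n) + ZMod.χ₄ p * (if p ∣ n then sumChi (n / p) else 0) =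
      (1 + ZMod.χ₄ p) * sumChi n := by
  have h1 : (p * n).divisors = n.divisors ∪ n.divisors.image (p * ·) := by
    ext d
    simp only [Finset.mem_union, Nat.mem_divisors, Finset.mem_image]
    constructor
    · rintro ⟨h, -⟩
      by_cases hd : p ∣ d
      · obtain ⟨c, rfl⟩ := hd
        exact Or.inr ⟨c, ⟨Nat.dvd_of_mul_dvd_mul_left hp.pos h, hn⟩, rfl⟩
      · exact Or.inl ⟨((hp.coprime_iff_not_dvd.2 hd).symm.dvd_of_dvd_mul_left h), hn⟩
    · rintro (⟨h, -⟩ | ⟨c, ⟨h, -⟩, rfl⟩)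
      · exact ⟨h.mul_left p, mul_ne_zero hp.ne_zero hn⟩
      · exact ⟨Nat.mul_dvd_mul_left p h, mul_ne_zero hp.ne_zero hn⟩
  have hinj : Set.InjOn (p * ·) (n.divisors : Set ℕ) :=
    fun _ _ _ _ h => Nat.eq_of_mul_eq_mul_left hp.pos h
  have h2 : ∑ d ∈ n.divisors.image (p * ·), ZMod.χ₄ d = ZMod.χ₄ p * sumChi n := by
    rw [Finset.sum_image hinj, sumChi, Finset.mul_sum]
    exact Finset.sum_congr rfl fun d _ => by push_cast; rw [map_mul]
  have h3 : ∑ d ∈ n.divisors ∩ n.divisors.image (p * ·), ZMod.χ₄ d =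
      ZMod.χ₄ p * (if p ∣ n then sumChi (n / p) else 0) := by
    split_ifs with h
    · obtain ⟨m, rfl⟩ := h
      have hm : m ≠ 0 := right_ne_zero_of_mul hn
      rw [Nat.mul_div_cancel_left _ hp.pos, sumChi, Finset.mul_sum]
      have : (p * m).divisors ∩ (p * m).divisors.image (p * ·) = m.divisors.image (p * ·) := by
        ext d
        simp only [Finset.mem_inter, Nat.mem_divisors, Finset.mem_image]
        constructor
        · rintro ⟨⟨h, -⟩, c, -, rfl⟩
          exact ⟨c, ⟨Nat.dvd_of_mul_dvd_mul_left hp.pos h, hm⟩, rfl⟩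
        · rintro ⟨c, ⟨h, -⟩, rfl⟩
          exact ⟨⟨Nat.mul_dvd_mul_left p h, hn⟩, c, ⟨h.mul_left p, hn⟩, rfl⟩
      rw [this, Finset.sum_image fun _ _ _ _ h => Nat.eq_of_mul_eq_mul_left hp.pos h]
      exact Finset.sum_congr rfl fun d _ => by push_cast; rw [map_mul]
    · rw [mul_zero]
      refine Finset.sum_eq_zero fun d hd => absurd ?_ h
      simp only [Finset.mem_inter, Nat.mem_divisors, Finset.mem_image] at hd
      obtain ⟨⟨hd, -⟩, c, -, rfl⟩ := hd
      exact (dvd_mul_right p c).trans hd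
  rw [← h3, sumChi, h1, Finset.sum_union_inter, h2, add_mul, one_mul]
  rfl

/-- Both sides satisfy the same recursion in each odd prime factor. -/
theorem card_twoSquares_of_odd {n : ℕ} (hn : Odd n) : ((twoSquares n).card : ℤ) = 4 * sumChi n := by
  induction n using Nat.strong_induction_on with
  | _ n ih =>
    rcases eq_or_ne n 1 with rfl | h1
    · decide
    have hp := Nat.minFac_prime h1
    obtain ⟨m, hm⟩ := Nat.minFac_dvd n
    set p := n.minFac
    have hn0 : 0 < n := hn.pos
    have hm0 : 0 < m := Nat.pos_of_mul_pos_left (hm ▸ hn0)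
    have hodd := Nat.odd_mul.1 (hm ▸ hn)
    have hmn : m < n := by
      rw [hm]
      exact lt_mul_of_one_lt_left hm0 hp.one_lt
    have e1 := ih m hmn hodd.2
    have e2 : ((if p ∣ m then (twoSquares (m / p)).card else 0 : ℕ) : ℤ) =
        4 * if p ∣ m then sumChi (m / p) else 0 := by
      split_ifs with h
      · exact ih _ ((Nat.div_le_self _ _).trans_lt hmn) (hodd.2.of_dvd_nat (Nat.div_dvd_of_dvd h))
      · simp
    have e3 := sumChi_mul hp hm0.ne'
    rw [← hm] at e3
    have hp4 : p % 4 = 1 ∨ p % 4 = 3 := by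
      have := Nat.odd_iff.1 hodd.1
      omega
    rcases hp4 with h | h
    · rw [ZMod.χ₄_nat_one_mod_four h] at e3
      have e4 := card_twoSquares_of_one hp h m
      rw [← hm] at e4
      have e5 := congrArg (Nat.cast : ℕ → ℤ) e4
      rw [Nat.cast_add, e2] at e5
      push_cast at e5
      linarith
    · rw [ZMod.χ₄_nat_three_mod_four h] at e3
      have e4 := card_twoSquares_of_three hp h m
      rw [← hm] at e4
      rw [e4, e2]
      linarith

end TwoSquares

end HeckeModTwo

namespace HeckeModTwo

/-! ### An elementary convolution identity for the character sums. -/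

section Involution

/-- The solutions `(d, e, a, b)` of `a d + b e = n` in odd natural numbers. -/
def oddQuadruples (n : ℕ) : Finset (ℕ × ℕ × ℕ × ℕ) :=
  (Finset.range (n + 1) ×ˢ Finset.range (n + 1) ×ˢ Finset.range (n + 1) ×ˢ
    Finset.range (n + 1)).filter fun t =>
      (Odd t.1 ∧ Odd t.2.1 ∧ Odd t.2.2.1 ∧ Odd t.2.2.2) ∧ t.2.2.1 * t.1 + t.2.2.2 * t.2.1 = n

theorem mem_oddQuadruples {n d e a b : ℕ} : (d, e, a, b) ∈ oddQuadruples n ↔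
    (Odd d ∧ Odd e ∧ Odd a ∧ Odd b) ∧ a * d + b * e = n := by
  simp only [oddQuadruples, Finset.mem_filter, Finset.mem_product, Finset.mem_range,
    and_iff_right_iff_imp]
  rintro ⟨⟨hd, he, ha, hb⟩, rfl⟩
  have h1 := Nat.le_mul_of_pos_left d ha.pos
  have h2 := Nat.le_mul_of_pos_left e hb.pos
  have h3 := Nat.le_mul_of_pos_right a hd.pos
  have h4 := Nat.le_mul_of_pos_right b he.pos
  omega

theorem χ₄_mul_χ₄_of_odd {d e : ℕ} (hd : Odd d) (he : Odd e) :
    ZMod.χ₄ d * ZMod.χ₄ e = if d % 4 = e % 4 then 1 else -1 := by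
  rw [Nat.odd_iff] at hd he
  rw [ZMod.χ₄_nat_eq_if_mod_four, ZMod.χ₄_nat_eq_if_mod_four]
  have h1 : d % 4 = 1 ∨ d % 4 = 3 := by omega
  have h2 : e % 4 = 1 ∨ e % 4 = 3 := by omega
  rcases h1 with h1 | h1 <;> rcases h2 with h2 | h2 <;> simp [h1, h2, hd, he]

/-- A sign-reversing involution. With k = d - e and e = q k + r, the map exchanges k with a + b and
r with a, keeping q, and preserves a d + b e. -/
theorem sum_oddQuadruples_of_lt {n : ℕ} (hn : Odd n) :
    ∑ t ∈ (oddQuadruples (2 * n)).filter (fun t => t.2.1 < t.1),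
      ZMod.χ₄ t.1 * ZMod.χ₄ t.2.1 = 0 := by
  let g : ℕ × ℕ × ℕ × ℕ → ℕ × ℕ × ℕ × ℕ := fun t =>
    (t.2.2.1 + (t.2.2.1 + t.2.2.2) * (t.2.1 / (t.1 - t.2.1)) + (t.2.2.1 + t.2.2.2),
      t.2.2.1 + (t.2.2.1 + t.2.2.2) * (t.2.1 / (t.1 - t.2.1)),
      t.2.1 % (t.1 - t.2.1), (t.1 - t.2.1) - t.2.1 % (t.1 - t.2.1))
  have hkey : ∀ t ∈ (oddQuadruples (2 * n)).filter (fun t => t.2.1 < t.1),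
      g t ∈ (oddQuadruples (2 * n)).filter (fun t => t.2.1 < t.1) ∧ g (g t) = t ∧
      ZMod.χ₄ t.1 * ZMod.χ₄ t.2.1 + ZMod.χ₄ (g t).1 * ZMod.χ₄ (g t).2.1 = 0 := by
    rintro ⟨d, e, a, b⟩ ht
    rw [Finset.mem_filter, mem_oddQuadruples] at ht
    obtain ⟨⟨⟨hd, he, ha, hb⟩, h⟩, hlt⟩ := ht
    simp only at hlt
    obtain ⟨k, rfl⟩ : ∃ k, d = e + k := ⟨d - e, by omega⟩
    simp only [g, Nat.add_sub_cancel_left]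
    set q := e / k with hq
    set r := e % k with hr
    have hk : 0 < k := by omega
    have hrk : r < k := Nat.mod_lt _ hk
    have hqr : r + k * q = e := Nat.mod_add_div e k
    have hk2 : Even k := by
      rw [Nat.odd_iff] at hd he
      rw [Nat.even_iff]
      omega
    have hr1 : Odd r := by
      rw [← hqr, Nat.odd_add] at he
      exact he.2 (hk2.mul_right q)
    have hs : Even (a + b) := ha.add_odd hb
    have he' : Odd (a + (a + b) * q) := ha.add_even (hs.mul_right q)
    refine ⟨?_, ?_, ?_⟩
    · rw [Finset.mem_filter, mem_oddQuadruples]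
      refine ⟨⟨⟨he'.add_even hs, he', hr1, ?_⟩, ?_⟩, ?_⟩
      · rw [Nat.odd_sub' hrk.le]
        exact ⟨fun _ => hk2, fun _ => hr1⟩
      · obtain ⟨c, hc⟩ : ∃ c, k = r + c := ⟨k - r, by omega⟩
        rw [show k - r = c by omega, ← h, ← hqr]
        rw [hc]
        ring
      · have := ha.pos
        simp only
        omega
    · have h1 : (a + (a + b) * q) / (a + b) = q := by
        rw [Nat.add_mul_div_left _ _ (by have := ha.pos; omega), Nat.div_eq_of_lt
          (by have := hb.pos; omega), zero_add]
      have h2 : (a + (a + b) * q) % (a + b) = a := by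
        rw [Nat.add_mul_mod_self_left, Nat.mod_eq_of_lt (by have := hb.pos; omega)]
      rw [h1, h2, show r + (k - r) = k by omega, hqr, Nat.add_sub_cancel_left]
    · rw [χ₄_mul_χ₄_of_odd hd he, χ₄_mul_χ₄_of_odd (he'.add_even hs) he']
      obtain ⟨κ, hκ⟩ := hk2
      obtain ⟨σ, hσ⟩ := hs
      have h3 : a * κ + σ * e = n := by
        have : a * (e + k) + b * e = a * k + (a + b) * e := by ring
        rw [this, hσ, hκ] at h
        linarith
      -- Since n = aκ + σe is odd with a and e odd, exactly one of κ, σ is odd. As χ₄(d) χ₄(e) = 1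
      -- exactly when 4 divides d - e, the sign changes.
      have h4 : Even κ ↔ Odd σ := by
        have h5 := h3 ▸ hn
        rw [Nat.odd_add, Nat.odd_mul, Nat.even_mul] at h5
        simp only [ha, true_and, Nat.not_even_iff_odd.2 he, or_false] at h5
        rw [← Nat.not_odd_iff_even, h5, Nat.not_even_iff_odd]
      rw [hσ, hκ]
      generalize a + (σ + σ) * q = e'
      rw [Nat.even_iff, Nat.odd_iff] at h4
      by_cases h6 : κ % 2 = 0
      · rw [if_pos (by omega), if_neg (by omega)]
        norm_num
      · rw [if_neg (by omega), if_pos (by omega)]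
        norm_num
  refine Finset.sum_involution (fun t _ => g t) (fun t ht => (hkey t ht).2.2) ?_
    (fun t ht => (hkey t ht).1) (fun t ht => (hkey t ht).2.1)
  intro t ht hne heq
  have := (hkey t ht).2.2
  rw [heq] at this
  omega

/-- The terms with d ≠ e cancel. For d = e dividing n, there are n/d ways to write 2n/d as a sum of
two odd numbers, each with sign 1. -/
theorem sum_oddQuadruples {n : ℕ} (hn : Odd n) :
    ∑ t ∈ oddQuadruples (2 * n), ZMod.χ₄ t.1 * ZMod.χ₄ t.2.1 = ∑ d ∈ n.divisors, (d : ℤ) := by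
  have h1 : ∑ t ∈ (oddQuadruples (2 * n)).filter (fun t => t.1 < t.2.1),
      ZMod.χ₄ t.1 * ZMod.χ₄ t.2.1 = 0 := by
    rw [← sum_oddQuadruples_of_lt hn]
    refine Finset.sum_nbij' (fun t => (t.2.1, t.1, t.2.2.2, t.2.2.1))
      (fun t => (t.2.1, t.1, t.2.2.2, t.2.2.1)) ?_ ?_ (fun _ _ => rfl) (fun _ _ => rfl)
      (fun _ _ => mul_comm _ _)
    all_goals
      rintro ⟨d, e, a, b⟩ ht
      rw [Finset.mem_filter, mem_oddQuadruples] at ht ⊢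
      refine ⟨⟨⟨ht.1.1.2.1, ht.1.1.1, ht.1.1.2.2.2, ht.1.1.2.2.1⟩, ?_⟩, ht.2⟩
      rw [add_comm]
      exact ht.1.2
  have h2 : ∑ t ∈ (oddQuadruples (2 * n)).filter (fun t => t.1 = t.2.1),
      ZMod.χ₄ t.1 * ZMod.χ₄ t.2.1 = ∑ d ∈ n.divisors, (d : ℤ) := by
    have h3 : ∀ t ∈ (oddQuadruples (2 * n)).filter (fun t => t.1 = t.2.1),
        ZMod.χ₄ t.1 * ZMod.χ₄ t.2.1 = 1 := by
      rintro ⟨d, e, a, b⟩ ht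
      rw [Finset.mem_filter, mem_oddQuadruples] at ht
      rw [χ₄_mul_χ₄_of_odd ht.1.1.1 ht.1.1.2.1, if_pos]
      have := ht.2
      simp only at this
      rw [this]
    rw [Finset.sum_congr rfl h3, Finset.sum_const, nsmul_one, ← Nat.cast_sum,
      ← Nat.sum_div_divisors n fun d => d]
    congr 1
    have h4 : ∑ d ∈ n.divisors, n / d = (n.divisors.sigma fun d => Finset.range (n / d)).card := by
      simp
    rw [h4]
    have h5 : ∀ t ∈ (oddQuadruples (2 * n)).filter (fun t => t.1 = t.2.1), ∃ m,
        0 < t.1 ∧ n = t.1 * m ∧ t.2.2.1 + t.2.2.2 = 2 * m ∧ Odd t.2.2.1 ∧ Odd t.2.2.2 := by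
      rintro ⟨d, e, a, b⟩ ht
      rw [Finset.mem_filter, mem_oddQuadruples] at ht
      obtain ⟨⟨⟨hd, he, ha, hb⟩, h⟩, hde⟩ := ht
      simp only at hde
      subst hde
      have hdn : d ∣ n := by
        refine (Nat.Coprime.dvd_of_dvd_mul_left (Nat.coprime_two_right.2 hd)) ⟨a + b, ?_⟩
        rw [← h]
        ring
      obtain ⟨m, rfl⟩ := hdn
      refine ⟨m, hd.pos, rfl, Nat.eq_of_mul_eq_mul_left hd.pos ?_, ha, hb⟩
      simp only
      linarith
    refine Finset.card_nbij' (fun t => ⟨t.1, t.2.2.1 / 2⟩)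
      (fun x => (x.1, x.1, 2 * x.2 + 1, 2 * (n / x.1) - (2 * x.2 + 1))) ?_ ?_ ?_ ?_
    · intro t ht
      obtain ⟨m, hd, hm, hab, ha, hb⟩ := h5 t ht
      simp only [Finset.coe_sigma, Set.mem_sigma_iff, Finset.mem_coe, Nat.mem_divisors,
        Finset.mem_range]
      refine ⟨⟨⟨m, hm⟩, hn.pos.ne'⟩, ?_⟩
      conv_rhs => rw [hm, Nat.mul_div_cancel_left _ hd]
      have := hb.pos
      omega
    · rintro ⟨d, i⟩ hx
      simp only [Finset.coe_sigma, Set.mem_sigma_iff, Finset.mem_coe, Nat.mem_divisors,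
        Finset.mem_range] at hx
      obtain ⟨⟨⟨m, rfl⟩, -⟩, hi⟩ := hx
      have hd := (Nat.odd_mul.1 hn).1
      rw [Nat.mul_div_cancel_left _ hd.pos] at hi
      rw [Finset.mem_coe, Finset.mem_filter, mem_oddQuadruples]
      simp only
      rw [Nat.mul_div_cancel_left _ hd.pos]
      refine ⟨⟨⟨hd, hd, ⟨i, rfl⟩, ⟨m - i - 1, by omega⟩⟩, ?_⟩, trivial⟩
      rw [← add_mul, show 2 * i + 1 + (2 * m - (2 * i + 1)) = 2 * m by omega]
      ring
    · intro t ht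
      obtain ⟨m, hd, hm, hab, ha, hb⟩ := h5 t ht
      have hde := (Finset.mem_filter.1 ht).2
      rw [Nat.odd_iff] at ha
      refine Prod.ext rfl (Prod.ext hde (Prod.ext ?_ ?_))
      · simp only
        omega
      · simp only
        conv_lhs => rw [hm, Nat.mul_div_cancel_left _ hd]
        omega
    · rintro ⟨d, i⟩ hx
      simp only
      congr 1
      omega
  rw [← Finset.sum_filter_add_sum_filter_not _ (fun t => t.1 < t.2.1), h1, zero_add,
    ← Finset.sum_filter_add_sum_filter_not _ (fun t => t.1 = t.2.1), Finset.filter_filter,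
    Finset.filter_filter, ← h2, ← add_zero (∑ t ∈ (oddQuadruples (2 * n)).filter (fun t => t.1 = t.2.1), _),
    ← sum_oddQuadruples_of_lt hn]
  congr 2 <;> refine Finset.filter_congr fun t _ => ?_ <;> omega

theorem sum_sumChi_mul_sumChi {n : ℕ} (hn : Odd n) :
    ∑ uv ∈ (Finset.HasAntidiagonal.antidiagonal (2 * n)).filter (fun uv => Odd uv.1),
      sumChi uv.1 * sumChi uv.2 = ∑ d ∈ n.divisors, (d : ℤ) := by
  rw [← sum_oddQuadruples hn]
  simp only [sumChi, Finset.sum_mul_sum, ← Finset.sum_product']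
  rw [Finset.sum_sigma']
  symm
  refine Finset.sum_nbij' (fun t => ⟨(t.2.2.1 * t.1, t.2.2.2 * t.2.1), (t.1, t.2.1)⟩)
    (fun x => (x.2.1, x.2.2, x.1.1 / x.2.1, x.1.2 / x.2.2)) ?_ ?_ ?_ ?_ ?_
  · rintro ⟨d, e, a, b⟩ ht
    rw [mem_oddQuadruples] at ht
    obtain ⟨⟨hd, he, ha, hb⟩, h⟩ := ht
    simp only [Finset.mem_sigma, Finset.mem_filter, Finset.HasAntidiagonal.mem_antidiagonal,
      Finset.mem_product, Nat.mem_divisors]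
    exact ⟨⟨h, ha.mul hd⟩, ⟨dvd_mul_left _ _, (ha.mul hd).pos.ne'⟩, dvd_mul_left _ _,
      (hb.mul he).pos.ne'⟩
  · rintro ⟨⟨u, v⟩, d, e⟩ hx
    simp only [Finset.mem_sigma, Finset.mem_filter, Finset.HasAntidiagonal.mem_antidiagonal,
      Finset.mem_product, Nat.mem_divisors] at hx
    obtain ⟨⟨h, hu⟩, ⟨⟨a, rfl⟩, h0⟩, ⟨b, rfl⟩, h1⟩ := hx
    have hv : Odd (e * b) := by
      rw [Nat.odd_iff] at hu ⊢
      omega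
    simp only
    rw [Nat.mul_div_cancel_left _ (Nat.odd_mul.1 hu).1.pos,
      Nat.mul_div_cancel_left _ (Nat.odd_mul.1 hv).1.pos, mem_oddQuadruples]
    exact ⟨⟨(Nat.odd_mul.1 hu).1, (Nat.odd_mul.1 hv).1, (Nat.odd_mul.1 hu).2,
      (Nat.odd_mul.1 hv).2⟩, by rw [mul_comm a, mul_comm b, h]⟩
  · rintro ⟨d, e, a, b⟩ ht
    rw [mem_oddQuadruples] at ht
    simp only
    rw [Nat.mul_div_cancel _ ht.1.1.pos, Nat.mul_div_cancel _ ht.1.2.1.pos]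
  · rintro ⟨⟨u, v⟩, d, e⟩ hx
    simp only [Finset.mem_sigma, Finset.mem_filter, Finset.HasAntidiagonal.mem_antidiagonal,
      Finset.mem_product, Nat.mem_divisors] at hx
    simp only
    rw [Nat.div_mul_cancel hx.2.1.1, Nat.div_mul_cancel hx.2.2.1]
  · intro _ _
    rfl

end Involution

end HeckeModTwo

namespace HeckeModTwo

open PowerSeries

/-! ### Bookkeeping of exponents in residue classes. -/

section Support

variable {R : Type*} [CommRing R]

/-- The nonzero coefficients of `f` sit in degrees congruent to `r` modulo `m`. -/
def SupportedMod (m r : ℕ) (f : PowerSeries R) : Prop :=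
  ∀ n, coeff n f ≠ 0 → n ≡ r [MOD m]

theorem SupportedMod.coeff_eq_zero {m r n : ℕ} {f : PowerSeries R} (h : SupportedMod m r f)
    (hn : ¬ n ≡ r [MOD m]) : coeff n f = 0 := by
  by_contra h'
  exact hn (h n h')

theorem SupportedMod.mul {m r s : ℕ} {f g : PowerSeries R} (hf : SupportedMod m r f)
    (hg : SupportedMod m s g) : SupportedMod m (r + s) (f * g) := by
  intro n hn
  rw [coeff_mul] at hn
  obtain ⟨ij, hij, h⟩ := Finset.exists_ne_zero_of_sum_ne_zero hn
  rw [← Finset.HasAntidiagonal.mem_antidiagonal.1 hij]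
  exact (hf _ (left_ne_zero_of_mul h)).add (hg _ (right_ne_zero_of_mul h))

theorem SupportedMod.expand {m r : ℕ} {f : PowerSeries R} (hf : SupportedMod m r f) (k : ℕ)
    (hk : k ≠ 0) : SupportedMod (k * m) (k * r) (PowerSeries.expand k hk f) := by
  intro n hn
  rw [coeff_expand] at hn
  split_ifs at hn with h
  · obtain ⟨c, rfl⟩ := h
    rw [Nat.mul_div_cancel_left _ (Nat.pos_of_ne_zero hk)] at hn
    exact (hf _ hn).mul_left' k
  · exact absurd rfl hn

theorem SupportedMod.of_dvd {m m' r : ℕ} {f : PowerSeries R} (hf : SupportedMod m r f)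
    (h : m' ∣ m) : SupportedMod m' r f :=
  fun n hn => (hf n hn).of_dvd h

theorem supportedMod_one (f : PowerSeries R) : SupportedMod 1 0 f := fun _ _ => Nat.modEq_one

end Support

/-! ### Theta series and four odd squares. -/

section Theta

/-- The series `∑ q^{(2m+1)²}` with integer coefficients. -/
noncomputable def intDelta : PowerSeries ℤ :=
  open Classical in PowerSeries.mk fun n => if ∃ m : ℕ, n = (2 * m + 1) ^ 2 then 1 else 0

/-- The integers with square `n`. -/
noncomputable def squareRoots (n : ℕ) : Finset ℤ :=
  (Finset.Icc (-(n : ℤ)) n).filter fun x : ℤ => x ^ 2 = n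

theorem mem_squareRoots {n : ℕ} {x : ℤ} : x ∈ squareRoots n ↔ x ^ 2 = n := by
  simp only [squareRoots, Finset.mem_filter, Finset.mem_Icc, and_iff_right_iff_imp]
  intro h
  constructor <;> nlinarith [Int.le_self_sq x, Int.le_self_sq (-x)]

/-- The theta series `∑ q^{x²}`, the sum being over all integers. -/
noncomputable def theta : PowerSeries ℤ := PowerSeries.mk fun n => (squareRoots n).card

theorem coeff_theta (n : ℕ) : coeff n theta = (squareRoots n).card := by
  rw [theta, coeff_mk]

theorem coeff_theta_sq (n : ℕ) : coeff n (theta ^ 2) = ((twoSquares n).card : ℤ) := by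
  rw [sq, coeff_mul]
  simp only [coeff_theta]
  rw [Finset.card_eq_sum_card_fiberwise (f := fun z : ℤ × ℤ => ((z.1 ^ 2).toNat, (z.2 ^ 2).toNat))
    (t := Finset.HasAntidiagonal.antidiagonal n)]
  · push_cast
    refine Finset.sum_congr rfl fun ij hij => ?_
    rw [← Nat.cast_mul, ← Finset.card_product]
    congr 2
    ext z
    rw [Finset.mem_product, mem_squareRoots, mem_squareRoots, Finset.mem_filter, mem_twoSquares,
      Prod.ext_iff]
    rw [Finset.HasAntidiagonal.mem_antidiagonal] at hij
    have h1 := sq_nonneg z.1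
    have h2 := sq_nonneg z.2
    simp only
    omega
  · intro z hz
    rw [Finset.mem_coe, mem_twoSquares] at hz
    rw [Finset.mem_coe, Finset.HasAntidiagonal.mem_antidiagonal]
    have h1 := sq_nonneg z.1
    have h2 := sq_nonneg z.2
    simp only
    omega

theorem coeff_theta_sq_root (m : ℕ) : coeff (m ^ 2) theta = if m = 0 then 1 else 2 := by
  rw [coeff_theta]
  have : squareRoots (m ^ 2) = {(m : ℤ), -(m : ℤ)} := by
    ext x
    rw [mem_squareRoots]
    push_cast
    rw [sq_eq_sq_iff_eq_or_eq_neg]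
    simp
  rw [this]
  split_ifs with h
  · simp [h]
  · rw [Finset.card_pair (by omega)]
    rfl

theorem coeff_theta_of_not_isSquare {n : ℕ} (h : ¬ IsSquare n) : coeff n theta = 0 := by
  rw [coeff_theta, Nat.cast_eq_zero, Finset.card_eq_zero, Finset.eq_empty_iff_forall_notMem]
  intro x hx
  rw [mem_squareRoots] at hx
  refine h ⟨x.natAbs, ?_⟩
  zify
  rw [← sq, sq_abs, hx]

theorem coeff_intDelta (n : ℕ) [Decidable (∃ m : ℕ, n = (2 * m + 1) ^ 2)] :
    coeff n intDelta = if ∃ m : ℕ, n = (2 * m + 1) ^ 2 then 1 else 0 := by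
  rw [intDelta, coeff_mk]
  congr

theorem supportedMod_intDelta : SupportedMod 8 1 intDelta := by
  classical
  intro n hn
  rw [coeff_intDelta] at hn
  obtain ⟨m, rfl⟩ := (ite_ne_right_iff.1 hn).1
  obtain ⟨c, hc⟩ := Nat.even_mul_succ_self m
  have : (2 * m + 1) ^ 2 = 4 * (m * (m + 1)) + 1 := by ring
  rw [Nat.ModEq]
  omega

theorem theta_eq : theta = expand 4 four_ne_zero theta + 2 * intDelta := by
  classical
  ext n
  rw [map_add, coeff_expand, two_mul, map_add, ← two_mul, coeff_intDelta]
  by_cases h : IsSquare n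
  · obtain ⟨r, rfl⟩ := h
    rw [← sq]
    rcases Nat.even_or_odd' r with ⟨m, rfl | rfl⟩
    · have h1 : ¬ ∃ k, (2 * m) ^ 2 = (2 * k + 1) ^ 2 := by
        rintro ⟨k, hk⟩
        have := Nat.pow_left_injective two_ne_zero hk
        omega
      rw [if_neg h1, mul_zero, add_zero, if_pos ⟨m ^ 2, by ring⟩,
        show (2 * m) ^ 2 / 4 = m ^ 2 by rw [mul_pow]; omega, coeff_theta_sq_root,
        coeff_theta_sq_root]
      simp
    · have h4 : ¬ 4 ∣ (2 * m + 1) ^ 2 := by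
        intro h
        have : 2 ∣ (2 * m + 1) ^ 2 := (by norm_num : 2 ∣ 4).trans h
        have := Nat.prime_two.dvd_of_dvd_pow this
        omega
      rw [if_neg h4, if_pos ⟨m, rfl⟩, coeff_theta_sq_root, if_neg (by omega)]
      rfl
  · have h1 : ¬ ∃ m, n = (2 * m + 1) ^ 2 := by
      rintro ⟨m, rfl⟩
      exact h ⟨2 * m + 1, by ring⟩
    rw [coeff_theta_of_not_isSquare h, if_neg h1, mul_zero, add_zero]
    · split_ifs with h4
      · obtain ⟨c, rfl⟩ := h4
        rw [Nat.mul_div_cancel_left _ (by norm_num), coeff_theta_of_not_isSquare]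
        rintro ⟨r, rfl⟩
        exact h ⟨2 * r, by ring⟩
      · rfl

/-- The grouping is by degree: the bracket is supported in even degrees, the last term in degrees 1
modulo 4. -/
theorem theta_sq_eq : theta ^ 2 =
    (expand 4 four_ne_zero theta ^ 2 + 4 * intDelta ^ 2) +
      4 * (intDelta * expand 4 four_ne_zero theta) := by
  conv_lhs => rw [theta_eq]
  ring

theorem supportedMod_expand_theta : SupportedMod 4 0 (expand 4 four_ne_zero theta) :=
  (supportedMod_one theta).expand 4 four_ne_zero

theorem coeff_four_mul {n : ℕ} (f : PowerSeries ℤ) : coeff n (4 * f) = 4 * coeff n f := by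
  rw [← coeff_C_mul]
  rfl

/-- The odd part of `theta ^ 2`. -/
theorem coeff_intDelta_mul_of_odd {n : ℕ} (hn : Odd n) :
    coeff n (intDelta * expand 4 four_ne_zero theta) = sumChi n := by
  have h1 := coeff_theta_sq n
  have hn' := Nat.odd_iff.1 hn
  rw [theta_sq_eq, map_add, map_add, card_twoSquares_of_odd hn, coeff_four_mul, coeff_four_mul,
    sq, sq, (supportedMod_expand_theta.mul supportedMod_expand_theta).coeff_eq_zero,
    (supportedMod_intDelta.mul supportedMod_intDelta).coeff_eq_zero] at h1
  · linarith
  all_goals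
    rw [Nat.ModEq]
    omega

/-- For odd m, the coefficients of θ² at q^m and q^(2m) are equal; the first comes from δ·θ(q⁴)
alone, the second from δ² alone, with δ = `intDelta`. In all other degrees both sides vanish. -/
theorem intDelta_sq_eq : intDelta ^ 2 =
    expand 2 two_ne_zero (intDelta * expand 4 four_ne_zero theta) := by
  have hs := supportedMod_intDelta.mul supportedMod_intDelta
  have hs' := (supportedMod_intDelta.of_dvd (by norm_num : 4 ∣ 8)).mul supportedMod_expand_theta
  rw [← sq] at hs
  ext n
  rw [coeff_expand]
  split_ifs with h
  · obtain ⟨m, rfl⟩ := h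
    rw [Nat.mul_div_cancel_left _ two_pos]
    rcases Nat.even_or_odd m with hm | hm
    · rw [Nat.even_iff] at hm
      rw [hs.coeff_eq_zero, hs'.coeff_eq_zero] <;> rw [Nat.ModEq] <;> omega
    · have h1 := coeff_theta_sq (2 * m)
      rw [coeff_intDelta_mul_of_odd hm]
      rw [theta_sq_eq, map_add, map_add, card_twoSquares_two_mul, card_twoSquares_of_odd hm,
        coeff_four_mul, coeff_four_mul, sq (expand _ _ _), hs'.coeff_eq_zero,
        (supportedMod_expand_theta.mul supportedMod_expand_theta).coeff_eq_zero] at h1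
      · linarith
      all_goals
        rw [Nat.odd_iff] at hm
        rw [Nat.ModEq]
        omega
  · rw [hs.coeff_eq_zero]
    rw [Nat.ModEq]
    omega

theorem intDelta_pow_four_eq : intDelta ^ 4 = expand 4 four_ne_zero
    (intDelta * expand 4 four_ne_zero theta * expand 2 two_ne_zero theta ^ 2) := by
  rw [show intDelta ^ 4 = (intDelta ^ 2) ^ 2 by ring, intDelta_sq_eq, ← map_pow, mul_pow,
    intDelta_sq_eq]
  have h1 : ∀ f : PowerSeries ℤ, expand 4 four_ne_zero f =
      expand 2 two_ne_zero (expand 2 two_ne_zero f) := fun f =>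
    (expand_mul 2 two_ne_zero 2 two_ne_zero f)
  rw [h1 (_ * _), map_mul _ (_ * _), ← map_pow (expand 2 two_ne_zero) theta, h1 theta]
  simp only [map_mul, map_pow]

/-- Jacobi's theorem on sums of four odd squares. -/
theorem coeff_intDelta_pow_four {n : ℕ} (hn : Odd n) :
    coeff (4 * n) (intDelta ^ 4) = ∑ d ∈ n.divisors, (d : ℤ) := by
  rw [← sum_sumChi_mul_sumChi hn, show intDelta ^ 4 = intDelta ^ 2 * intDelta ^ 2 by ring,
    intDelta_sq_eq, ← map_mul, show 4 * n = 2 * (2 * n) by ring, coeff_expand_mul, coeff_mul,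
    Finset.sum_filter]
  refine Finset.sum_congr rfl fun uv huv => ?_
  rw [Finset.HasAntidiagonal.mem_antidiagonal] at huv
  split_ifs with h
  · rw [coeff_intDelta_mul_of_odd h, coeff_intDelta_mul_of_odd]
    rw [Nat.odd_iff] at *
    omega
  · have hs' := (supportedMod_intDelta.of_dvd (by norm_num : 4 ∣ 8)).mul supportedMod_expand_theta
    rw [hs'.coeff_eq_zero, zero_mul]
    rw [Nat.odd_iff] at h
    rw [Nat.ModEq]
    omega

theorem coeff_intDelta_mul_mul {n : ℕ} (hn : Odd n) :
    coeff n (intDelta * expand 4 four_ne_zero theta * expand 2 two_ne_zero theta ^ 2) =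
      ∑ d ∈ n.divisors, (d : ℤ) := by
  rw [← coeff_intDelta_pow_four hn, intDelta_pow_four_eq, coeff_expand_mul]

end Theta

end HeckeModTwo

namespace HeckeModTwo

open PowerSeries

/-! ### Prime coefficients of the small powers of Δ. -/

section ModTwo

theorem SupportedMod.add {R : Type*} [CommRing R] {m r : ℕ} {f g : PowerSeries R}
    (hf : SupportedMod m r f) (hg : SupportedMod m r g) : SupportedMod m r (f + g) := by
  intro n hn
  by_contra h
  rw [map_add, hf.coeff_eq_zero h, hg.coeff_eq_zero h, add_zero] at hn
  exact hn rfl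

theorem SupportedMod.four_mul {m r : ℕ} {f : PowerSeries ℤ} (hf : SupportedMod m r f) :
    SupportedMod m r (4 * f) := by
  intro n hn
  rw [coeff_four_mul] at hn
  exact hf n (right_ne_zero_of_mul hn)

/-- Substitute q² in the decomposition of θ²: its even part then contributes only in degrees 1
modulo 4, and the rest becomes 4δ², with δ = `intDelta`. -/
theorem coeff_intDelta_cube_mul {n : ℕ} (hn : n % 4 = 3) :
    4 * coeff n (intDelta ^ 3 * expand 4 four_ne_zero theta) = ∑ d ∈ n.divisors, (d : ℤ) := by
  rw [← coeff_intDelta_mul_mul (Nat.odd_iff.2 (by omega)), ← map_pow, theta_sq_eq, map_add,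
    mul_add, map_add]
  have h4 := supportedMod_intDelta.of_dvd (by norm_num : 4 ∣ 8)
  have hG : SupportedMod 2 0 (expand 4 four_ne_zero theta ^ 2 + 4 * intDelta ^ 2) := by
    refine SupportedMod.add ?_ (SupportedMod.four_mul ?_)
    · rw [sq]
      exact (supportedMod_expand_theta.mul supportedMod_expand_theta).of_dvd (by norm_num)
    · rw [sq]
      exact fun n hn => ((h4.mul h4 n hn).of_dvd (by norm_num : 2 ∣ 4)).trans (by decide)
  rw [((h4.mul supportedMod_expand_theta).mul (hG.expand 2 two_ne_zero)).coeff_eq_zero, zero_add,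
    map_mul (expand 2 two_ne_zero), ← intDelta_sq_eq, map_ofNat, ← coeff_four_mul]
  · congr 1
    ring
  · rw [Nat.ModEq]
    omega

/-- Split θ(q⁴) once more as θ(q¹⁶) + 2δ(q⁴), where δ = `intDelta`; the first part lives in degrees
3 modulo 8. Modulo 2 the product that is left is Δ³ Δ⁴. -/
theorem coeff_intDelta_cube_mul_expand {n : ℕ} (hn : n % 8 = 7) :
    8 * coeff n (intDelta ^ 3 * expand 4 four_ne_zero intDelta) = ∑ d ∈ n.divisors, (d : ℤ) := by
  rw [← coeff_intDelta_cube_mul (by omega)]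
  conv_rhs => rw [theta_eq]
  have h3 : SupportedMod 8 3 (intDelta ^ 3) := by
    rw [pow_succ, sq]
    exact (supportedMod_intDelta.mul supportedMod_intDelta).mul supportedMod_intDelta
  have h16 : SupportedMod 8 0 (expand 4 four_ne_zero (expand 4 four_ne_zero theta)) :=
    (supportedMod_expand_theta.expand 4 four_ne_zero).of_dvd (by norm_num)
  rw [map_add, mul_add, map_add, (h3.mul h16).coeff_eq_zero, zero_add, two_mul, map_add, mul_add,
    map_add]
  · ring
  · rw [Nat.ModEq]
    omega

theorem map_intDelta : map (Int.castRingHom (ZMod 2)) intDelta = Delta := by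
  classical
  ext n
  rw [coeff_map, coeff_intDelta, coeff_Delta]
  split_ifs <;> simp

theorem map_theta : map (Int.castRingHom (ZMod 2)) theta = 1 := by
  ext n
  rw [coeff_map, coeff_one]
  by_cases h : IsSquare n
  · obtain ⟨m, rfl⟩ := h
    rw [← sq, coeff_theta_sq_root]
    by_cases hm : m = 0
    · simp [hm]
    · rw [if_neg hm, if_neg (pow_ne_zero 2 hm)]
      rfl
  · rw [coeff_theta_of_not_isSquare h, if_neg, map_zero]
    rintro rfl
    exact h ⟨0, rfl⟩

theorem Delta_pow_two_pow (i : ℕ) :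
    Delta ^ 2 ^ i = expand (2 ^ i) (pow_ne_zero i two_ne_zero) Delta := by
  induction i with
  | zero => simp
  | succ i ih =>
    rw [show Delta ^ 2 ^ (i + 1) = (Delta ^ 2 ^ i) ^ 2 by rw [pow_succ, pow_mul], ih, sq_eq_expand,
      ← expand_mul]
    congr 2
    ring

theorem coeff_Delta_cube_of_three {n : ℕ} (hn : n % 4 = 3) :
    ∃ c : ℤ, ∑ d ∈ n.divisors, (d : ℤ) = 4 * c ∧ coeff n (Delta ^ 3) = (c : ZMod 2) := by
  refine ⟨_, (coeff_intDelta_cube_mul hn).symm, ?_⟩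
  have h := coeff_map (Int.castRingHom (ZMod 2)) n (intDelta ^ 3 * expand 4 four_ne_zero theta)
  rw [map_mul, map_pow, map_intDelta, map_expand, map_theta, map_one, mul_one] at h
  exact h

theorem coeff_Delta_seven_of_seven {n : ℕ} (hn : n % 8 = 7) :
    ∃ c : ℤ, ∑ d ∈ n.divisors, (d : ℤ) = 8 * c ∧ coeff n (Delta ^ 7) = (c : ZMod 2) := by
  refine ⟨_, (coeff_intDelta_cube_mul_expand hn).symm, ?_⟩
  have h := coeff_map (Int.castRingHom (ZMod 2)) n (intDelta ^ 3 * expand 4 four_ne_zero intDelta)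
  have h4 := Delta_pow_two_pow 2
  norm_num at h4
  rw [map_mul, map_pow, map_intDelta, map_expand, map_intDelta, ← h4, ← pow_add] at h
  exact h

theorem sum_divisors_prime {p : ℕ} (hp : p.Prime) : ∑ d ∈ p.divisors, (d : ℤ) = p + 1 := by
  rw [hp.sum_divisors]
  simp

theorem coeff_Delta_three_prime {p : ℕ} (hp : p.Prime) :
    coeff p (Delta ^ 3) = 1 ↔ p ≡ 3 [MOD 8] := by
  constructor
  · intro h
    by_contra h'
    rw [coeff_Delta_pow_of_mod_ne 3 h'] at h
    exact zero_ne_one h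
  · intro h
    rw [Nat.ModEq] at h
    obtain ⟨c, h1, h2⟩ := coeff_Delta_cube_of_three (n := p) (by omega)
    rw [sum_divisors_prime hp] at h1
    rw [h2, ZMod.intCast_eq_one_iff_odd, Int.odd_iff]
    omega

theorem coeff_Delta_seven_prime {p : ℕ} (hp : p.Prime) :
    coeff p (Delta ^ 7) = 1 ↔ p ≡ 7 [MOD 16] := by
  by_cases h : p % 8 = 7
  · obtain ⟨c, h1, h2⟩ := coeff_Delta_seven_of_seven h
    rw [sum_divisors_prime hp] at h1
    rw [h2, ZMod.intCast_eq_one_iff_odd, Int.odd_iff, Nat.ModEq]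
    omega
  · rw [coeff_Delta_pow_of_mod_ne 7 h, Nat.ModEq]
    simp only [zero_ne_one, false_iff]
    omega

/-- Euler's argument: p divides xv - uy or xv + uy, and p² = (xu ± dyv)² + d(xv ∓ uy)² with d ≥ 2
forces that factor to vanish. Positivity excludes the sum. -/
theorem unique_sq_add_mul_sq {p d x y u v : ℕ} (hp : p.Prime) (hd : 2 ≤ d) (hx : 0 < x)
    (hv : 0 < v) (h : p = x ^ 2 + d * y ^ 2) (h' : p = u ^ 2 + d * v ^ 2) : x = u ∧ y = v := by
  zify at h h' hd hx hv
  have hpp := Nat.prime_iff_prime_int.1 hp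
  have hp0 : (0 : ℤ) < p := by exact_mod_cast hp.pos
  have hbig : ∀ s t : ℤ, (p : ℤ) ^ 2 = s ^ 2 + d * t ^ 2 → (p : ℤ) ∣ t → t = 0 := by
    rintro s t hst ⟨c, rfl⟩
    by_contra hne
    have hc : c ≠ 0 := right_ne_zero_of_mul hne
    have hc1 : 1 ≤ c ^ 2 := by
      have := sq_pos_of_ne_zero hc
      omega
    have h1 : (p : ℤ) ^ 2 * (d * c ^ 2) ≤ (p : ℤ) ^ 2 * 1 := by nlinarith [sq_nonneg s]
    have h2 := le_of_mul_le_mul_left h1 (by positivity)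
    nlinarith
  have hdvd : (p : ℤ) ∣ (x * v - u * y) * (x * v + u * y) := by
    refine ⟨v ^ 2 - y ^ 2, ?_⟩
    linear_combination (v : ℤ) ^ 2 * -h + (y : ℤ) ^ 2 * h'
  rcases hpp.dvd_or_dvd hdvd with h1 | h1
  · have h2 := hbig (x * u + d * y * v) _ (by
      linear_combination (p : ℤ) * h + (x ^ 2 + d * y ^ 2 : ℤ) * h') h1
    have h3 : (p : ℤ) * (v ^ 2 - y ^ 2) = 0 := by
      linear_combination (x * v + u * y : ℤ) * h2 + (v : ℤ) ^ 2 * h - (y : ℤ) ^ 2 * h'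
    have h4 : (y : ℤ) ^ 2 = v ^ 2 := by
      have := (mul_eq_zero.1 h3).resolve_left hp0.ne'
      linarith
    have h5 : (x : ℤ) ^ 2 = u ^ 2 := by
      rw [h4] at h
      linarith
    exact ⟨Nat.pow_left_injective two_ne_zero (by exact_mod_cast h5),
      Nat.pow_left_injective two_ne_zero (by exact_mod_cast h4)⟩
  · have h2 := hbig (x * u - d * y * v) _ (by
      linear_combination (p : ℤ) * h + (x ^ 2 + d * y ^ 2 : ℤ) * h') h1
    have : (0 : ℤ) < x * v + u * y := by positivity
    omega

/-- By Frobenius the coefficient counts the representations modulo 2; uniqueness turns the parity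
into existence. -/
theorem coeff_Delta_mul_prime {p : ℕ} (hp : p.Prime) (i : ℕ) (hi : i ≠ 0) :
    coeff p (Delta ^ (1 + 2 ^ i)) = 1 ↔
      ∃ x y : ℕ, p = (2 * x + 1) ^ 2 + 2 ^ i * (2 * y + 1) ^ 2 := by
  classical
  have hd : 0 < 2 ^ i := by positivity
  rw [pow_add, pow_one, Delta_pow_two_pow, coeff_mul]
  have hne : ∀ kl ∈ Finset.HasAntidiagonal.antidiagonal p,
      coeff kl.1 Delta * coeff kl.2 (expand (2 ^ i) (pow_ne_zero i two_ne_zero) Delta) ≠ 0 →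
      ∃ x y : ℕ, kl = ((2 * x + 1) ^ 2, 2 ^ i * (2 * y + 1) ^ 2) := by
    rintro ⟨k, l⟩ _ h
    have h1 := left_ne_zero_of_mul h
    have h2 := right_ne_zero_of_mul h
    simp only at h1 h2
    rw [coeff_Delta] at h1
    rw [coeff_expand] at h2
    obtain ⟨x, rfl⟩ := (ite_ne_right_iff.1 h1).1
    obtain ⟨⟨c, rfl⟩, h3⟩ := ite_ne_right_iff.1 h2
    rw [Nat.mul_div_cancel_left _ hd, coeff_Delta] at h3
    obtain ⟨y, rfl⟩ := (ite_ne_right_iff.1 h3).1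
    exact ⟨x, y, rfl⟩
  constructor
  · intro h
    obtain ⟨kl, hkl, h1⟩ := Finset.exists_ne_zero_of_sum_ne_zero (h.trans_ne one_ne_zero)
    obtain ⟨x, y, rfl⟩ := hne kl hkl h1
    exact ⟨x, y, (Finset.HasAntidiagonal.mem_antidiagonal.1 hkl).symm⟩
  · rintro ⟨x, y, h⟩
    rw [Finset.sum_eq_single_of_mem ((2 * x + 1) ^ 2, 2 ^ i * (2 * y + 1) ^ 2)
      (Finset.HasAntidiagonal.mem_antidiagonal.2 h.symm)]
    · simp only
      rw [coeff_expand_mul, coeff_Delta, coeff_Delta, if_pos ⟨x, rfl⟩, if_pos ⟨y, rfl⟩, one_mul]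
    · intro kl hkl hkl'
      by_contra h1
      obtain ⟨u, v, rfl⟩ := hne kl hkl h1
      have h2 := (Finset.HasAntidiagonal.mem_antidiagonal.1 hkl).symm
      obtain ⟨h3, h4⟩ := unique_sq_add_mul_sq hp (d := 2 ^ i)
        (by simpa using Nat.pow_le_pow_right two_pos (Nat.one_le_iff_ne_zero.2 hi))
        (Nat.succ_pos _) (Nat.succ_pos _) h h2
      refine hkl' (Prod.ext ?_ ?_)
      · exact congrArg (· ^ 2) h3.symm
      · exact congrArg (2 ^ i * · ^ 2) h4.symm

theorem exists_odd_iff {p d : ℕ} (hp : p.Prime) (hp2 : p ≠ 2) (hd : Even d) :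
    (∃ x y : ℕ, p = (2 * x + 1) ^ 2 + d * (2 * y + 1) ^ 2) ↔
      ∃ r s : ℤ, Odd s ∧ (p : ℤ) = r ^ 2 + d * s ^ 2 := by
  constructor
  · rintro ⟨x, y, h⟩
    exact ⟨2 * x + 1, 2 * y + 1, ⟨y, rfl⟩, by exact_mod_cast h⟩
  · rintro ⟨r, s, hs, h⟩
    have h1 : p = r.natAbs ^ 2 + d * s.natAbs ^ 2 := by
      zify
      rw [sq_abs, sq_abs, h]
    have hr : Odd (r.natAbs) := by
      have h2 := h1 ▸ hp.odd_of_ne_two hp2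
      rw [Nat.odd_add] at h2
      exact (Nat.odd_pow_iff two_ne_zero).1 (h2.2 (hd.mul_right _))
    obtain ⟨x, hx⟩ := hr
    obtain ⟨y, hy⟩ := Int.natAbs_odd.2 hs
    exact ⟨x, y, by rw [h1, hx, hy]⟩

theorem coeff_Delta_nine_prime {p : ℕ} (hp : p.Prime) (hp2 : p ≠ 2) :
    coeff p (Delta ^ 9) = 1 ↔ ∃ r s : ℤ, Odd s ∧ (p : ℤ) = r ^ 2 + 8 * s ^ 2 :=
  (coeff_Delta_mul_prime hp 3 (by norm_num)).trans (exists_odd_iff hp hp2 (by decide))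

theorem coeff_Delta_seventeen_prime {p : ℕ} (hp : p.Prime) (hp2 : p ≠ 2) :
    coeff p (Delta ^ 17) = 1 ↔ ∃ r s : ℤ, Odd s ∧ (p : ℤ) = r ^ 2 + 16 * s ^ 2 :=
  (coeff_Delta_mul_prime hp 4 (by norm_num)).trans (exists_odd_iff hp hp2 (by decide))

theorem exists_of_sq_add_sq {p a c : ℕ} (h : p % 8 = 5) (ha : Odd a) (hc : Even c)
    (hac : p = a ^ 2 + c ^ 2) : ∃ x y : ℕ, p = (2 * x + 1) ^ 2 + 4 * (2 * y + 1) ^ 2 := by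
  obtain ⟨x, rfl⟩ := ha
  obtain ⟨b, rfl⟩ := hc
  rcases Nat.even_or_odd' b with ⟨y, rfl | rfl⟩
  · exfalso
    obtain ⟨e, he⟩ := Nat.even_mul_succ_self x
    have : p = 4 * (x * (x + 1)) + 1 + 16 * y ^ 2 := by rw [hac]; ring
    omega
  · exact ⟨x, y, by rw [hac]; ring⟩

/-- A prime 5 modulo 8 is a sum of two squares, and modulo 8 its even term must be 4 times an odd
square. -/
theorem coeff_Delta_five_prime {p : ℕ} (hp : p.Prime) :
    coeff p (Delta ^ 5) = 1 ↔ p ≡ 5 [MOD 8] := by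
  constructor
  · intro h
    by_contra h'
    rw [coeff_Delta_pow_of_mod_ne 5 h'] at h
    exact zero_ne_one h
  · intro h
    rw [Nat.ModEq] at h
    have : Fact p.Prime := ⟨hp⟩
    obtain ⟨a, b, hab⟩ := Nat.Prime.sq_add_sq (p := p) (by omega)
    have hodd : Odd (a ^ 2 + b ^ 2) := Nat.odd_iff.2 (by omega)
    rw [Nat.odd_add, Nat.odd_pow_iff two_ne_zero, Nat.even_pow' two_ne_zero] at hodd
    refine (coeff_Delta_mul_prime hp 2 (by norm_num)).2 ?_
    rcases Nat.even_or_odd b with hb | hb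
    · exact exists_of_sq_add_sq h (hodd.2 hb) hb hab.symm
    · refine exists_of_sq_add_sq h hb (c := a) ?_ (by rw [← hab, add_comm])
      rw [← Nat.not_odd_iff_even, hodd, Nat.not_even_iff_odd]
      exact hb

end ModTwo

end HeckeModTwo

namespace HeckeModTwo

open PowerSeries

/-! ### Changing generators modulo terms of degree two. -/

section Generators

variable {F R : Type*} [CommRing F] [Ring R] [Algebra F R]

/-- The span of the monomials of degree at least `d` in `u` and `v`. -/
def degreeSpan (F : Type*) {R : Type*} [CommRing F] [Ring R] [Algebra F R] (u v : R) (d : ℕ) :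
    Submodule F R :=
  Submodule.span F {w | ∃ i j, d ≤ i + j ∧ w = u ^ i * v ^ j}

theorem pow_mul_pow_mem_degreeSpan (u v : R) {d i j : ℕ} (h : d ≤ i + j) :
    u ^ i * v ^ j ∈ degreeSpan F u v d :=
  Submodule.subset_span ⟨i, j, h, rfl⟩

theorem degreeSpan_anti (u v : R) {d e : ℕ} (h : d ≤ e) :
    degreeSpan F u v e ≤ degreeSpan F u v d :=
  Submodule.span_mono fun _ ⟨i, j, hij, hw⟩ => ⟨i, j, h.trans hij, hw⟩

theorem mul_mem_degreeSpan {u v : R} (huv : Commute u v) {d e : ℕ} {a b : R}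
    (ha : a ∈ degreeSpan F u v d) (hb : b ∈ degreeSpan F u v e) :
    a * b ∈ degreeSpan F u v (d + e) := by
  have h := Submodule.mul_mem_mul ha hb
  rw [degreeSpan, degreeSpan, Submodule.span_mul_span] at h
  refine Submodule.span_mono ?_ h
  rintro _ ⟨_, ⟨i, j, hij, rfl⟩, _, ⟨k, l, hkl, rfl⟩, rfl⟩
  refine ⟨i + k, j + l, by omega, ?_⟩
  dsimp only
  rw [pow_add, pow_add, mul_assoc, ← mul_assoc (v ^ j), ((huv.pow_pow k j).eq).symm]
  simp only [mul_assoc]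

theorem pow_sub_pow_mem_degreeSpan {u v x w : R} (huv : Commute u v)
    (hw : w ∈ degreeSpan F u v 1) (hx : x - w ∈ degreeSpan F u v 2) (i : ℕ) :
    x ^ i ∈ degreeSpan F u v i ∧ x ^ i - w ^ i ∈ degreeSpan F u v (i + 1) := by
  have hx1 : x ∈ degreeSpan F u v 1 := by
    rw [← sub_add_cancel x w]
    exact add_mem (degreeSpan_anti u v one_le_two hx) hw
  have hp : ∀ y ∈ degreeSpan F u v 1, ∀ i : ℕ, y ^ i ∈ degreeSpan F u v i := by
    intro y hy i
    induction i with
    | zero =>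
      have := pow_mul_pow_mem_degreeSpan (F := F) u v (le_refl (0 + 0))
      simpa using this
    | succ i ih =>
      rw [pow_succ]
      exact mul_mem_degreeSpan huv ih hy
  refine ⟨hp x hx1 i, ?_⟩
  induction i with
  | zero => simp
  | succ i ih =>
    rw [show x ^ (i + 1) - w ^ (i + 1) = x ^ i * (x - w) + (x ^ i - w ^ i) * w by
      rw [pow_succ, pow_succ]
      noncomm_ring]
    exact add_mem (mul_mem_degreeSpan huv (hp x hx1 i) hx : _ ∈ degreeSpan F u v (i + 2))
      (mul_mem_degreeSpan huv ih hw)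

theorem sum_sub_mem_degreeSpan (u v : R) {S : Finset (ℕ × ℕ)} {c : ℕ → ℕ → F} {k l : ℕ}
    (hkl : k + l = 1) (hS : (k, l) ∈ S) (h0 : c 0 0 = 0) (h1 : c k l = 1) (h2 : c l k = 0) :
    ∑ ij ∈ S, c ij.1 ij.2 • (u ^ ij.1 * v ^ ij.2) - u ^ k * v ^ l ∈ degreeSpan F u v 2 := by
  rw [← Finset.add_sum_erase _ _ hS, h1, one_smul, add_sub_cancel_left]
  refine Submodule.sum_mem _ ?_
  rintro ⟨i, j⟩ hij
  by_cases h : 2 ≤ i + j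
  · exact Submodule.smul_mem _ _ (pow_mul_pow_mem_degreeSpan _ _ h)
  · suffices h' : c i j = 0 by
      rw [h', zero_smul]
      exact zero_mem _
    have h3 : ¬ (i = k ∧ j = l) := fun h => (Finset.mem_erase.1 hij).1 (Prod.ext h.1 h.2)
    have h4 : i = 0 ∧ j = 0 ∨ i = l ∧ j = k := by omega
    rcases h4 with ⟨rfl, rfl⟩ | ⟨rfl, rfl⟩
    · exact h0
    · exact h2

/-- Since x ≡ u and y ≡ v modulo degree 2, x^i y^j ≡ u^i v^j modulo higher degree. Descending
induction on the degree starts at N, where all monomials vanish. -/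
theorem pow_mul_pow_mem_of_nilpotent {u v x y : R} (huv : Commute u v) {N : ℕ}
    (hN : ∀ i j, N ≤ i + j → u ^ i * v ^ j = 0) (hx : x - u ∈ degreeSpan F u v 2)
    (hy : y - v ∈ degreeSpan F u v 2) {B : Subalgebra F R} (hxB : x ∈ B) (hyB : y ∈ B) (i j : ℕ) :
    u ^ i * v ^ j ∈ B := by
  have hu : u ∈ degreeSpan F u v 1 := by
    simpa using pow_mul_pow_mem_degreeSpan (F := F) u v (le_refl (1 + 0))
  have hv : v ∈ degreeSpan F u v 1 := by
    simpa using pow_mul_pow_mem_degreeSpan (F := F) u v (le_refl (0 + 1))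
  suffices h : ∀ k d, N ≤ d + k → degreeSpan F u v d ≤ Subalgebra.toSubmodule B from
    h N 0 (by omega) (pow_mul_pow_mem_degreeSpan u v (Nat.zero_le _))
  intro k
  induction k with
  | zero =>
    intro d hd
    refine Submodule.span_le.2 ?_
    rintro _ ⟨i, j, hij, rfl⟩
    rw [hN i j (by omega)]
    exact zero_mem _
  | succ k ih =>
    intro d hd
    refine Submodule.span_le.2 ?_
    rintro _ ⟨i, j, hij, rfl⟩
    have hX := pow_sub_pow_mem_degreeSpan huv hu hx i
    have hY := pow_sub_pow_mem_degreeSpan huv hv hy j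
    have hv' : v ^ j ∈ degreeSpan F u v j := by
      simpa using pow_mul_pow_mem_degreeSpan (F := F) u v (le_refl (0 + j))
    have h1 : x ^ i * y ^ j - u ^ i * v ^ j ∈ degreeSpan F u v (d + 1) := by
      rw [show x ^ i * y ^ j - u ^ i * v ^ j =
        x ^ i * (y ^ j - v ^ j) + (x ^ i - u ^ i) * v ^ j by noncomm_ring]
      exact degreeSpan_anti u v (by omega) (add_mem
        (degreeSpan_anti u v (by omega) (mul_mem_degreeSpan huv hX.1 hY.2))
        (degreeSpan_anti u v (by omega : i + j + 1 ≤ _) (mul_mem_degreeSpan huv hX.2 hv')))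
    rw [← sub_sub_cancel (x ^ i * y ^ j) (u ^ i * v ^ j)]
    exact sub_mem (S := Submodule F R) (B.mul_mem (B.pow_mem hxB i) (B.pow_mem hyB j))
      (ih (d + 1) (by omega) h1)

end Generators

end HeckeModTwo

namespace HeckeModTwo

open PowerSeries

/-! ### The Hecke operators as elements of the projective limit. -/

section HeckeElements

/-- The action of `A` on `F(n)`. -/
noncomputable def evalAt (n : ℕ) : heckeAlgebra →ₐ[ZMod 2] Module.End (ZMod 2) (cuspSpace n) :=
  (heckeAlgebraAt n).val.comp ((Pi.evalAlgHom (ZMod 2) (fun n => heckeAlgebraAt n) n).comp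
    heckeAlgebra.val)

theorem evalAt_apply (n : ℕ) (t : heckeAlgebra) : evalAt n t = (t.1 n).1 := rfl

/-- The restriction of `T_p` to `F(n)`. -/
noncomputable def heckeRestrict {p : ℕ} (hp : p.Prime ∧ p ≠ 2) (n : ℕ) :
    Module.End (ZMod 2) (cuspSpace n) :=
  (heckeOp p).restrict fun _ hf => heckeOp_mem_cuspSpace hp.1 hp.2 hf

open Classical in
/-- The Hecke operator `T_p` as an element of `A`. -/
noncomputable def heckeElement (p : ℕ) : heckeAlgebra :=
  if hp : p.Prime ∧ p ≠ 2 then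
    ⟨fun n => ⟨heckeRestrict hp n, Algebra.subset_adjoin ⟨p, hp.1, hp.2, fun _ => rfl⟩⟩,
      fun _ _ => rfl⟩
  else 0

theorem actsAsHecke_heckeElement {p : ℕ} (hp : p.Prime) (hp2 : p ≠ 2) :
    ActsAsHecke p (heckeElement p) := by
  intro n f
  rw [heckeElement, dif_pos ⟨hp, hp2⟩]
  rfl

theorem coe_evalAt_heckeElement {p : ℕ} (hp : p.Prime) (hp2 : p ≠ 2) (n : ℕ) (f : cuspSpace n) :
    (evalAt n (heckeElement p) f : PowerSeries (ZMod 2)) = heckeOp p f :=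
  actsAsHecke_heckeElement hp hp2 n f

theorem coe_evalAt_heckeElement_pow {p : ℕ} (hp : p.Prime) (hp2 : p ≠ 2) (n i : ℕ)
    (f : cuspSpace n) :
    ((evalAt n (heckeElement p) ^ i) f : PowerSeries (ZMod 2)) = (heckeOp p ^ i) f := by
  induction i with
  | zero => rfl
  | succ i ih =>
    rw [pow_succ', pow_succ', Module.End.mul_apply, Module.End.mul_apply,
      coe_evalAt_heckeElement hp hp2, ih]

theorem coe_evalAt_monomial (n i j : ℕ) (f : cuspSpace n) :
    ((evalAt n (heckeElement 3) ^ i * evalAt n (heckeElement 5) ^ j) f : PowerSeries (ZMod 2)) =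
      (heckeOp 3 ^ i * heckeOp 5 ^ j) f := by
  rw [Module.End.mul_apply, Module.End.mul_apply,
    coe_evalAt_heckeElement_pow Nat.prime_three (by norm_num),
    coe_evalAt_heckeElement_pow Nat.prime_five (by norm_num)]

theorem evalAt_monomial_eq_zero {n i j : ℕ} (h : nilpotencyBound n ≤ i + j) :
    evalAt n (heckeElement 3) ^ i * evalAt n (heckeElement 5) ^ j = 0 := by
  refine LinearMap.ext fun f => Subtype.ext ?_
  rw [coe_evalAt_monomial, heckeOp_pow_mul_pow_cuspSpace h f.2]
  rfl

/-- The indices of the monomials in `T₃` and `T₅` that can be nonzero on `F(n)`. -/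
noncomputable def monomialIndices (n : ℕ) : Finset (ℕ × ℕ) :=
  Finset.range (nilpotencyBound n) ×ˢ Finset.range (nilpotencyBound n)

theorem nilpotencyBound_le_of_notMem {n : ℕ} {ij : ℕ × ℕ} (h : ij ∉ monomialIndices n) :
    nilpotencyBound n ≤ ij.1 + ij.2 := by
  rw [monomialIndices, Finset.mem_product, Finset.mem_range, Finset.mem_range] at h
  omega

theorem mem_heckeAlgebraAt_eq_sum {p : ℕ} (hp : p.Prime) (hp2 : p ≠ 2) {n : ℕ}
    {g : Module.End (ZMod 2) (cuspSpace n)}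
    (hg : ∀ f : cuspSpace n, (g f : PowerSeries (ZMod 2)) = heckeOp p f) :
    g = ∑ ij ∈ monomialIndices n, coeff p (dualBasis ij.1 ij.2) •
      (evalAt n (heckeElement 3) ^ ij.1 * evalAt n (heckeElement 5) ^ ij.2) := by
  refine LinearMap.ext fun f => Subtype.ext ?_
  rw [hg, heckeOp_eq_sum hp hp2 f.2, LinearMap.sum_apply, AddSubmonoidClass.coe_finsetSum]
  refine Finset.sum_congr rfl fun ij _ => ?_
  rw [LinearMap.smul_apply, Submodule.coe_smul, coe_evalAt_monomial]

instance (n : ℕ) : DiscreteTopology (heckeAlgebraAt n) := ⟨rfl⟩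

set_option maxHeartbeats 1000000 in
-- Convergence in the limit is componentwise, and on each F(n) only finitely many monomials are
-- nonzero, so the sum is finite there.
theorem isExpansion_iff_forall {t : heckeAlgebra} {c : ℕ → ℕ → ZMod 2} :
    IsExpansion (heckeElement 3) (heckeElement 5) t c ↔
    ∀ n, evalAt n t = ∑ ij ∈ monomialIndices n, c ij.1 ij.2 •
      (evalAt n (heckeElement 3) ^ ij.1 * evalAt n (heckeElement 5) ^ ij.2) := by
  have h1 : IsExpansion (heckeElement 3) (heckeElement 5) t c ↔ ∀ n, HasSum
      (fun ij : ℕ × ℕ => (c ij.1 ij.2 • (heckeElement 3 ^ ij.1 * heckeElement 5 ^ ij.2)).1 n)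
      (t.1 n) := by
    rw [← Pi.hasSum]
    exact (Topology.IsInducing.hasSum_iff (g := heckeAlgebra.val)
      Topology.IsInducing.subtypeVal _ _).symm
  rw [h1]
  refine forall_congr' fun n => ?_
  have h2 : ∀ ij : ℕ × ℕ, evalAt n (c ij.1 ij.2 • (heckeElement 3 ^ ij.1 * heckeElement 5 ^ ij.2)) =
      c ij.1 ij.2 • (evalAt n (heckeElement 3) ^ ij.1 * evalAt n (heckeElement 5) ^ ij.2) := by
    intro ij
    simp only [map_smul, map_mul, map_pow]
  have h3 : HasSum
      (fun ij : ℕ × ℕ => (c ij.1 ij.2 • (heckeElement 3 ^ ij.1 * heckeElement 5 ^ ij.2)).1 n)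
      (∑ ij ∈ monomialIndices n,
        (c ij.1 ij.2 • (heckeElement 3 ^ ij.1 * heckeElement 5 ^ ij.2)).1 n) := by
    refine hasSum_sum_of_ne_finset_zero fun ij hij => Subtype.ext ?_
    exact (h2 ij).trans
      (by rw [evalAt_monomial_eq_zero (nilpotencyBound_le_of_notMem hij), smul_zero]; rfl)
  have h4 : ((∑ ij ∈ monomialIndices n,
      (c ij.1 ij.2 • (heckeElement 3 ^ ij.1 * heckeElement 5 ^ ij.2)).1 n : heckeAlgebraAt n) :
      Module.End (ZMod 2) (cuspSpace n)) = ∑ ij ∈ monomialIndices n, c ij.1 ij.2 •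
      (evalAt n (heckeElement 3) ^ ij.1 * evalAt n (heckeElement 5) ^ ij.2) := by
    rw [AddSubmonoidClass.coe_finsetSum]
    exact Finset.sum_congr rfl fun ij _ => h2 ij
  rw [← h4, evalAt_apply]
  constructor
  · intro h
    rw [h.unique h3]
  · intro h
    rw [Subtype.ext h]
    exact h3

set_option maxHeartbeats 1000000 in
theorem isExpansion_iff {p : ℕ} (hp : p.Prime) (hp2 : p ≠ 2) (c : ℕ → ℕ → ZMod 2) :
    IsExpansion (heckeElement 3) (heckeElement 5) (heckeElement p) c ↔
      ∀ i j, c i j = coeff p (dualBasis i j) := by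
  classical
  rw [isExpansion_iff_forall]
  constructor
  · intro h i j
    -- Uniqueness: evaluating at the dual vector and taking the coefficient of q isolates c i j.
    obtain ⟨n, hn⟩ := exists_mem_cuspSpace (dualBasis_mem i j)
    have h1 := congrArg (fun g : Module.End (ZMod 2) (cuspSpace n) =>
      coeff 1 ((g ⟨dualBasis i j, hn⟩ : cuspSpace n) : PowerSeries (ZMod 2))) (h n)
    rw [coe_evalAt_heckeElement hp hp2, coeff_one_heckeOp hp, LinearMap.sum_apply,
      AddSubmonoidClass.coe_finsetSum, map_sum] at h1
    have h2 : ∀ kl ∈ monomialIndices n, coeff 1 (((c kl.1 kl.2 •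
        (evalAt n (heckeElement 3) ^ kl.1 * evalAt n (heckeElement 5) ^ kl.2))
        ⟨dualBasis i j, hn⟩ : cuspSpace n) : PowerSeries (ZMod 2)) =
        if (i, j) = kl then c i j else 0 := by
      rintro ⟨k, l⟩ -
      rw [LinearMap.smul_apply, Submodule.coe_smul, coe_evalAt_monomial, map_smul, ← dualForm_apply,
        dualForm_dualBasis, smul_eq_mul]
      by_cases h : k = i ∧ l = j
      · obtain ⟨rfl, rfl⟩ := h
        simp
      · rw [if_neg h, mul_zero, if_neg fun h' => h
          ⟨(congrArg Prod.fst h').symm, (congrArg Prod.snd h').symm⟩]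
    rw [Finset.sum_congr rfl h2, Finset.sum_ite_eq, if_pos] at h1
    · exact h1.symm
    · by_contra hij
      have h3 := dualForm_dualBasis i j i j
      rw [dualForm_apply, heckeOp_pow_mul_pow_cuspSpace (nilpotencyBound_le_of_notMem hij) hn,
        map_zero, if_pos ⟨rfl, rfl⟩] at h3
      exact zero_ne_one h3
  · intro h n
    simp only [h]
    exact mem_heckeAlgebraAt_eq_sum hp hp2 (coe_evalAt_heckeElement hp hp2 n)

theorem coeff_Delta_prime {p : ℕ} (hp : p.Prime) : coeff p Delta = 0 := by
  classical
  rw [coeff_Delta, if_neg]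
  rintro ⟨m, rfl⟩
  exact hp.prime.irreducible.not_isSquare ⟨2 * m + 1, sq _⟩

set_option maxHeartbeats 1000000 in
theorem evalAt_sub_mem_degreeSpan {p : ℕ} (hp : p.Prime) (hp2 : p ≠ 2) (n : ℕ) {k l : ℕ}
    (hkl : k + l = 1) (h : coeff p (dualBasis k l) = 1) (h' : coeff p (dualBasis l k) = 0) :
    evalAt n (heckeElement p) - evalAt n (heckeElement 3) ^ k * evalAt n (heckeElement 5) ^ l ∈
      degreeSpan (ZMod 2) (evalAt n (heckeElement 3)) (evalAt n (heckeElement 5)) 2 := by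
  have hmem : (k, l) ∈ monomialIndices n := by
    -- The summand 2 in `nilpotencyBound` keeps the degree-one monomials in the index set for every
    -- n.
    rw [monomialIndices, Finset.mem_product, Finset.mem_range, Finset.mem_range, nilpotencyBound]
    dsimp only
    omega
  have h0 : coeff p (dualBasis 0 0) = 0 := by rw [dualBasis_zero_zero, coeff_Delta_prime hp]
  rw [mem_heckeAlgebraAt_eq_sum hp hp2 (coe_evalAt_heckeElement hp hp2 n)]
  exact sum_sub_mem_degreeSpan (c := fun i j => coeff p (dualBasis i j)) _ _ hkl hmem h0 h h'

set_option maxHeartbeats 1000000 in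
theorem heckeAlgebraAt_le_adjoin {p p' : ℕ} (hp : p.Prime) (hp' : p'.Prime)
    (h : p ≡ 3 [MOD 8]) (h' : p' ≡ 5 [MOD 8]) (n : ℕ) : heckeAlgebraAt n ≤
      Algebra.adjoin (ZMod 2) {evalAt n (heckeElement p), evalAt n (heckeElement p')} := by
  have hp2 : p ≠ 2 := by rintro rfl; exact absurd h (by decide)
  have hp2' : p' ≠ 2 := by rintro rfl; exact absurd h' (by decide)
  have h10 := (coeff_Delta_three_prime hp).2 h
  have h01 : coeff p (Delta ^ 5) = 0 :=
    coeff_Delta_pow_of_mod_ne 5 (by rw [Nat.ModEq] at h; omega)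
  have h10' : coeff p' (Delta ^ 3) = 0 :=
    coeff_Delta_pow_of_mod_ne 3 (by rw [Nat.ModEq] at h'; omega)
  have h01' := (coeff_Delta_five_prime hp').2 h'
  rw [← dualBasis_one_zero] at h10 h10'
  rw [← dualBasis_zero_one] at h01 h01'
  have hx := evalAt_sub_mem_degreeSpan hp hp2 n (k := 1) (l := 0) rfl h10 h01
  have hy := evalAt_sub_mem_degreeSpan hp' hp2' n (k := 0) (l := 1) rfl h01' h10'
  rw [pow_one, pow_zero, mul_one] at hx
  rw [pow_one, pow_zero, one_mul] at hy
  have hcomm : Commute (evalAt n (heckeElement 3)) (evalAt n (heckeElement 5)) := by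
    refine LinearMap.ext fun f => Subtype.ext ?_
    rw [Module.End.mul_apply, Module.End.mul_apply,
      coe_evalAt_heckeElement Nat.prime_three (by norm_num),
      coe_evalAt_heckeElement Nat.prime_five (by norm_num),
      coe_evalAt_heckeElement Nat.prime_five (by norm_num),
      coe_evalAt_heckeElement Nat.prime_three (by norm_num)]
    exact LinearMap.congr_fun (heckeOp_commute Nat.prime_three Nat.prime_five).eq f.1
  refine Algebra.adjoin_le ?_
  rintro g ⟨q, hq, hq2, hg⟩
  rw [mem_heckeAlgebraAt_eq_sum hq hq2 hg]
  refine sum_mem fun ij _ => Subalgebra.smul_mem _ ?_ _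
  exact pow_mul_pow_mem_of_nilpotent hcomm (fun i j => evalAt_monomial_eq_zero) hx hy
    (Algebra.subset_adjoin (Set.mem_insert _ _))
    (Algebra.subset_adjoin (Set.mem_insert_of_mem _ (Set.mem_singleton _))) _ _

theorem apply_eq_of_le {t u : heckeAlgebra} {m n : ℕ} (hmn : m ≤ n) (h : t.1 n = u.1 n) :
    t.1 m = u.1 m := by
  induction n, hmn using Nat.le_induction with
  | base => exact h
  | succ n _ ih =>
    refine ih (Subtype.ext (LinearMap.ext fun f => ?_))
    refine Submodule.inclusion_injective (cuspSpace_le_succ n) ?_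
    rw [← t.2 n f, ← u.2 n f, h]

theorem dense_adjoin {p p' : ℕ} (hp : p.Prime) (hp' : p'.Prime)
    (h : p ≡ 3 [MOD 8]) (h' : p' ≡ 5 [MOD 8]) :
    Dense (Algebra.adjoin (ZMod 2) {heckeElement p, heckeElement p'} : Set heckeAlgebra) := by
  intro u
  rw [mem_closure_iff]
  intro O hO hu
  obtain ⟨O', hO', rfl⟩ := isOpen_induced_iff.1 hO
  -- A basic neighbourhood constrains finitely many components, and all of them are determined by
  -- the one of largest index.
  obtain ⟨I, U, hU, hsub⟩ := isOpen_pi_iff.1 hO' u.1 hu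
  have h1 : evalAt (I.sup id) u ∈
      Algebra.adjoin (ZMod 2) {evalAt (I.sup id) (heckeElement p),
        evalAt (I.sup id) (heckeElement p')} :=
    heckeAlgebraAt_le_adjoin hp hp' h h' _ (u.1 (I.sup id)).2
  rw [← Set.image_pair, ← AlgHom.map_adjoin] at h1
  obtain ⟨b, hb, hbu⟩ := h1
  refine ⟨b, hsub fun i hi => ?_, hb⟩
  rw [apply_eq_of_le (m := i) (Finset.le_sup (f := id) hi) (Subtype.ext hbu)]
  exact (hU i hi).2

end HeckeElements

end HeckeModTwo

theorem mainTheorem10 :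
    ∃ (T : ℕ → HeckeModTwo.heckeAlgebra) (a : ℕ → ℕ → ℕ → ZMod 2),
      -- `T p` is the Hecke operator `T_p`, as an element of `A`
      (∀ p : ℕ, p.Prime → p ≠ 2 → HeckeModTwo.ActsAsHecke p (T p)) ∧
      -- `a i j p` are the coefficients of the unique expansion of `T_p` in `T_3` and `T_5`
      (∀ p : ℕ, p.Prime → p ≠ 2 → ∀ c : ℕ → ℕ → ZMod 2,
        HeckeModTwo.IsExpansion (T 3) (T 5) (T p) c ↔ ∀ i j : ℕ, c i j = a i j p) ∧
      (∀ p : ℕ, p.Prime → p ≠ 2 →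
        a 0 0 p = 0 ∧
        (a 1 0 p = 1 ↔ p ≡ 3 [MOD 8]) ∧
        (a 0 1 p = 1 ↔ p ≡ 5 [MOD 8]) ∧
        (a 1 1 p = 1 ↔ p ≡ 7 [MOD 16]) ∧
        (a 2 0 p = 1 ↔ ∃ r s : ℤ, Odd s ∧ (p : ℤ) = r ^ 2 + 8 * s ^ 2) ∧
        (a 0 2 p = 1 ↔ ∃ r s : ℤ, Odd s ∧ (p : ℤ) = r ^ 2 + 16 * s ^ 2)) ∧
      -- `A` is topologically generated by `T_p` and `T_{p'}`
      (∀ p p' : ℕ, p.Prime → p'.Prime → p ≡ 3 [MOD 8] → p' ≡ 5 [MOD 8] →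
        Dense (Algebra.adjoin (ZMod 2) {T p, T p'} : Set HeckeModTwo.heckeAlgebra)) := by
  refine ⟨HeckeModTwo.heckeElement,
    fun i j p => PowerSeries.coeff p (HeckeModTwo.dualBasis i j),
    fun p hp hp2 => HeckeModTwo.actsAsHecke_heckeElement hp hp2,
    fun p hp hp2 c => HeckeModTwo.isExpansion_iff hp hp2 c, fun p hp hp2 => ?_,
    fun p p' hp hp' h h' => HeckeModTwo.dense_adjoin hp hp' h h'⟩
  beta_reduce
  rw [HeckeModTwo.dualBasis_zero_zero, HeckeModTwo.dualBasis_one_zero,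
    HeckeModTwo.dualBasis_zero_one, HeckeModTwo.dualBasis_one_one, HeckeModTwo.dualBasis_two_zero,
    HeckeModTwo.dualBasis_zero_two]
  exact ⟨HeckeModTwo.coeff_Delta_prime hp, HeckeModTwo.coeff_Delta_three_prime hp,
    HeckeModTwo.coeff_Delta_five_prime hp, HeckeModTwo.coeff_Delta_seven_prime hp,
    HeckeModTwo.coeff_Delta_nine_prime hp hp2, HeckeModTwo.coeff_Delta_seventeen_prime hp hp2⟩
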